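/- Let $\mathbb K$ be a field of characteristic zero and let $(X,\mathcal O)$ be a ringed space whose structure sheaf $\mathcal O$ is a sheaf of commutative $\mathbb K$-algebras. Let $(\mathcal L,[\cdot,\cdot],\mathfrak a)$ be a Lie algebroid over $(X,\mathcal O)$, that is, an $\mathcal O$-module which is a sheaf of $\mathbb K$-Lie algebras, with an $\mathcal O$-linear morphism of sheaves of Lie algebras $\mathfrak a:\mathcal L\to\mathcal Der_{\mathbb K}(\mathcal O)$ such that $[D,fD']=f[D,D']+\mathfrak a(D)(f)\,D'$. Assume that $\mathcal L$ is locally free as an $\mathcal O$-module (of possibly infinite rank). Let $\omega$ be a $2$-cocycle of $\mathcal L$ with values in $\mathcal O$, that is, an alternating $\mathcal O$-bilinear form $\mathcal L\times\mathcal L\to\mathcal O$ with $$\mathfrak a(D_1)\omega(D_2,D_3)-\mathfrak a(D_2)\omega(D_1,D_3)+\mathfrak a(D_3)\omega(D_1,D_2)-\omega([D_1,D_2],D_3)+\omega([D_1,D_3],D_2)-\omega([D_2,D_3],D_1)=0 .$$ Let $\mathcal L_\omega=\mathcal O s\oplus\mathcal L$ be the sheaf of $\mathbb K$-Lie algebras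 with bracket $$[fs+D,\,gs+D']_\omega=\bigl(\mathfrak a(D)(g)-\mathfrak a(D')(f)+\omega(D,D')\bigr)s+[D,D'] .$$ For $V\subseteq X$ open let $U^+(V)$ be the non-unital subalgebra generated by $\mathcal L_\omega(V)$ in the universal enveloping algebra over $\mathbb K$ of the Lie algebra $\mathcal L_\omega(V)$, and let $J_\omega(V)\subseteq U^+(V)$ be the two-sided ideal generated by the elements $f\tilde D-(fs)\cdot\tilde D$ with $f\in\mathcal O(V)$, $\tilde D\in\mathcal L_\omega(V)$. The quotient $U^+(V)/J_\omega(V)$ is a unital algebra with unit $s$. The twisted universal enveloping algebroid $\mathscr U=\mathscr U(\mathcal O,\mathcal L,\omega)$ is the sheafification of $V\mapsto U^+(V)/J_\omega(V)$. Write $\overline D$ for the image in $\mathscr U$ of a section $D$ of $\mathcal L$, and map $\mathcal O$ to $\mathscr U$ by $f\mapsto fs$. Let $\mathscr U_n\subseteq\mathscr U$ be the subsheaf of sections that are locally sums of elements of the image of $\mathcal O$ and of products of at most $n$ elements of the image of $\mathcal L_\omega$, put $\mathscr U_{-1}=0$, and let $gr(\mathscr U)=\bigoplus_{n\ge0}\mathscr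 U_n/\mathscr U_{n-1}$ be the associated sheaf of graded $\mathcal O$-algebras. Let $\mathscr S_{\mathcal O}\mathcal L$ be the sheaf of symmetric algebras of the $\mathcal O$-module $\mathcal L$, with its usual grading. Then there is a unique isomorphism of sheaves of graded $\mathcal O$-algebras $$\mathscr S_{\mathcal O}\mathcal L\;\xrightarrow{\ \sim\ }\;gr\bigl(\mathscr U(\mathcal O,\mathcal L,\omega)\bigr)$$ which, for all $k\ge0$ and all sections $D_1,\dots,D_k$ of $\mathcal L$ over an open set, sends $D_1\cdots D_k$ to the class in $\mathscr U_k/\mathscr U_{k-1}$ of $\frac1{k!}\sum_{\sigma\in S_k}\overline{D_{\sigma(1)}}\cdots\overline{D_{\sigma(k)}}$. -/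

import Mathlib

open scoped DirectSum

namespace TwistedPBW

/-! ### Lie-Rinehart algebras: cocycles, extensions, twisted enveloping algebras -/

section Algebra

universe u v w

/-- A `2`-cocycle of the Chevalley-Eilenberg-de Rham complex of a Lie-Rinehart algebra `(R, L)`
with values in `R`, on which `L` acts through the anchor: an alternating `R`-bilinear form with
vanishing differential. -/
structure TwoCocycle (R : Type v) (L : Type w) [CommRing R] [LieRing L] [Module R L]
    [LieRingModule L R] where
  /-- the underlying bilinear form -/
  form : L →ₗ[R] L →ₗ[R] R
  alternating : ∀ x, form x x = 0
  closed : ∀ x y z,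
    ⁅x, form y z⁆ - ⁅y, form x z⁆ + ⁅z, form x y⁆
      - form ⁅x, y⁆ z + form ⁅x, z⁆ y - form ⁅y, z⁆ x = 0

/-- The underlying module `R s ⊕ L` of the abelian extension of `L` by `R` attached to a
`2`-cocycle. The element `⟨f, D⟩` is `f s + D`. -/
@[ext]
structure Extension {R : Type v} {L : Type w} [CommRing R] [LieRing L] [Module R L]
    [LieRingModule L R] (ω : TwoCocycle R L) : Type (max v w) where
  /-- the coefficient of `s` -/
  fst : R
  /-- the component in `L` -/
  snd : L

namespace Extension

variable {R : Type v} {L : Type w} [CommRing R] [LieRing L] [Module R L]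
  [LieRingModule L R] (ω : TwoCocycle R L)

/-- The identification of the underlying set with `R × L`. -/
def equivProd : Extension ω ≃ R × L where
  toFun a := (a.fst, a.snd)
  invFun p := ⟨p.1, p.2⟩

instance : AddCommGroup (Extension ω) := (equivProd ω).addCommGroup

instance : Module R (Extension ω) := (equivProd ω).module R

instance {K : Type u} [CommRing K] [Algebra K R] [LieAlgebra K L] : Module K (Extension ω) :=
  (equivProd ω).module K

variable {ω}

@[simp] lemma add_fst (a b : Extension ω) : (a + b).1 = a.1 + b.1 := rfl
@[simp] lemma add_snd (a b : Extension ω) : (a + b).2 = a.2 + b.2 := rfl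
@[simp] lemma zero_fst : (0 : Extension ω).1 = 0 := rfl
@[simp] lemma zero_snd : (0 : Extension ω).2 = 0 := rfl
@[simp] lemma smul_fst (r : R) (a : Extension ω) : (r • a).1 = r * a.1 := rfl
@[simp] lemma smul_snd (r : R) (a : Extension ω) : (r • a).2 = r • a.2 := rfl
@[simp] lemma ksmul_fst {K : Type u} [CommRing K] [Algebra K R] [LieAlgebra K L]
    (c : K) (a : Extension ω) : (c • a).1 = c • a.1 := rfl
@[simp] lemma ksmul_snd {K : Type u} [CommRing K] [Algebra K R] [LieAlgebra K L]
    (c : K) (a : Extension ω) : (c • a).2 = c • a.2 := rfl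

variable (ω)

/-- The twisted bracket
`[f s + D, g s + D'] = (D(g) - D'(f) + ω(D, D')) s + [D, D']`. -/
instance : Bracket (Extension ω) (Extension ω) :=
  ⟨fun a b => ⟨⁅a.2, b.1⁆ - ⁅b.2, a.1⁆ + ω.form a.2 b.2, ⁅a.2, b.2⁆⟩⟩

variable {ω}

@[simp] lemma lie_fst (a b : Extension ω) :
    (⁅a, b⁆ : Extension ω).1 = ⁅a.2, b.1⁆ - ⁅b.2, a.1⁆ + ω.form a.2 b.2 := rfl
@[simp] lemma lie_snd (a b : Extension ω) : (⁅a, b⁆ : Extension ω).2 = ⁅a.2, b.2⁆ := rfl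

lemma form_swap (ω : TwoCocycle R L) (x y : L) : ω.form x y = - ω.form y x := by
  have h := ω.alternating (x + y)
  simp only [map_add, LinearMap.add_apply, ω.alternating, zero_add, add_zero] at h
  exact eq_neg_of_add_eq_zero_right h

instance : LieRing (Extension ω) where
  add_lie a b c := by
    ext
    · simp only [lie_fst, add_fst, add_snd, add_lie, lie_add, map_add, LinearMap.add_apply]; abel
    · simp
  lie_add a b c := by
    ext
    · simp only [lie_fst, add_fst, add_snd, add_lie, lie_add, map_add]; abel
    · simp
  lie_self a := by
    ext
    · simp [ω.alternating]
    · simp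
  leibniz_lie a b c := by
    ext
    · have h := ω.closed a.2 b.2 c.2
      simp only [lie_fst, lie_snd, add_fst, lie_add, lie_sub, lie_lie]
      rw [form_swap ω a.2 ⁅b.2, c.2⁆, form_swap ω b.2 ⁅a.2, c.2⁆]
      linear_combination h
    · simp

instance {K : Type u} [CommRing K] [Algebra K R] [LieAlgebra K L] [LieRinehartRing R L]
    [LieRinehartAlgebra K R L] : LieAlgebra K (Extension ω) where
  lie_smul c a b := by
    have hf : ω.form a.2 (c • b.2) = c • ω.form a.2 b.2 := by
      rw [← algebraMap_smul R c b.2, map_smul, algebraMap_smul]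
    ext
    · have hl : ⁅a.2, c • b.1⁆ = c • ⁅a.2, b.1⁆ := LieModule.lie_smul c a.2 b.1
      simp only [lie_fst, ksmul_fst, ksmul_snd, hl, smul_lie, hf, smul_add, smul_sub]
    · simp

end Extension

section Enveloping

variable (K : Type u) {R : Type v} {L : Type w} [CommRing K] [CommRing R] [Algebra K R]
  [LieRing L] [LieAlgebra K L] [Module R L] [LieRingModule L R] [LieRinehartRing R L]
  [LieRinehartAlgebra K R L] (ω : TwoCocycle R L)

/-- The (non-unital) subalgebra of the universal enveloping algebra of the `K`-Lie algebra
`R s ⊕ L` that is generated by `R s ⊕ L`, i.e. the image of the tensors of positive degree. -/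
noncomputable def positivePart :
    NonUnitalSubalgebra K (UniversalEnvelopingAlgebra K (Extension ω)) :=
  NonUnitalAlgebra.adjoin K (Set.range (UniversalEnvelopingAlgebra.ι K (L := Extension ω)))

/-- The canonical map from `R s ⊕ L` to the positive part of its enveloping algebra. -/
noncomputable def toPositive (a : Extension ω) : positivePart K ω :=
  ⟨UniversalEnvelopingAlgebra.ι K a, NonUnitalAlgebra.subset_adjoin K ⟨a, rfl⟩⟩

/-- The two-sided ideal of the positive part generated by all `f • D - (f s) D`. -/
noncomputable def twistingIdeal : TwoSidedIdeal (positivePart K ω) :=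
  TwoSidedIdeal.span {a | ∃ (f : R) (D : Extension ω),
    a = toPositive K ω (f • D) - toPositive K ω ⟨f, 0⟩ * toPositive K ω D}

/-- The twisted universal enveloping algebra of a Lie-Rinehart algebra. -/
def TwistedEnveloping : Type (max u v w) := (twistingIdeal K ω).ringCon.Quotient

namespace TwistedEnveloping

noncomputable instance : NonUnitalRing (TwistedEnveloping K ω) :=
  inferInstanceAs (NonUnitalRing (twistingIdeal K ω).ringCon.Quotient)

/-- The quotient map. -/
noncomputable def mk : positivePart K ω →ₙ+* TwistedEnveloping K ω where
  toFun a := (Quotient.mk'' a : (twistingIdeal K ω).ringCon.Quotient)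
  map_mul' _ _ := rfl
  map_zero' := rfl
  map_add' _ _ := rfl

lemma mk_surjective : Function.Surjective (mk K ω) := Quotient.mk''_surjective

lemma mk_eq_iff (a b : positivePart K ω) : mk K ω a = mk K ω b ↔ a - b ∈ twistingIdeal K ω := by
  rw [← TwoSidedIdeal.rel_iff]
  exact Quotient.eq''

/-- The canonical map from `R s ⊕ L` to the twisted universal enveloping algebra. -/
noncomputable def ι : Extension ω →+ TwistedEnveloping K ω where
  toFun a := mk K ω (toPositive K ω a)
  map_zero' := by
    rw [← map_zero (mk K ω)]; congr 1; exact Subtype.ext (map_zero _)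
  map_add' a b := by
    rw [← map_add (mk K ω)]; congr 1; exact Subtype.ext (map_add _ a b)

lemma ι_smul (f : R) (a : Extension ω) :
    ι K ω (f • a) = ι K ω ⟨f, 0⟩ * ι K ω a := by
  change mk K ω _ = mk K ω _ * mk K ω _
  rw [← map_mul, mk_eq_iff]
  exact TwoSidedIdeal.subset_span ⟨f, a, rfl⟩

lemma ι_lie (a b : Extension ω) :
    ι K ω ⁅a, b⁆ = ι K ω a * ι K ω b - ι K ω b * ι K ω a := by
  change mk K ω _ = mk K ω _ * mk K ω _ - mk K ω _ * mk K ω _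
  rw [← map_mul, ← map_mul, ← map_sub]
  congr 1
  apply Subtype.ext
  let _ := LieRing.ofAssociativeRing (A := UniversalEnvelopingAlgebra K (Extension ω))
  exact (UniversalEnvelopingAlgebra.ι K (L := Extension ω)).map_lie a b

/-- Every element is a sum of non-empty products of elements of `R s ⊕ L`. -/
lemma induction {p : TwistedEnveloping K ω → Prop} (hι : ∀ a, p (ι K ω a))
    (hadd : ∀ a b, p a → p b → p (a + b)) (hmul : ∀ a b, p a → p b → p (a * b))
    (x : TwistedEnveloping K ω) : p x := by
  obtain ⟨⟨y, hy⟩, rfl⟩ := mk_surjective K ω x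
  suffices h : ∀ c : K, p (mk K ω (c • ⟨y, hy⟩)) by simpa using h 1
  let _ := LieRing.ofAssociativeRing (A := UniversalEnvelopingAlgebra K (Extension ω))
  induction hy using NonUnitalAlgebra.adjoin_induction with
  | mem y hy =>
    obtain ⟨a, rfl⟩ := hy
    intro c
    have h := hι (c • a)
    have h' : toPositive K ω (c • a) = c • toPositive K ω a :=
      Subtype.ext (map_smul (UniversalEnvelopingAlgebra.ι K (L := Extension ω)) c a)
    change p (mk K ω _) at h
    rwa [h'] at h
  | add y z hy hz h₁ h₂ =>
    intro c
    have : (c • ⟨y + z, add_mem hy hz⟩ : positivePart K ω) = c • ⟨y, hy⟩ + c • ⟨z, hz⟩ :=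
      smul_add c (⟨y, hy⟩ : positivePart K ω) ⟨z, hz⟩
    rw [this, map_add]
    exact hadd _ _ (h₁ c) (h₂ c)
  | zero =>
    intro c
    have : (c • ⟨0, zero_mem _⟩ : positivePart K ω) = 0 := smul_zero c
    rw [this, map_zero]
    simpa using hι 0
  | mul y z hy hz h₁ h₂ =>
    intro c
    have : (c • ⟨y * z, mul_mem hy hz⟩ : positivePart K ω) = (c • ⟨y, hy⟩) * ⟨z, hz⟩ :=
      (smul_mul_assoc c (⟨y, hy⟩ : positivePart K ω) ⟨z, hz⟩).symm
    rw [this, map_mul]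
    refine hmul _ _ (h₁ c) ?_
    simpa using h₂ 1
  | smul r y hy h =>
    intro c
    have : (c • ⟨r • y, SMulMemClass.smul_mem r hy⟩ : positivePart K ω) = (c * r) • ⟨y, hy⟩ :=
      (mul_smul c r (⟨y, hy⟩ : positivePart K ω)).symm
    rw [this]
    exact h (c * r)

/-- The generator `s` of `R s` is a unit. -/
noncomputable instance : Ring (TwistedEnveloping K ω) where
  one := ι K ω ⟨1, 0⟩
  one_mul x := by
    change ι K ω ⟨1, 0⟩ * x = x
    induction x using induction with
    | hι a => rw [← ι_smul, one_smul]
    | hadd a b ha hb => rw [mul_add, ha, hb]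
    | hmul a b ha hb => rw [← mul_assoc, ha]
  mul_one x := by
    change x * ι K ω ⟨1, 0⟩ = x
    induction x using induction with
    | hι a =>
      have h : (⁅a, (⟨1, 0⟩ : Extension ω)⁆ : Extension ω) = 0 := by
        have h1 : ⁅a.2, (1 : R)⁆ = 0 := by
          have := LieRinehartRing.leibniz_mul_right (A₁ := R) a.2 1 1
          simpa using this
        ext
        · simp [h1]
        · simp
      have h2 := ι_lie K ω a ⟨1, 0⟩
      rw [h, map_zero, ← ι_smul, one_smul] at h2
      exact (sub_eq_zero.mp h2.symm)
    | hadd a b ha hb => rw [add_mul, ha, hb]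
    | hmul a b ha hb => rw [mul_assoc, hb]
  zsmul := zsmulRec
  sub_eq_add_neg := sub_eq_add_neg
  neg_add_cancel := neg_add_cancel

lemma one_def : (1 : TwistedEnveloping K ω) = ι K ω ⟨1, 0⟩ := rfl

/-- The canonical ring homomorphism from `R`, sending `f` to the class of `f s`. -/
noncomputable def scalar : R →+* TwistedEnveloping K ω where
  toFun f := ι K ω ⟨f, 0⟩
  map_one' := rfl
  map_mul' f g := by
    rw [← ι_smul]
    congr 1
    ext <;> simp
  map_zero' := map_zero (ι K ω)
  map_add' f g := by
    rw [← map_add]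
    congr 1
    ext <;> simp

/-- The canonical map from `L`. -/
noncomputable def vector : L →+ TwistedEnveloping K ω where
  toFun D := ι K ω ⟨0, D⟩
  map_zero' := map_zero (ι K ω)
  map_add' f g := by
    rw [← map_add]
    congr 1
    ext <;> simp

lemma ι_smul' (f : R) (a : Extension ω) : ι K ω (f • a) = scalar K ω f * ι K ω a :=
  ι_smul K ω f a

noncomputable instance : Algebra K (TwistedEnveloping K ω) :=
  ((scalar K ω).comp (algebraMap K R)).toAlgebra' fun c x => by
    change scalar K ω _ * x = x * scalar K ω _
    induction x using induction with
    | hι a =>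
      have h : (⁅a, (⟨algebraMap K R c, 0⟩ : Extension ω)⁆ : Extension ω) = 0 := by
        have h1 : ⁅a.2, algebraMap K R c⁆ = 0 := by
          have h2 : ⁅a.2, (1 : R)⁆ = 0 := by
            simpa using LieRinehartRing.leibniz_mul_right (A₁ := R) a.2 1 1
          have h3 : ⁅a.2, c • (1 : R)⁆ = c • ⁅a.2, (1 : R)⁆ :=
            LieModule.lie_smul c a.2 (1 : R)
          rw [Algebra.algebraMap_eq_smul_one, h3, h2, smul_zero]
        ext
        · simp [h1]
        · simp
      have h2 := ι_lie K ω a ⟨algebraMap K R c, 0⟩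
      rw [h, map_zero] at h2
      exact (sub_eq_zero.mp h2.symm).symm
    | hadd a b ha hb => rw [mul_add, add_mul, ha, hb]
    | hmul a b ha hb => rw [← mul_assoc, ha, mul_assoc, hb, mul_assoc]

lemma ι_ksmul (c : K) (a : Extension ω) : ι K ω (c • a) = c • ι K ω a := by
  rw [Algebra.smul_def]
  change _ = scalar K ω (algebraMap K R c) * _
  rw [← ι_smul']
  congr 1
  ext
  · simp [Algebra.smul_def]
  · simp

variable {K ω}

/-- Ring homomorphisms from the twisted enveloping algebra are determined on generators. -/
lemma hom_ext {B : Type*} [Ring B] {φ ψ : TwistedEnveloping K ω →+* B}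
    (h : ∀ a, φ (ι K ω a) = ψ (ι K ω a)) : φ = ψ := by
  ext x
  induction x using induction with
  | hι a => exact h a
  | hadd a b ha hb => rw [map_add, map_add, ha, hb]
  | hmul a b ha hb => rw [map_mul, map_mul, ha, hb]

/-- The universal property of the twisted enveloping algebra. -/
lemma exists_lift {B : Type*} [Ring B] [Algebra K B] (φ : Extension ω →ₗ[K] B)
    (hlie : ∀ a b, φ ⁅a, b⁆ = φ a * φ b - φ b * φ a)
    (hsmul : ∀ (f : R) a, φ (f • a) = φ ⟨f, 0⟩ * φ a)
    (hone : φ ⟨1, 0⟩ = 1) :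
    ∃ ψ : TwistedEnveloping K ω →+* B, ∀ a, ψ (ι K ω a) = φ a := by
  let _ := LieRing.ofAssociativeRing (A := B)
  let _ := LieRing.ofAssociativeRing (A := UniversalEnvelopingAlgebra K (Extension ω))
  let _ : LieAlgebra K B := LieAlgebra.ofAssociativeAlgebra
  let φ' : Extension ω →ₗ⁅K⁆ B := { φ with map_lie' := fun {a b} => hlie a b }
  let F := UniversalEnvelopingAlgebra.lift K φ'
  let G : positivePart K ω →ₙ+* B :=
    { toFun := fun x => F x
      map_mul' := fun x y => map_mul F x.1 y.1
      map_zero' := map_zero F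
      map_add' := fun x y => map_add F x.1 y.1 }
  have hG : ∀ a, G (toPositive K ω a) = φ a := fun a =>
    UniversalEnvelopingAlgebra.lift_ι_apply K φ' a
  have hle : twistingIdeal K ω ≤ TwoSidedIdeal.ker G := by
    refine TwoSidedIdeal.span_le.mpr ?_
    rintro _ ⟨f, a, rfl⟩
    change _ ∈ TwoSidedIdeal.ker G
    rw [TwoSidedIdeal.mem_ker, map_sub, map_mul, hG, hG, hG, hsmul, sub_self]
  let H : TwistedEnveloping K ω → B := fun x => Quotient.liftOn' x G fun a b hab => by
    have h1 : a - b ∈ twistingIdeal K ω := (TwoSidedIdeal.rel_iff _ _ _).mp hab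
    have h2 := (TwoSidedIdeal.mem_ker G).mp (hle h1)
    rw [map_sub] at h2
    exact sub_eq_zero.mp h2
  have hH : ∀ y, H (mk K ω y) = G y := fun _ => rfl
  refine ⟨{ toFun := H, map_one' := (hG _).trans hone, map_mul' := ?_, map_zero' := ?_,
            map_add' := ?_ }, fun a => hG a⟩
  · intro x y
    obtain ⟨x, rfl⟩ := mk_surjective K ω x
    obtain ⟨y, rfl⟩ := mk_surjective K ω y
    rw [← map_mul, hH, hH, hH, map_mul]
  · rw [← map_zero (mk K ω), hH, map_zero]
  · intro x y
    obtain ⟨x, rfl⟩ := mk_surjective K ω x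
    obtain ⟨y, rfl⟩ := mk_surjective K ω y
    rw [← map_add, hH, hH, hH, map_add]

variable (K ω)

/-- The `n`-th step of the ascending filtration: the additive span of the image of `R` and of all
products of at most `n` elements of `R s ⊕ L`. -/
noncomputable def filtration (n : ℕ) : AddSubgroup (TwistedEnveloping K ω) :=
  AddSubgroup.closure (Set.range (scalar K ω) ∪
    {x | ∃ l : List (Extension ω), l.length ≤ n ∧ x = (l.map (ι K ω)).prod})

variable {K ω}

lemma filtration_mono {m n : ℕ} (h : m ≤ n) : filtration K ω m ≤ filtration K ω n := by
  refine AddSubgroup.closure_mono (Set.union_subset_union_right _ ?_)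
  rintro _ ⟨l, hl, rfl⟩
  exact ⟨l, hl.trans h, rfl⟩

lemma scalar_mem_filtration (f : R) (n : ℕ) : scalar K ω f ∈ filtration K ω n :=
  AddSubgroup.subset_closure (Or.inl ⟨f, rfl⟩)

lemma prod_mem_filtration (l : List (Extension ω)) :
    (l.map (ι K ω)).prod ∈ filtration K ω l.length :=
  AddSubgroup.subset_closure (Or.inr ⟨l, le_rfl, rfl⟩)

lemma vector_mem_filtration (D : L) : vector K ω D ∈ filtration K ω 1 := by
  have h := prod_mem_filtration (K := K) (ω := ω) [⟨0, D⟩]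
  rw [List.map_singleton, List.prod_singleton] at h
  exact h

lemma one_mem_filtration (n : ℕ) : (1 : TwistedEnveloping K ω) ∈ filtration K ω n := by
  rw [← map_one (scalar K ω)]
  exact scalar_mem_filtration 1 n

lemma scalar_mul_mem_filtration (f : R) {n : ℕ} {y : TwistedEnveloping K ω}
    (hy : y ∈ filtration K ω n) : scalar K ω f * y ∈ filtration K ω n := by
  suffices h : filtration K ω n ≤
      (filtration K ω n).comap (AddMonoidHom.mulLeft (scalar K ω f)) from h hy
  refine (AddSubgroup.closure_le _).mpr ?_
  rintro _ (⟨g, rfl⟩ | ⟨l, hl, rfl⟩)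
  · change scalar K ω f * scalar K ω g ∈ filtration K ω n
    rw [← map_mul]
    exact scalar_mem_filtration _ n
  · change scalar K ω f * (l.map (ι K ω)).prod ∈ filtration K ω n
    cases l with
    | nil =>
      rw [List.map_nil, List.prod_nil, mul_one]
      exact scalar_mem_filtration _ n
    | cons a l =>
      rw [List.map_cons, List.prod_cons, ← mul_assoc, ← ι_smul']
      have h := prod_mem_filtration (K := K) ((f • a) :: l)
      rw [List.map_cons, List.prod_cons] at h
      exact filtration_mono hl h

lemma ι_mul_scalar (a : Extension ω) (f : R) :
    ι K ω a * scalar K ω f = scalar K ω f * ι K ω a + scalar K ω ⁅a.snd, f⁆ := by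
  have h := ι_lie K ω a ⟨f, 0⟩
  have e : (⁅a, (⟨f, 0⟩ : Extension ω)⁆ : Extension ω) = ⟨⁅a.snd, f⁆, 0⟩ := by
    ext <;> simp
  rw [e] at h
  exact eq_add_of_sub_eq' h.symm

lemma ι_mul_mem_filtration (a : Extension ω) {n : ℕ} {y : TwistedEnveloping K ω}
    (hy : y ∈ filtration K ω n) : ι K ω a * y ∈ filtration K ω (n + 1) := by
  suffices h : filtration K ω n ≤
      (filtration K ω (n + 1)).comap (AddMonoidHom.mulLeft (ι K ω a)) from h hy
  refine (AddSubgroup.closure_le _).mpr ?_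
  rintro _ (⟨g, rfl⟩ | ⟨l, hl, rfl⟩)
  · change ι K ω a * scalar K ω g ∈ filtration K ω (n + 1)
    rw [ι_mul_scalar]
    refine add_mem (scalar_mul_mem_filtration g ?_) (scalar_mem_filtration _ _)
    have h := prod_mem_filtration (K := K) [a]
    rw [List.map_singleton, List.prod_singleton] at h
    exact filtration_mono (Nat.le_add_left 1 n) h
  · change ι K ω a * (l.map (ι K ω)).prod ∈ filtration K ω (n + 1)
    have h := prod_mem_filtration (K := K) (a :: l)
    rw [List.map_cons, List.prod_cons] at h
    exact filtration_mono (Nat.succ_le_succ hl) h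

lemma mul_mem_filtration {m n : ℕ} {x y : TwistedEnveloping K ω}
    (hx : x ∈ filtration K ω m) (hy : y ∈ filtration K ω n) : x * y ∈ filtration K ω (m + n) := by
  suffices h : filtration K ω m ≤
      (filtration K ω (m + n)).comap (AddMonoidHom.mulRight y) from h hx
  refine (AddSubgroup.closure_le _).mpr ?_
  rintro _ (⟨g, rfl⟩ | ⟨l, hl, rfl⟩)
  · exact filtration_mono (Nat.le_add_left n m) (scalar_mul_mem_filtration g hy)
  · refine filtration_mono (Nat.add_le_add_right hl n) ?_
    change (l.map (ι K ω)).prod * y ∈ filtration K ω (l.length + n)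
    clear hl
    induction l with
    | nil =>
      rw [List.map_nil, List.prod_nil, one_mul]
      exact filtration_mono (Nat.le_add_left n _) hy
    | cons a l ih =>
      rw [List.map_cons, List.prod_cons, mul_assoc, List.length_cons, Nat.add_right_comm]
      exact ι_mul_mem_filtration a ih

section Functoriality

variable {R' : Type v} {L' : Type w} [CommRing R'] [Algebra K R']
  [LieRing L'] [LieAlgebra K L'] [Module R' L'] [LieRingModule L' R'] [LieRinehartRing R' L']
  [LieRinehartAlgebra K R' L'] {ω' : TwoCocycle R' L'}

/-- Functoriality of the twisted enveloping algebra: a morphism of Lie-Rinehart algebras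
compatible with the cocycles induces a ring homomorphism. -/
lemma exists_map (σ : R →ₐ[K] R') (F : LieRinehartAlgebra.Hom σ L L')
    (hω : ∀ x y, σ (ω.form x y) = ω'.form (F x) (F y)) :
    ∃ ψ : TwistedEnveloping K ω →+* TwistedEnveloping K ω',
      ∀ a, ψ (ι K ω a) = ι K ω' ⟨σ a.1, F a.2⟩ := by
  refine exists_lift (B := TwistedEnveloping K ω')
    { toFun := fun a => ι K ω' ⟨σ a.1, F a.2⟩
      map_add' := ?_
      map_smul' := ?_ } ?_ ?_ ?_
  · intro a b
    rw [← map_add]; congr 1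
    ext
    · simp
    · exact map_add F.toLieHom a.2 b.2
  · intro c a
    rw [RingHom.id_apply, ← ι_ksmul]; congr 1
    ext
    · simp
    · exact map_smul F.toLieHom c a.2
  · intro a b
    change ι K ω' _ = ι K ω' _ * ι K ω' _ - ι K ω' _ * ι K ω' _
    rw [← ι_lie]; congr 1
    ext
    · simp [hω, F.apply_lie]
    · exact F.toLieHom.map_lie a.2 b.2
  · intro f a
    change ι K ω' _ = ι K ω' _ * ι K ω' _
    have h0 : F (0 : L) = 0 := map_zero F.toLieHom
    change _ = ι K ω' ⟨σ f, F 0⟩ * _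
    rw [h0, ← ι_smul]; congr 1
    ext
    · simp
    · simp [F.map_smul_apply]
  · change ι K ω' ⟨σ 1, F 0⟩ = _
    have h0 : F (0 : L) = 0 := map_zero F.toLieHom
    rw [h0, map_one]; rfl

/-- The ring homomorphism induced by a morphism of Lie-Rinehart algebras. -/
noncomputable def map (σ : R →ₐ[K] R') (F : LieRinehartAlgebra.Hom σ L L')
    (hω : ∀ x y, σ (ω.form x y) = ω'.form (F x) (F y)) :
    TwistedEnveloping K ω →+* TwistedEnveloping K ω' :=
  (exists_map σ F hω).choose

@[simp] lemma map_ι (σ : R →ₐ[K] R') (F : LieRinehartAlgebra.Hom σ L L')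
    (hω : ∀ x y, σ (ω.form x y) = ω'.form (F x) (F y)) (a : Extension ω) :
    map σ F hω (ι K ω a) = ι K ω' ⟨σ a.1, F a.2⟩ :=
  (exists_map σ F hω).choose_spec a

lemma map_scalar (σ : R →ₐ[K] R') (F : LieRinehartAlgebra.Hom σ L L')
    (hω : ∀ x y, σ (ω.form x y) = ω'.form (F x) (F y)) (f : R) :
    map σ F hω (scalar K ω f) = scalar K ω' (σ f) := by
  have h0 : F (0 : L) = 0 := map_zero F.toLieHom
  change map σ F hω (ι K ω _) = _
  rw [map_ι]
  change ι K ω' ⟨σ f, F 0⟩ = _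
  rw [h0]; rfl

lemma map_mem_filtration (σ : R →ₐ[K] R') (F : LieRinehartAlgebra.Hom σ L L')
    (hω : ∀ x y, σ (ω.form x y) = ω'.form (F x) (F y)) {n : ℕ} {x : TwistedEnveloping K ω}
    (hx : x ∈ filtration K ω n) : map σ F hω x ∈ filtration K ω' n := by
  suffices h : filtration K ω n ≤ (filtration K ω' n).comap (map σ F hω).toAddMonoidHom from h hx
  refine (AddSubgroup.closure_le _).mpr ?_
  rintro _ (⟨f, rfl⟩ | ⟨l, hl, rfl⟩)
  · change map σ F hω (scalar K ω f) ∈ filtration K ω' n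
    rw [map_scalar]
    exact AddSubgroup.subset_closure (Or.inl ⟨_, rfl⟩)
  · change map σ F hω (l.map (ι K ω)).prod ∈ filtration K ω' n
    refine AddSubgroup.subset_closure (Or.inr
      ⟨l.map fun a => ⟨σ a.1, F a.2⟩, by simpa using hl, ?_⟩)
    rw [map_list_prod, List.map_map, List.map_map]
    congr 2
    ext a
    exact map_ι σ F hω a

end Functoriality

end TwistedEnveloping

end Enveloping

end Algebra

/-! ### Filtered rings and associated graded rings -/

section Graded

universe u

/-- An ascending filtration `F 0 ≤ F 1 ≤ ⋯` of a ring by additive subgroups, with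
`1 ∈ F 0` and `F i * F j ⊆ F (i + j)`. -/
structure RingFiltration (A : Type u) [Ring A] where
  /-- the steps of the filtration -/
  step : ℕ → AddSubgroup A
  mono : Monotone step
  one_mem : 1 ∈ step 0
  mul_mem : ∀ {i j : ℕ} {a b : A}, a ∈ step i → b ∈ step j → a * b ∈ step (i + j)

namespace RingFiltration

variable {A : Type u} [Ring A] (F : RingFiltration A)

/-- The step `F (n - 1)`, with the convention `F (-1) = 0`. -/
def prev : ℕ → AddSubgroup A
  | 0 => ⊥
  | n + 1 => F.step n

lemma mul_mem_prev_left {i j : ℕ} {a b : A} (ha : a ∈ F.prev i) (hb : b ∈ F.step j) :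
    a * b ∈ F.prev (i + j) := by
  cases i with
  | zero =>
    have : a = 0 := ha
    rw [this, zero_mul]
    exact zero_mem _
  | succ i =>
    rw [Nat.add_right_comm]
    exact F.mul_mem ha hb

lemma mul_mem_prev_right {i j : ℕ} {a b : A} (ha : a ∈ F.step i) (hb : b ∈ F.prev j) :
    a * b ∈ F.prev (i + j) := by
  cases j with
  | zero =>
    have : b = 0 := hb
    rw [this, mul_zero]
    exact zero_mem _
  | succ j => exact F.mul_mem ha hb

/-- The `n`-th graded piece `F n / F (n - 1)`. -/
abbrev Piece (n : ℕ) : Type u := F.step n ⧸ (F.prev n).addSubgroupOf (F.step n)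

/-- The class in `F n / F (n - 1)` of an element of `F n`. -/
def toPiece (n : ℕ) : F.step n →+ F.Piece n := QuotientAddGroup.mk' _

lemma toPiece_surjective (n : ℕ) : Function.Surjective (F.toPiece n) :=
  QuotientAddGroup.mk'_surjective _

lemma toPiece_eq_iff {n : ℕ} (a b : F.step n) :
    F.toPiece n a = F.toPiece n b ↔ (a : A) - b ∈ F.prev n := by
  rw [← sub_eq_zero, ← map_sub]
  exact (QuotientAddGroup.eq_zero_iff _).trans AddSubgroup.mem_addSubgroupOf

/-- Multiplication of graded pieces, induced by multiplication of representatives. -/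
def pieceMul (i j : ℕ) : F.Piece i →+ F.Piece j →+ F.Piece (i + j) :=
  QuotientAddGroup.lift _
    { toFun := fun a => QuotientAddGroup.lift _
        { toFun := fun b => F.toPiece (i + j) ⟨a * b, F.mul_mem a.2 b.2⟩
          map_zero' := by
            rw [← map_zero (F.toPiece (i + j))]; congr 1; exact Subtype.ext (mul_zero _)
          map_add' := fun b c => by
            rw [← map_add (F.toPiece (i + j))]; congr 1; exact Subtype.ext (mul_add _ _ _) }
        (fun b hb => by
          rw [AddMonoidHom.mem_ker]
          refine (QuotientAddGroup.eq_zero_iff _).mpr (AddSubgroup.mem_addSubgroupOf.mpr ?_)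
          exact F.mul_mem_prev_right a.2 (AddSubgroup.mem_addSubgroupOf.mp hb))
      map_zero' := by
        ext b
        change F.toPiece (i + j) _ = 0
        rw [← map_zero (F.toPiece (i + j))]; congr 1; exact Subtype.ext (zero_mul _)
      map_add' := fun a c => by
        ext b
        change F.toPiece (i + j) _ = F.toPiece (i + j) _ + F.toPiece (i + j) _
        rw [← map_add (F.toPiece (i + j))]; congr 1; exact Subtype.ext (add_mul _ _ _) }
    (fun a ha => by
      rw [AddMonoidHom.mem_ker]
      ext b
      refine (QuotientAddGroup.eq_zero_iff _).mpr (AddSubgroup.mem_addSubgroupOf.mpr ?_)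
      exact F.mul_mem_prev_left (AddSubgroup.mem_addSubgroupOf.mp ha) b.2)

lemma pieceMul_apply {i j : ℕ} (a : F.step i) (b : F.step j) :
    F.pieceMul i j (F.toPiece i a) (F.toPiece j b)
      = F.toPiece (i + j) ⟨a * b, F.mul_mem a.2 b.2⟩ := rfl

lemma mk_toPiece_eq {i j : ℕ} (h : i = j) (a : F.step i) (b : F.step j) (hab : (a : A) = b) :
    (GradedMonoid.mk i (F.toPiece i a) : GradedMonoid F.Piece)
      = GradedMonoid.mk j (F.toPiece j b) := by
  subst h
  rw [Subtype.ext hab]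

instance : GradedMonoid.GMul F.Piece where
  mul a b := F.pieceMul _ _ a b

instance : GradedMonoid.GOne F.Piece where
  one := F.toPiece 0 ⟨1, F.one_mem⟩

instance : DirectSum.GRing F.Piece where
  mul_zero a := map_zero (F.pieceMul _ _ a)
  zero_mul b := DFunLike.congr_fun (map_zero (F.pieceMul _ _)) b
  mul_add a b c := map_add (F.pieceMul _ _ a) b c
  add_mul {i j} a b c := DFunLike.congr_fun (map_add (F.pieceMul i j) a b) c
  one_mul := by
    rintro ⟨i, a⟩
    obtain ⟨a, rfl⟩ := F.toPiece_surjective i a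
    exact F.mk_toPiece_eq (zero_add i) _ _ (one_mul _)
  mul_one := by
    rintro ⟨i, a⟩
    obtain ⟨a, rfl⟩ := F.toPiece_surjective i a
    exact F.mk_toPiece_eq (add_zero i) _ _ (mul_one _)
  mul_assoc := by
    rintro ⟨i, a⟩ ⟨j, b⟩ ⟨k, c⟩
    obtain ⟨a, rfl⟩ := F.toPiece_surjective i a
    obtain ⟨b, rfl⟩ := F.toPiece_surjective j b
    obtain ⟨c, rfl⟩ := F.toPiece_surjective k c
    exact F.mk_toPiece_eq (add_assoc i j k) _ _ (mul_assoc _ _ _)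
  natCast n := n • F.toPiece 0 ⟨1, F.one_mem⟩
  natCast_zero := zero_nsmul _
  natCast_succ n := succ_nsmul _ n
  intCast n := n • F.toPiece 0 ⟨1, F.one_mem⟩
  intCast_ofNat n := natCast_zsmul _ n
  intCast_negSucc_ofNat n := negSucc_zsmul _ n

/-- The associated graded ring `⨁ n, F n / F (n - 1)`. -/
abbrev Gr : Type u := ⨁ n, F.Piece n

noncomputable instance : Ring F.Gr := inferInstance

/-- The class of an element of `F n` in degree `n` of the associated graded ring. -/
noncomputable def symbol (n : ℕ) : F.step n →+ F.Gr :=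
  (DirectSum.of F.Piece n).comp (F.toPiece n)

lemma symbol_mul {i j : ℕ} (a : F.step i) (b : F.step j) :
    F.symbol i a * F.symbol j b = F.symbol (i + j) ⟨a * b, F.mul_mem a.2 b.2⟩ :=
  DirectSum.of_mul_of _ _

lemma symbol_one : F.symbol 0 ⟨1, F.one_mem⟩ = 1 := rfl

lemma gr_induction {p : F.Gr → Prop} (h₀ : p 0) (h : ∀ n a, p (F.symbol n a))
    (hadd : ∀ a b, p a → p b → p (a + b)) (x : F.Gr) : p x := by
  induction x using DirectSum.induction_on with
  | zero => exact h₀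
  | of n a =>
    obtain ⟨a, rfl⟩ := F.toPiece_surjective n a
    exact h n a
  | add a b ha hb => exact hadd a b ha hb

/-- The degree `n` part of the associated graded ring. -/
noncomputable def degree (n : ℕ) : AddSubgroup F.Gr := (F.symbol n).range

lemma gr_hom_ext {B : Type*} [Ring B] {φ ψ : F.Gr →+* B}
    (h : ∀ n a, φ (F.symbol n a) = ψ (F.symbol n a)) : φ = ψ := by
  refine RingHom.ext fun x => ?_
  induction x using F.gr_induction with
  | h₀ => rw [map_zero, map_zero]
  | h n a => exact h n a
  | hadd a b ha hb => rw [map_add, map_add, ha, hb]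

variable {F} {B : Type u} [Ring B] {G : RingFiltration B}

/-- The map on graded pieces induced by a filtered ring homomorphism. -/
def pieceMap (f : A →+* B) (hf : ∀ n a, a ∈ F.step n → f a ∈ G.step n) (n : ℕ) :
    F.Piece n →+ G.Piece n :=
  QuotientAddGroup.lift _
    ((G.toPiece n).comp
      ((f.toAddMonoidHom.comp (F.step n).subtype).codRestrict (G.step n) fun a => hf n a a.2))
    (fun a ha => by
      rw [AddMonoidHom.mem_ker]
      refine (QuotientAddGroup.eq_zero_iff _).mpr (AddSubgroup.mem_addSubgroupOf.mpr ?_)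
      have ha' : (a : A) ∈ F.prev n := AddSubgroup.mem_addSubgroupOf.mp ha
      change f a ∈ G.prev n
      cases n with
      | zero =>
        have : (a : A) = 0 := ha'
        rw [this, map_zero]; exact zero_mem _
      | succ n => exact hf n _ ha')

/-- The ring homomorphism on associated graded rings induced by a filtered ring homomorphism. -/
noncomputable def grMap (f : A →+* B) (hf : ∀ n a, a ∈ F.step n → f a ∈ G.step n) :
    F.Gr →+* G.Gr :=
  DirectSum.toSemiring (fun n => (DirectSum.of G.Piece n).comp (pieceMap f hf n))
    (by
      change G.symbol 0 ⟨f 1, _⟩ = 1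
      rw [← symbol_one]
      congr 1
      exact Subtype.ext (map_one f))
    (by
      intro i j a b
      obtain ⟨a, rfl⟩ := F.toPiece_surjective i a
      obtain ⟨b, rfl⟩ := F.toPiece_surjective j b
      change G.symbol (i + j) ⟨f (a * b), _⟩ = G.symbol i ⟨f a, _⟩ * G.symbol j ⟨f b, _⟩
      rw [symbol_mul]
      congr 1
      exact Subtype.ext (map_mul f _ _))

lemma grMap_symbol (f : A →+* B) (hf : ∀ n a, a ∈ F.step n → f a ∈ G.step n) (n : ℕ)
    (a : F.step n) : grMap f hf (F.symbol n a) = G.symbol n ⟨f a, hf n a a.2⟩ :=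
  DirectSum.toSemiring_of _ _ _ _ _

end RingFiltration

end Graded

/-! ### Lie algebroids over a ringed space -/

section Sheaves

open CategoryTheory TopologicalSpace Opposite AlgebraicGeometry

universe u

/-- The structure sheaf, seen as a sheaf of (not necessarily commutative) rings. -/
noncomputable abbrev ringSheaf (X : RingedSpace.{u, u}) : TopCat.Sheaf RingCat.{u} X :=
  (sheafCompose (Opens.grothendieckTopology X) (forget₂ CommRingCat.{u} RingCat.{u})).obj X.sheaf

/-- The structure of a sheaf of `K`-algebras on the structure sheaf of a ringed space. -/
class StructureAlgebra (K : Type u) [Field K] (X : RingedSpace.{u, u}) where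
  algebra : ∀ V : (Opens X)ᵒᵖ, Algebra K (X.presheaf.obj V)
  map_algebraMap : ∀ {V W : (Opens X)ᵒᵖ} (i : V ⟶ W) (c : K),
    (X.presheaf.map i).hom (algebraMap K (X.presheaf.obj V) c) = algebraMap K (X.presheaf.obj W) c

instance {K : Type u} [Field K] {X : RingedSpace.{u, u}} [StructureAlgebra K X]
    (V : (Opens X)ᵒᵖ) : Algebra K (X.presheaf.obj V) := StructureAlgebra.algebra V

/-- The restriction maps of the structure sheaf are homomorphisms of `K`-algebras. -/
noncomputable def resO (K : Type u) [Field K] {X : RingedSpace.{u, u}} [StructureAlgebra K X]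
    {V W : (Opens X)ᵒᵖ} (i : V ⟶ W) : X.presheaf.obj V →ₐ[K] X.presheaf.obj W :=
  { (X.presheaf.map i).hom with commutes' := StructureAlgebra.map_algebraMap i }

/-- The sections over an open set of a sheaf of modules. -/
def Sections {X : RingedSpace.{u, u}} (M : SheafOfModules.{u} (ringSheaf X))
    (V : (Opens X)ᵒᵖ) : Type u := M.val.obj V

namespace Sections

variable {X : RingedSpace.{u, u}} (M : SheafOfModules.{u} (ringSheaf X))

noncomputable instance (V : (Opens X)ᵒᵖ) : AddCommGroup (Sections M V) :=
  inferInstanceAs (AddCommGroup (M.val.obj V))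

noncomputable instance (V : (Opens X)ᵒᵖ) : Module (X.presheaf.obj V) (Sections M V) :=
  inferInstanceAs (Module ((ringSheaf X).obj.obj V) (M.val.obj V))

/-- The restriction maps of a sheaf of modules. -/
noncomputable def res {V W : (Opens X)ᵒᵖ} (i : V ⟶ W) :
    Sections M V →ₛₗ[(X.presheaf.map i).hom] Sections M W where
  toFun := M.val.map i
  map_add' := map_add (M.val.map i).hom
  map_smul' := M.val.map_smul i

lemma res_id (V : (Opens X)ᵒᵖ) (D : Sections M V) : res M (𝟙 V) D = D := by
  change M.val.map (𝟙 V) D = D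
  rw [M.val.map_id]; rfl

lemma res_comp {U V W : (Opens X)ᵒᵖ} (i : U ⟶ V) (j : V ⟶ W) (D : Sections M U) :
    res M (i ≫ j) D = res M j (res M i D) :=
  M.val.map_comp_apply i j D

end Sections

/-- Let `η : P ⟶ Q` be a morphism of presheaves of rings and `F` a family of additive subgroups
of `P` stable under restriction. The sections of `Q` which locally are images under `η` of sections
in `F`. If `η` is the sheafification map, this is the subsheaf of `Q` generated by `F`. -/
def localImage {X : RingedSpace.{u, u}} {P Q : (Opens X)ᵒᵖ ⥤ RingCat.{u}} (η : P ⟶ Q)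
    (F : ∀ V, AddSubgroup (P.obj V))
    (hF : ∀ {V W : (Opens X)ᵒᵖ} (i : V ⟶ W) (a : P.obj V), a ∈ F V → (P.map i).hom a ∈ F W)
    (V : (Opens X)ᵒᵖ) : AddSubgroup (Q.obj V) where
  carrier := {s | ∀ x ∈ V.unop, ∃ (W : Opens X) (i : W ⟶ V.unop), x ∈ W ∧
    ∃ t ∈ F (op W), (η.app (op W)).hom t = (Q.map i.op).hom s}
  zero_mem' := fun x hx => ⟨V.unop, 𝟙 _, hx, 0, zero_mem _, by rw [map_zero, map_zero]⟩
  neg_mem' := by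
    intro s hs x hx
    obtain ⟨W, i, hxW, t, ht, h⟩ := hs x hx
    exact ⟨W, i, hxW, -t, neg_mem ht, by rw [map_neg, map_neg, h]⟩
  add_mem' := by
    intro s s' hs hs' x hx
    obtain ⟨W, i, hxW, t, ht, h⟩ := hs x hx
    obtain ⟨W', i', hxW', t', ht', h'⟩ := hs' x hx
    refine ⟨W ⊓ W', homOfLE inf_le_left ≫ i, ⟨hxW, hxW'⟩,
      (P.map (homOfLE inf_le_left).op).hom t + (P.map (homOfLE inf_le_right).op).hom t',
      add_mem (hF _ _ ht) (hF _ _ ht'), ?_⟩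
    have e : (homOfLE inf_le_left ≫ i : W ⊓ W' ⟶ V.unop) = homOfLE inf_le_right ≫ i' :=
      Subsingleton.elim _ _
    rw [map_add, map_add, NatTrans.naturality_apply η, NatTrans.naturality_apply η, h, h']
    congr 1
    · rw [op_comp, Q.map_comp]; rfl
    · rw [e, op_comp, Q.map_comp]; rfl

section localImage

variable {X : RingedSpace.{u, u}} {P Q : (Opens X)ᵒᵖ ⥤ RingCat.{u}} (η : P ⟶ Q)

lemma localImage_res {F : ∀ V, AddSubgroup (P.obj V)}
    (hF : ∀ {V W : (Opens X)ᵒᵖ} (i : V ⟶ W) (a : P.obj V), a ∈ F V → (P.map i).hom a ∈ F W)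
    {V W : (Opens X)ᵒᵖ} (j : V ⟶ W) {s : Q.obj V} (hs : s ∈ localImage η F hF V) :
    (Q.map j).hom s ∈ localImage η F hF W := by
  intro x hx
  obtain ⟨U, i, hxU, t, ht, h⟩ := hs x (j.unop.le hx)
  refine ⟨U ⊓ W.unop, homOfLE inf_le_right, ⟨hxU, hx⟩,
    (P.map (homOfLE inf_le_left).op).hom t, hF _ _ ht, ?_⟩
  have e : (homOfLE inf_le_right ≫ j.unop : U ⊓ W.unop ⟶ V.unop) = homOfLE inf_le_left ≫ i :=
    Subsingleton.elim _ _
  rw [NatTrans.naturality_apply η, h]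
  change (Q.map i.op ≫ Q.map (homOfLE inf_le_left).op).hom s
    = (Q.map j ≫ Q.map (homOfLE inf_le_right).op).hom s
  rw [← Q.map_comp, ← Q.map_comp, ← op_comp, ← e]
  rfl

lemma app_mem_localImage {F : ∀ V, AddSubgroup (P.obj V)}
    (hF : ∀ {V W : (Opens X)ᵒᵖ} (i : V ⟶ W) (a : P.obj V), a ∈ F V → (P.map i).hom a ∈ F W)
    {V : (Opens X)ᵒᵖ} {t : P.obj V} (ht : t ∈ F V) :
    (η.app V).hom t ∈ localImage η F hF V := fun x hx =>
  ⟨V.unop, 𝟙 _, hx, t, ht, by rw [op_id, Q.map_id]; rfl⟩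

lemma localImage_mono {F G : ∀ V, AddSubgroup (P.obj V)}
    (hF : ∀ {V W : (Opens X)ᵒᵖ} (i : V ⟶ W) (a : P.obj V), a ∈ F V → (P.map i).hom a ∈ F W)
    (hG : ∀ {V W : (Opens X)ᵒᵖ} (i : V ⟶ W) (a : P.obj V), a ∈ G V → (P.map i).hom a ∈ G W)
    (h : ∀ V, F V ≤ G V) (V : (Opens X)ᵒᵖ) : localImage η F hF V ≤ localImage η G hG V := by
  intro s hs x hx
  obtain ⟨W, i, hxW, t, ht, e⟩ := hs x hx
  exact ⟨W, i, hxW, t, h _ ht, e⟩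

lemma mul_mem_localImage {F G H : ∀ V, AddSubgroup (P.obj V)}
    (hF : ∀ {V W : (Opens X)ᵒᵖ} (i : V ⟶ W) (a : P.obj V), a ∈ F V → (P.map i).hom a ∈ F W)
    (hG : ∀ {V W : (Opens X)ᵒᵖ} (i : V ⟶ W) (a : P.obj V), a ∈ G V → (P.map i).hom a ∈ G W)
    (hH : ∀ {V W : (Opens X)ᵒᵖ} (i : V ⟶ W) (a : P.obj V), a ∈ H V → (P.map i).hom a ∈ H W)
    (h : ∀ V (a b : P.obj V), a ∈ F V → b ∈ G V → a * b ∈ H V) {V : (Opens X)ᵒᵖ}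
    {s s' : Q.obj V} (hs : s ∈ localImage η F hF V) (hs' : s' ∈ localImage η G hG V) :
    s * s' ∈ localImage η H hH V := by
  intro x hx
  obtain ⟨W, i, hxW, t, ht, e₁⟩ := hs x hx
  obtain ⟨W', i', hxW', t', ht', e₂⟩ := hs' x hx
  refine ⟨W ⊓ W', homOfLE inf_le_left ≫ i, ⟨hxW, hxW'⟩,
    (P.map (homOfLE inf_le_left).op).hom t * (P.map (homOfLE inf_le_right).op).hom t',
    h _ _ _ (hF _ _ ht) (hG _ _ ht'), ?_⟩
  have e : (homOfLE inf_le_left ≫ i : W ⊓ W' ⟶ V.unop) = homOfLE inf_le_right ≫ i' :=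
    Subsingleton.elim _ _
  rw [map_mul, map_mul, NatTrans.naturality_apply η, NatTrans.naturality_apply η, e₁, e₂]
  congr 1
  · rw [op_comp, Q.map_comp]; rfl
  · rw [e, op_comp, Q.map_comp]; rfl

end localImage

/-- A Lie algebroid over a ringed space `(X, 𝒪)` over `K`: a sheaf of `𝒪`-modules with a bracket
and an action (the anchor) on `𝒪` by `K`-derivations, making the sections over each open set into
a Lie-Rinehart algebra, compatibly with restriction. (`K`-bilinearity of the bracket
follows from biadditivity, antisymmetry and the Leibniz rule, as `K`-derivations kill `K`.) -/
structure LieAlgebroid (K : Type u) [Field K] (X : RingedSpace.{u, u})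
    [StructureAlgebra K X] where
  /-- the underlying sheaf of modules -/
  module : SheafOfModules.{u} (ringSheaf X)
  /-- the bracket -/
  bracket : ∀ V, Sections module V →+ Sections module V →+ Sections module V
  /-- the anchor -/
  anchor : ∀ V, Sections module V →ₗ[X.presheaf.obj V]
    Derivation K (X.presheaf.obj V) (X.presheaf.obj V)
  bracket_self : ∀ V D, bracket V D D = 0
  jacobi : ∀ V D₁ D₂ D₃, bracket V D₁ (bracket V D₂ D₃)
    = bracket V (bracket V D₁ D₂) D₃ + bracket V D₂ (bracket V D₁ D₃)
  anchor_bracket : ∀ V D₁ D₂, anchor V (bracket V D₁ D₂) = ⁅anchor V D₁, anchor V D₂⁆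
  leibniz : ∀ V D₁ (f : X.presheaf.obj V) D₂,
    bracket V D₁ (f • D₂) = f • bracket V D₁ D₂ + anchor V D₁ f • D₂
  res_bracket : ∀ {V W} (i : V ⟶ W) D₁ D₂,
    Sections.res module i (bracket V D₁ D₂)
      = bracket W (Sections.res module i D₁) (Sections.res module i D₂)
  res_anchor : ∀ {V W} (i : V ⟶ W) D f,
    (X.presheaf.map i).hom (anchor V D f)
      = anchor W (Sections.res module i D) ((X.presheaf.map i).hom f)

namespace LieAlgebroid

variable {K : Type u} [Field K] {X : RingedSpace.{u, u}} [StructureAlgebra K X]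
  (L : LieAlgebroid K X)

/-- The Lie-Rinehart algebra of sections over an open set. -/
def Sec (V : (Opens X)ᵒᵖ) : Type u := Sections L.module V

section

variable (V : (Opens X)ᵒᵖ)

noncomputable instance : AddCommGroup (L.Sec V) :=
  inferInstanceAs (AddCommGroup (Sections L.module V))

noncomputable instance : Module (X.presheaf.obj V) (L.Sec V) :=
  inferInstanceAs (Module (X.presheaf.obj V) (Sections L.module V))

noncomputable instance : LieRing (L.Sec V) where
  bracket D₁ D₂ := L.bracket V D₁ D₂
  add_lie D₁ D₂ D₃ := DFunLike.congr_fun (map_add (L.bracket V) D₁ D₂) D₃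
  lie_add D₁ D₂ D₃ := map_add (L.bracket V D₁) D₂ D₃
  lie_self D := L.bracket_self V D
  leibniz_lie D₁ D₂ D₃ := L.jacobi V D₁ D₂ D₃

noncomputable instance : LieRingModule (L.Sec V) (X.presheaf.obj V) where
  bracket D f := L.anchor V D f
  add_lie D₁ D₂ f := DFunLike.congr_fun (map_add (L.anchor V) D₁ D₂) f
  lie_add D f g := map_add (L.anchor V D) f g
  leibniz_lie D₁ D₂ f := by
    have h := DFunLike.congr_fun (L.anchor_bracket V D₁ D₂) f
    rw [Derivation.commutator_apply] at h
    change L.anchor V D₁ (L.anchor V D₂ f)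
      = L.anchor V (L.bracket V D₁ D₂) f + L.anchor V D₂ (L.anchor V D₁ f)
    rw [h]; abel

instance : LieRinehartRing (X.presheaf.obj V) (L.Sec V) where
  lie_smul_eq_mul' f g D := DFunLike.congr_fun (map_smul (L.anchor V) f D) g
  leibniz_mul_right' D f g := by
    change L.anchor V D (f * g) = f • L.anchor V D g + L.anchor V D f * g
    refine (Derivation.leibniz _ f g).trans ?_
    exact congrArg (fun t => f * L.anchor V D g + t) (mul_comm _ _)
  leibniz_smul_right' D₁ D₂ f := L.leibniz V D₁ f D₂

noncomputable instance : Module K (L.Sec V) :=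
  Module.compHom (L.Sec V) (algebraMap K (X.presheaf.obj V))

instance : IsScalarTower K (X.presheaf.obj V) (L.Sec V) where
  smul_assoc c f D := by
    change (c • f) • D = algebraMap K (X.presheaf.obj V) c • f • D
    rw [Algebra.smul_def, mul_smul]

noncomputable instance : LieAlgebra K (L.Sec V) where
  lie_smul c D₁ D₂ := by
    have h := L.leibniz V D₁ (algebraMap K (X.presheaf.obj V) c) D₂
    refine h.trans ?_
    have h0 : L.anchor V D₁ (algebraMap K (X.presheaf.obj V) c) = 0 :=
      Derivation.map_algebraMap _ c
    have h1 : L.anchor V D₁ (algebraMap K (X.presheaf.obj V) c) • 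
        (D₂ : Sections L.module V) = 0 := by
      rw [h0, zero_smul]
    exact (congrArg _ h1).trans (add_zero _)

instance : LieRinehartAlgebra K (X.presheaf.obj V) (L.Sec V) where
  smul_lie c D f := by
    change L.anchor V (algebraMap K (X.presheaf.obj V) c • D) f = c • L.anchor V D f
    refine (DFunLike.congr_fun
      ((L.anchor V).map_smul (algebraMap K (X.presheaf.obj V) c) D) f).trans ?_
    exact (Algebra.smul_def c (L.anchor V D f)).symm
  lie_smul c D f := Derivation.map_smul (L.anchor V D) c f

end

/-- Restriction of sections, as a morphism of Lie-Rinehart algebras. -/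
noncomputable def res {V W : (Opens X)ᵒᵖ} (i : V ⟶ W) :
    LieRinehartAlgebra.Hom (resO K i) (L.Sec V) (L.Sec W) where
  toFun := Sections.res L.module i
  map_add' := map_add (Sections.res L.module i)
  map_smul' c D := by
    have h := (Sections.res L.module i).map_smulₛₗ (algebraMap K (X.presheaf.obj V) c) D
    rw [StructureAlgebra.map_algebraMap] at h
    exact h
  map_lie' {D₁ D₂} := L.res_bracket i D₁ D₂
  map_smul_apply' f D := (Sections.res L.module i).map_smulₛₗ f D
  apply_lie' f D := L.res_anchor i D f

lemma res_id (V : (Opens X)ᵒᵖ) (D : L.Sec V) : L.res (𝟙 V) D = D :=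
  Sections.res_id L.module V D

lemma res_comp {U V W : (Opens X)ᵒᵖ} (i : U ⟶ V) (j : V ⟶ W) (D : L.Sec U) :
    L.res (i ≫ j) D = L.res j (L.res i D) :=
  Sections.res_comp L.module i j D

/-- A `2`-cocycle of a Lie algebroid with values in `𝒪`: a compatible family of `2`-cocycles on
sections. -/
structure Cocycle where
  /-- the cocycle on sections over an open set -/
  val : ∀ V : (Opens X)ᵒᵖ, TwoCocycle (X.presheaf.obj V) (L.Sec V)
  res_val : ∀ {V W : (Opens X)ᵒᵖ} (i : V ⟶ W) (D₁ D₂ : L.Sec V),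
    resO K i ((val V).form D₁ D₂) = (val W).form (L.res i D₁) (L.res i D₂)

/-! #### The sheaf of symmetric algebras -/

/-- The map of symmetric algebras induced by restriction. -/
noncomputable def symRes {V W : (Opens X)ᵒᵖ} (i : V ⟶ W) :
    SymmetricAlgebra (X.presheaf.obj V) (L.Sec V) →+*
      SymmetricAlgebra (X.presheaf.obj W) (L.Sec W) :=
  letI : Algebra (X.presheaf.obj V) (SymmetricAlgebra (X.presheaf.obj W) (L.Sec W)) :=
    ((algebraMap (X.presheaf.obj W) (SymmetricAlgebra (X.presheaf.obj W) (L.Sec W))).comp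
      (X.presheaf.map i).hom).toAlgebra
  (SymmetricAlgebra.lift
    { toFun := fun D => SymmetricAlgebra.ι (X.presheaf.obj W) (L.Sec W) (L.res i D)
      map_add' := fun D D' => by
        rw [← map_add]
        exact congrArg _ (map_add (L.res i).toLieHom D D')
      map_smul' := fun f D => by
        have h : L.res i (f • D) = (X.presheaf.map i).hom f • L.res i D :=
          (L.res i).map_smul_apply f D
        rw [h, map_smul, Algebra.smul_def, Algebra.smul_def]
        rfl } : SymmetricAlgebra (X.presheaf.obj V) (L.Sec V) →ₐ[X.presheaf.obj V]
      SymmetricAlgebra (X.presheaf.obj W) (L.Sec W)).toRingHom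

lemma symRes_ι {V W : (Opens X)ᵒᵖ} (i : V ⟶ W) (D : L.Sec V) :
    L.symRes i (SymmetricAlgebra.ι _ _ D) = SymmetricAlgebra.ι _ _ (L.res i D) := by
  let _ : Algebra (X.presheaf.obj V) (SymmetricAlgebra (X.presheaf.obj W) (L.Sec W)) :=
    ((algebraMap (X.presheaf.obj W) (SymmetricAlgebra (X.presheaf.obj W) (L.Sec W))).comp
      (X.presheaf.map i).hom).toAlgebra
  exact SymmetricAlgebra.lift_ι_apply _ D

lemma symRes_algebraMap {V W : (Opens X)ᵒᵖ} (i : V ⟶ W) (f : X.presheaf.obj V) :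
    L.symRes i (algebraMap _ _ f) = algebraMap _ _ ((X.presheaf.map i).hom f) := by
  let _ : Algebra (X.presheaf.obj V) (SymmetricAlgebra (X.presheaf.obj W) (L.Sec W)) :=
    ((algebraMap (X.presheaf.obj W) (SymmetricAlgebra (X.presheaf.obj W) (L.Sec W))).comp
      (X.presheaf.map i).hom).toAlgebra
  exact AlgHom.commutes (SymmetricAlgebra.lift _) f

/-- The presheaf `V ↦ Sym (L V)` over `𝒪 V`. -/
noncomputable def symPresheaf : (Opens X)ᵒᵖ ⥤ RingCat.{u} where
  obj V := RingCat.of (SymmetricAlgebra (X.presheaf.obj V) (L.Sec V))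
  map i := RingCat.ofHom (L.symRes i)
  map_id V := by
    refine RingCat.hom_ext (RingHom.ext fun x => ?_)
    change L.symRes (𝟙 V) x = x
    induction x using SymmetricAlgebra.induction with
    | algebraMap f => rw [symRes_algebraMap, X.presheaf.map_id]; rfl
    | ι D => rw [symRes_ι, res_id]
    | mul a b ha hb => rw [map_mul, ha, hb]
    | add a b ha hb => rw [map_add, ha, hb]
  map_comp {U V W} i j := by
    refine RingCat.hom_ext (RingHom.ext fun x => ?_)
    change L.symRes (i ≫ j) x = L.symRes j (L.symRes i x)
    induction x using SymmetricAlgebra.induction with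
    | algebraMap f =>
      rw [symRes_algebraMap, symRes_algebraMap, symRes_algebraMap, X.presheaf.map_comp]; rfl
    | ι D => rw [symRes_ι, symRes_ι, symRes_ι, res_comp]
    | mul a b ha hb => rw [map_mul, map_mul, map_mul, ha, hb]
    | add a b ha hb => rw [map_add, map_add, map_add, ha, hb]

/-- The sheaf of symmetric algebras of `L` over `𝒪`. -/
noncomputable def symSheaf : TopCat.Sheaf RingCat.{u} X :=
  (presheafToSheaf (Opens.grothendieckTopology X) RingCat.{u}).obj L.symPresheaf

/-- The sheafification map. -/
noncomputable def toSymSheaf : L.symPresheaf ⟶ L.symSheaf.obj :=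
  toSheafify (Opens.grothendieckTopology X) L.symPresheaf

/-- The `𝒪`-algebra structure of the sheaf of symmetric algebras. -/
noncomputable def symScalar (V : (Opens X)ᵒᵖ) : X.presheaf.obj V →+* L.symSheaf.obj.obj V :=
  (L.toSymSheaf.app V).hom.comp
    (algebraMap (X.presheaf.obj V) (SymmetricAlgebra (X.presheaf.obj V) (L.Sec V)))

/-- The canonical map from `L` to its sheaf of symmetric algebras. -/
noncomputable def symVector (V : (Opens X)ᵒᵖ) : L.Sec V →+ L.symSheaf.obj.obj V :=
  (L.toSymSheaf.app V).hom.toAddMonoidHom.comp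
    (SymmetricAlgebra.ι (X.presheaf.obj V) (L.Sec V)).toAddMonoidHom

/-- The `n`-th symmetric power of `L V`, inside the symmetric algebra. -/
noncomputable def symPower (n : ℕ) (V : (Opens X)ᵒᵖ) : AddSubgroup (L.symPresheaf.obj V) :=
  ((LinearMap.range (SymmetricAlgebra.ι (X.presheaf.obj V) (L.Sec V))) ^ n).toAddSubgroup

lemma symRes_mem (n : ℕ) {V W : (Opens X)ᵒᵖ} (i : V ⟶ W)
    (a : SymmetricAlgebra (X.presheaf.obj V) (L.Sec V))
    (ha : a ∈ (LinearMap.range (SymmetricAlgebra.ι (X.presheaf.obj V) (L.Sec V))) ^ n) :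
    L.symRes i a ∈ (LinearMap.range (SymmetricAlgebra.ι (X.presheaf.obj W) (L.Sec W))) ^ n := by
  induction ha using Submodule.pow_induction_on_left' with
  | algebraMap f =>
    rw [symRes_algebraMap, pow_zero]
    exact Submodule.algebraMap_mem _
  | add x y k hx hy h₁ h₂ => rw [map_add]; exact add_mem h₁ h₂
  | mem_mul m hm k x hx h =>
    obtain ⟨D, rfl⟩ := hm
    rw [map_mul, symRes_ι, pow_succ']
    exact Submodule.mul_mem_mul ⟨_, rfl⟩ h

lemma symPower_res (n : ℕ) {V W : (Opens X)ᵒᵖ} (i : V ⟶ W) (a : L.symPresheaf.obj V)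
    (ha : a ∈ L.symPower n V) : (L.symPresheaf.map i).hom a ∈ L.symPower n W :=
  L.symRes_mem n i a ha

/-- The degree `n` part of the sheaf of symmetric algebras. -/
noncomputable def symDegree (n : ℕ) (V : (Opens X)ᵒᵖ) : AddSubgroup (L.symSheaf.obj.obj V) :=
  localImage L.toSymSheaf (L.symPower n) (L.symPower_res n) V

/-! #### The twisted universal enveloping algebroid -/

variable (ω : L.Cocycle)

/-- The restriction maps of twisted enveloping algebras. -/
noncomputable def twistedRes {V W : (Opens X)ᵒᵖ} (i : V ⟶ W) :
    TwistedEnveloping K (ω.val V) →+* TwistedEnveloping K (ω.val W) :=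
  TwistedEnveloping.map (resO K i) (L.res i) (ω.res_val i)

/-- The presheaf of twisted enveloping algebras. -/
noncomputable def twistedPresheaf : (Opens X)ᵒᵖ ⥤ RingCat.{u} where
  obj V := RingCat.of (TwistedEnveloping K (ω.val V))
  map i := RingCat.ofHom (L.twistedRes ω i)
  map_id V := by
    refine RingCat.hom_ext (TwistedEnveloping.hom_ext fun a => ?_)
    change L.twistedRes ω (𝟙 V) _ = TwistedEnveloping.ι K (ω.val V) a
    rw [twistedRes, TwistedEnveloping.map_ι, res_id]
    congr 1
    ext
    · change (X.presheaf.map (𝟙 V)).hom a.1 = a.1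
      rw [X.presheaf.map_id]; rfl
    · rfl
  map_comp {U V W} i j := by
    refine RingCat.hom_ext (TwistedEnveloping.hom_ext fun a => ?_)
    change L.twistedRes ω (i ≫ j) _ = L.twistedRes ω j (L.twistedRes ω i _)
    rw [twistedRes, twistedRes, twistedRes, TwistedEnveloping.map_ι, TwistedEnveloping.map_ι,
      TwistedEnveloping.map_ι, res_comp]
    congr 1
    ext
    · change (X.presheaf.map (i ≫ j)).hom a.1 = (X.presheaf.map j).hom ((X.presheaf.map i).hom a.1)
      rw [X.presheaf.map_comp]; rfl
    · rfl

/-- The universal enveloping algebroid of `L` twisted by `ω`. -/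
noncomputable def twistedSheaf : TopCat.Sheaf RingCat.{u} X :=
  (presheafToSheaf (Opens.grothendieckTopology X) RingCat.{u}).obj (L.twistedPresheaf ω)

/-- The sheafification map. -/
noncomputable def toTwistedSheaf : L.twistedPresheaf ω ⟶ (L.twistedSheaf ω).obj :=
  toSheafify (Opens.grothendieckTopology X) (L.twistedPresheaf ω)

/-- The canonical homomorphism from `𝒪` to the twisted universal enveloping algebroid. -/
noncomputable def twistedScalar (V : (Opens X)ᵒᵖ) :
    X.presheaf.obj V →+* (L.twistedSheaf ω).obj.obj V :=
  ((L.toTwistedSheaf ω).app V).hom.comp (TwistedEnveloping.scalar K (ω.val V))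

/-- The canonical map from `L` to the twisted universal enveloping algebroid. -/
noncomputable def twistedVector (V : (Opens X)ᵒᵖ) :
    L.Sec V →+ (L.twistedSheaf ω).obj.obj V :=
  ((L.toTwistedSheaf ω).app V).hom.toAddMonoidHom.comp (TwistedEnveloping.vector K (ω.val V))

lemma twistedPresheaf_filtration_res (n : ℕ) {V W : (Opens X)ᵒᵖ} (i : V ⟶ W)
    (a : (L.twistedPresheaf ω).obj V) (ha : a ∈ TwistedEnveloping.filtration K (ω.val V) n) :
    ((L.twistedPresheaf ω).map i).hom a ∈ TwistedEnveloping.filtration K (ω.val W) n :=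
  TwistedEnveloping.map_mem_filtration (resO K i) (L.res i) (ω.res_val i) ha

/-- The ascending filtration of the twisted universal enveloping algebroid, on sections: the `n`-th
step consists of the sections which locally come from the `n`-th step of the presheaf. -/
noncomputable def twistedFiltration (V : (Opens X)ᵒᵖ) :
    RingFiltration ((L.twistedSheaf ω).obj.obj V) where
  step n := localImage (L.toTwistedSheaf ω)
    (fun V => TwistedEnveloping.filtration K (ω.val V) n)
    (L.twistedPresheaf_filtration_res ω n) V
  mono _ _ h := localImage_mono _ _ _ (fun _ => TwistedEnveloping.filtration_mono h) V
  one_mem := by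
    rw [← map_one ((L.toTwistedSheaf ω).app V).hom]
    exact app_mem_localImage (L.toTwistedSheaf ω) _ (TwistedEnveloping.one_mem_filtration 0)
  mul_mem ha hb := mul_mem_localImage _ _ _ _
    (fun _ _ _ h h' => TwistedEnveloping.mul_mem_filtration h h') ha hb

lemma twistedFiltration_res {V W : (Opens X)ᵒᵖ} (i : V ⟶ W) (n : ℕ)
    (a : (L.twistedSheaf ω).obj.obj V) (ha : a ∈ (L.twistedFiltration ω V).step n) :
    ((L.twistedSheaf ω).obj.map i).hom a ∈ (L.twistedFiltration ω W).step n :=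
  localImage_res _ _ i ha

/-- The presheaf of associated graded rings `V ↦ ⨁ n, 𝒰ₙ(V) / 𝒰ₙ₋₁(V)`. -/
noncomputable def grPresheaf : (Opens X)ᵒᵖ ⥤ RingCat.{u} where
  obj V := RingCat.of (L.twistedFiltration ω V).Gr
  map i := RingCat.ofHom (RingFiltration.grMap ((L.twistedSheaf ω).obj.map i).hom
    (L.twistedFiltration_res ω i))
  map_id V := by
    refine RingCat.hom_ext ((L.twistedFiltration ω V).gr_hom_ext fun n a => ?_)
    refine (RingFiltration.grMap_symbol _ _ n a).trans ?_
    change _ = (L.twistedFiltration ω V).symbol n a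
    congr 1
    refine Subtype.ext ?_
    change ((L.twistedSheaf ω).obj.map (𝟙 V)).hom a = a
    rw [(L.twistedSheaf ω).obj.map_id]; rfl
  map_comp {U V W} i j := by
    refine RingCat.hom_ext ((L.twistedFiltration ω U).gr_hom_ext fun n a => ?_)
    refine (RingFiltration.grMap_symbol _ _ n a).trans ?_
    refine Eq.trans ?_ ((congrArg (RingFiltration.grMap ((L.twistedSheaf ω).obj.map j).hom
      (L.twistedFiltration_res ω j)) (RingFiltration.grMap_symbol
        ((L.twistedSheaf ω).obj.map i).hom (L.twistedFiltration_res ω i) n a)).trans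
      (RingFiltration.grMap_symbol ((L.twistedSheaf ω).obj.map j).hom
        (L.twistedFiltration_res ω j) n _)).symm
    congr 1
    refine Subtype.ext ?_
    change ((L.twistedSheaf ω).obj.map (i ≫ j)).hom a
      = ((L.twistedSheaf ω).obj.map j).hom (((L.twistedSheaf ω).obj.map i).hom a)
    rw [(L.twistedSheaf ω).obj.map_comp]; rfl

/-- The associated graded sheaf of the twisted universal enveloping algebroid: the direct sum of
the quotient sheaves of consecutive steps of the filtration, i.e. the sheafification of
`V ↦ ⨁ n, 𝒰ₙ(V) / 𝒰ₙ₋₁(V)`. -/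
noncomputable def grSheaf : TopCat.Sheaf RingCat.{u} X :=
  (presheafToSheaf (Opens.grothendieckTopology X) RingCat.{u}).obj (L.grPresheaf ω)

/-- The sheafification map. -/
noncomputable def toGrSheaf : L.grPresheaf ω ⟶ (L.grSheaf ω).obj :=
  toSheafify (Opens.grothendieckTopology X) (L.grPresheaf ω)

/-- The class in degree `n` of the associated graded sheaf of a section of the `n`-th step of the
filtration. -/
noncomputable def symbol (n : ℕ) (V : (Opens X)ᵒᵖ) :
    (L.twistedFiltration ω V).step n →+ (L.grSheaf ω).obj.obj V :=
  ((L.toGrSheaf ω).app V).hom.toAddMonoidHom.comp ((L.twistedFiltration ω V).symbol n)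

/-- The degree `n` part of the associated graded sheaf. -/
noncomputable def grDegree (n : ℕ) (V : (Opens X)ᵒᵖ) : AddSubgroup ((L.grSheaf ω).obj.obj V) :=
  localImage (L.toGrSheaf ω) (fun V => (L.twistedFiltration ω V).degree n)
    (by
      rintro V W i _ ⟨a, rfl⟩
      exact ⟨_, (RingFiltration.grMap_symbol _ _ n a).symm⟩) V

lemma twistedScalar_mem (V : (Opens X)ᵒᵖ) (f : X.presheaf.obj V) (n : ℕ) :
    L.twistedScalar ω V f ∈ (L.twistedFiltration ω V).step n :=
  app_mem_localImage (L.toTwistedSheaf ω) _ (TwistedEnveloping.scalar_mem_filtration f n)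

lemma twistedVector_mem (V : (Opens X)ᵒᵖ) (D : L.Sec V) :
    L.twistedVector ω V D ∈ (L.twistedFiltration ω V).step 1 :=
  app_mem_localImage (L.toTwistedSheaf ω) _ (TwistedEnveloping.vector_mem_filtration D)

/-- The `𝒪`-algebra structure of the associated graded sheaf: `f` is sent to the class of `f` in
degree `0`. -/
noncomputable def grScalar (V : (Opens X)ᵒᵖ) :
    X.presheaf.obj V →+* (L.grSheaf ω).obj.obj V where
  toFun f := L.symbol ω 0 V ⟨L.twistedScalar ω V f, L.twistedScalar_mem ω V f 0⟩
  map_one' := by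
    rw [← map_one ((L.toGrSheaf ω).app V).hom]
    refine congrArg ((L.toGrSheaf ω).app V).hom ?_
    refine Eq.trans ?_ (L.twistedFiltration ω V).symbol_one
    exact congrArg _ (Subtype.ext (map_one (L.twistedScalar ω V)))
  map_mul' f g := by
    refine Eq.trans ?_ (map_mul ((L.toGrSheaf ω).app V).hom _ _)
    refine congrArg ((L.toGrSheaf ω).app V).hom ?_
    refine Eq.trans ?_ ((L.twistedFiltration ω V).symbol_mul _ _).symm
    exact congrArg _ (Subtype.ext (map_mul (L.twistedScalar ω V) f g))
  map_zero' := by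
    rw [← map_zero (L.symbol ω 0 V)]
    exact congrArg _ (Subtype.ext (map_zero (L.twistedScalar ω V)))
  map_add' f g := by
    rw [← map_add (L.symbol ω 0 V)]
    exact congrArg _ (Subtype.ext (map_add (L.twistedScalar ω V) f g))

lemma prod_twistedVector_mem (V : (Opens X)ᵒᵖ) {k : ℕ} (D : Fin k → L.Sec V) :
    (List.ofFn fun j => L.twistedVector ω V (D j)).prod ∈ (L.twistedFiltration ω V).step k := by
  have h : ∀ l : List (L.Sec V), (l.map (L.twistedVector ω V)).prod
      ∈ (L.twistedFiltration ω V).step l.length := by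
    intro l
    induction l with
    | nil => exact (L.twistedFiltration ω V).one_mem
    | cons D l ih =>
      rw [List.map_cons, List.prod_cons, List.length_cons, add_comm]
      exact (L.twistedFiltration ω V).mul_mem (L.twistedVector_mem ω V D) ih
  have h' := h (List.ofFn D)
  rwa [List.map_ofFn, List.length_ofFn] at h'

/-- The symmetrized product `(1 / k!) ∑ σ, D_{σ(1)} ⋯ D_{σ(k)}` in the twisted universal enveloping
algebroid, as a section of the `k`-th step of the filtration. -/
noncomputable def symmetrized (V : (Opens X)ᵒᵖ) {k : ℕ} (D : Fin k → L.Sec V) :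
    (L.twistedFiltration ω V).step k :=
  ⟨L.twistedScalar ω V (algebraMap K (X.presheaf.obj V) ((k.factorial : K)⁻¹)) *
      ∑ σ : Equiv.Perm (Fin k), (List.ofFn fun j => L.twistedVector ω V (D (σ j))).prod, by
    have h := (L.twistedFiltration ω V).mul_mem (i := 0) (j := k)
      (L.twistedScalar_mem ω V (algebraMap K (X.presheaf.obj V) ((k.factorial : K)⁻¹)) 0)
      (sum_mem fun (σ : Equiv.Perm (Fin k)) (_ : σ ∈ Finset.univ) =>
        L.prod_twistedVector_mem ω V fun j => D (σ j))
    rwa [zero_add] at h⟩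

end LieAlgebroid

end Sheaves

end TwistedPBW

universe u

/-! Interchanging two factors in the twisted enveloping algebra costs a bracket, a derivative of a
function or a value of the cocycle, all of lower order. So the associated graded ring is
commutative, and `L` in degree one extends to a homomorphism `symToGraded` from the symmetric
algebra. It is onto in each degree, because `f s + D` and `D` have the same symbol in degree one
(`exists_symToGraded_eq`). The real content is injectivity.

Suppose first that `L` is free over `R` with an ordered basis `e_i`. Then `R s ⊕ L` is made to act
on the polynomial ring `R[X_i]`: `s` acts as `1`, elements of `L` act as first order operators over
`R`, and `e_i m = X_i m` plus terms of degree at most `deg m`. Ordering the factors of a product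
forces the values of these operators (`limit`). That they satisfy the commutation relations
(`commutes`) is an induction on the degree resting on the Jacobi identity of the extension, which
contains the cocycle condition. Acting on `1` and keeping the leading homogeneous part turns
multiplication by `D` into multiplication by its linear form, so it inverts `symToGraded` up to the
identification of the symmetric algebra with polynomials (`gradedToPolynomial_mul`,
`symToGraded_injective`).

A locally free sheaf of infinite rank need not have free modules of sections, even over small open
sets, since a section of a free sheaf is only locally a finite combination of the basis. Its stalks
are free (`exists_stalk_basis`), and they are Lie-Rinehart algebras with a cocycle. An element of
the symmetric algebra of sections that has zero image in the graded algebra therefore vanishes in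
the symmetric algebra of each stalk, hence near each point (`exists_symRes_eq_zero`). So the
presheaf morphism `symToGr` is locally injective as well as locally surjective, and it becomes an
isomorphism on sheaves. Characteristic zero serves to divide by `k!`: all orderings of a product
have the same symbol, so their average has it too (`symToGr_symmetrized`). -/

namespace TwistedPBW

universe v w

/-! ### First order operators on polynomials over a free Lie-Rinehart algebra -/

section FreePBW

open MvPolynomial Module

namespace Extension

variable {R : Type v} {L : Type w} [CommRing R] [LieRing L] [Module R L]
  [LieRingModule L R] {ω : TwoCocycle R L}

lemma eq_smul_add (a : Extension ω) : a = a.fst • (⟨1, 0⟩ : Extension ω) + ⟨0, a.snd⟩ := by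
  ext <;> simp

/-- The extension obeys the Leibniz rule of a Lie-Rinehart algebra, with anchor through the
projection to `L`: the cocycle is `R`-bilinear and adds no correction. -/
lemma lie_smul_right [LieRinehartRing R L] (a b : Extension ω) (f : R) :
    ⁅a, f • b⁆ = f • ⁅a, b⁆ + ⁅a.snd, f⁆ • b := by
  ext
  · simp only [lie_fst, smul_fst, smul_snd, add_fst, LieRinehartRing.leibniz_mul_right,
      LieRinehartRing.lie_smul_eq_mul, map_smul, smul_eq_mul]
    ring
  · simp

lemma lie_smul_left [LieRinehartRing R L] (a b : Extension ω) (f : R) :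
    ⁅f • a, b⁆ = f • ⁅a, b⁆ - ⁅b.snd, f⁆ • a := by
  rw [← lie_skew, lie_smul_right, ← lie_skew a b, smul_neg]
  abel

end Extension

namespace FreePBW

variable {R : Type v} {L : Type w} [CommRing R] [LieRing L] [Module R L]
  [LieRingModule L R] {ω : TwoCocycle R L} {I : Type*} (b : Basis I R L)

/-- The linear extension in `a` of a family of operators on monomials, one for each basis
element of `L`, with `s` acting as the identity. -/
noncomputable def onMonomial (T : I → (I →₀ ℕ) → MvPolynomial I R) (a : Extension ω)
    (m : I →₀ ℕ) : MvPolynomial I R :=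
  a.fst • monomial m 1 + Finsupp.linearCombination R (fun i => T i m) (b.repr a.snd)

lemma onMonomial_add (T : I → (I →₀ ℕ) → MvPolynomial I R) (a a' : Extension ω) (m : I →₀ ℕ) :
    onMonomial b T (a + a') m = onMonomial b T a m + onMonomial b T a' m := by
  rw [onMonomial, onMonomial, onMonomial, Extension.add_snd, map_add, map_add,
    Extension.add_fst, add_smul]
  abel

lemma onMonomial_smul (T : I → (I →₀ ℕ) → MvPolynomial I R) (f : R) (a : Extension ω)
    (m : I →₀ ℕ) : onMonomial b T (f • a) m = f • onMonomial b T a m := by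
  rw [onMonomial, onMonomial, Extension.smul_snd, map_smul, map_smul, Extension.smul_fst,
    mul_smul, smul_add]

/-- The operator attached to `a` by a family of operators on monomials, extended so that `a`
acts as a first order differential operator over `R`. -/
noncomputable def act (T : I → (I →₀ ℕ) → MvPolynomial I R) (a : Extension ω)
    (p : MvPolynomial I R) : MvPolynomial I R :=
  ∑ m ∈ p.support, (⁅a.snd, p.coeff m⁆ • monomial m 1 + p.coeff m • onMonomial b T a m)

variable (T : I → (I →₀ ℕ) → MvPolynomial I R)

/-- Monomials with coefficient zero contribute nothing, so sums for different polynomials can be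
compared over a common index set. -/
lemma act_eq_sum (a : Extension ω) (p : MvPolynomial I R) {s : Finset (I →₀ ℕ)}
    (hs : p.support ⊆ s) :
    act b T a p =
      ∑ m ∈ s, (⁅a.snd, p.coeff m⁆ • monomial m 1 + p.coeff m • onMonomial b T a m) := by
  refine Finset.sum_subset hs fun m _ hm => ?_
  rw [notMem_support_iff.mp hm, lie_zero, zero_smul, zero_smul, add_zero]

lemma act_add (a : Extension ω) (p q : MvPolynomial I R) :
    act b T a (p + q) = act b T a p + act b T a q := by
  classical
  rw [act_eq_sum b T a p (Finset.subset_union_left (s₂ := q.support)),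
    act_eq_sum b T a q (Finset.subset_union_right (s₁ := p.support)),
    act_eq_sum b T a (p + q) support_add, ← Finset.sum_add_distrib]
  refine Finset.sum_congr rfl fun m _ => ?_
  rw [coeff_add, lie_add, add_smul, add_smul]
  abel

lemma act_zero (a : Extension ω) : act b T a 0 = 0 := by simp [act]

lemma act_sub (a : Extension ω) (p q : MvPolynomial I R) :
    act b T a (p - q) = act b T a p - act b T a q := by
  have h := act_add b T a (p - q) q
  rw [sub_add_cancel] at h
  exact eq_sub_of_add_eq h.symm

lemma act_sum (a : Extension ω) {α : Type*} (s : Finset α) (p : α → MvPolynomial I R) :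
    act b T a (∑ j ∈ s, p j) = ∑ j ∈ s, act b T a (p j) :=
  map_sum ({ toFun := act b T a, map_zero' := act_zero b T a, map_add' := act_add b T a } :
    MvPolynomial I R →+ MvPolynomial I R) p s

/-- This mirrors the relation `ι_mul_scalar` of the enveloping algebra, and it is what carries
commutation relations from monomials to all polynomials. -/
lemma act_smul [LieRinehartRing R L] (a : Extension ω) (f : R) (p : MvPolynomial I R) :
    act b T a (f • p) = f • act b T a p + ⁅a.snd, f⁆ • p := by
  rw [act_eq_sum b T a (f • p) support_smul, act, Finset.smul_sum]
  conv_rhs => rw [← support_sum_monomial_coeff p]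
  rw [Finset.smul_sum, support_sum_monomial_coeff, ← Finset.sum_add_distrib]
  refine Finset.sum_congr rfl fun m _ => ?_
  have h : monomial m (p.coeff m) = p.coeff m • monomial m (1 : R) := by
    rw [smul_monomial, smul_eq_mul, mul_one]
  rw [coeff_smul, smul_eq_mul, LieRinehartRing.leibniz_mul_right, h]
  simp only [add_smul, smul_add, smul_smul, smul_eq_mul]
  abel

lemma act_add_left (a a' : Extension ω) (p : MvPolynomial I R) :
    act b T (a + a') p = act b T a p + act b T a' p := by
  rw [act, act, act, ← Finset.sum_add_distrib]
  refine Finset.sum_congr rfl fun m _ => ?_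
  rw [onMonomial_add, Extension.add_snd, add_lie, add_smul, smul_add]
  abel

lemma act_smul_left [LieRinehartRing R L] (f : R) (a : Extension ω) (p : MvPolynomial I R) :
    act b T (f • a) p = f • act b T a p := by
  rw [act, act, Finset.smul_sum]
  refine Finset.sum_congr rfl fun m _ => ?_
  rw [onMonomial_smul, Extension.smul_snd, LieRinehartRing.lie_smul_eq_mul, smul_add, mul_smul,
    smul_comm f (p.coeff m)]

lemma act_one_left [LieRinehartRing R L] (p : MvPolynomial I R) :
    act b T (⟨1, 0⟩ : Extension ω) p = p := by
  conv_rhs => rw [← support_sum_monomial_coeff p]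
  refine Finset.sum_congr rfl fun m _ => ?_
  simp [onMonomial, smul_monomial]

lemma lie_one [LieRinehartRing R L] (D : L) : ⁅D, (1 : R)⁆ = 0 := by
  simpa using LieRinehartRing.leibniz_mul_right (A₁ := R) D 1 1

lemma act_monomial [LieRinehartRing R L] (a : Extension ω) (m : I →₀ ℕ) :
    act b T a (monomial m 1) = onMonomial b T a m := by
  classical
  rw [act_eq_sum b T a (monomial m 1) support_monomial_subset, Finset.sum_singleton,
    coeff_monomial, if_pos rfl, lie_one, zero_smul, zero_add, one_smul]

/-- The element of the extension given by a basis element of `L`. -/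
noncomputable def gen (i : I) : Extension ω := ⟨0, b i⟩

lemma onMonomial_gen (i : I) (m : I →₀ ℕ) :
    onMonomial b T (gen b i : Extension ω) m = T i m := by
  simp [onMonomial, gen]

lemma act_gen [LieRinehartRing R L] (i : I) (m : I →₀ ℕ) :
    act b T (gen b i : Extension ω) (monomial m 1) = T i m := by
  rw [act_monomial, onMonomial_gen]

/-- Operators agreeing on monomials of degree at most `n` act identically on polynomials of
degree at most `n`. -/
lemma act_congr {T T' : I → (I →₀ ℕ) → MvPolynomial I R} {n : ℕ}
    (h : ∀ i m, m.degree ≤ n → T i m = T' i m) (a : Extension ω) {p : MvPolynomial I R}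
    (hp : p ∈ restrictTotalDegree I R n) : act b T a p = act b T' a p := by
  rw [mem_restrictTotalDegree] at hp
  refine Finset.sum_congr rfl fun m hm => ?_
  have hmn : m.degree ≤ n := (le_totalDegree hm).trans hp
  rw [onMonomial, onMonomial]
  have e : (fun i => T i m) = fun i => T' i m := funext fun i => h i m hmn
  rw [e]

lemma monomial_mem {m : I →₀ ℕ} {n : ℕ} (h : m.degree ≤ n) (c : R) :
    monomial m c ∈ restrictTotalDegree I R n := by
  rw [mem_restrictTotalDegree]
  exact (totalDegree_monomial_le m c).trans h

lemma restrictTotalDegree_mono {m n : ℕ} (h : m ≤ n) :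
    restrictTotalDegree I R m ≤ restrictTotalDegree I R n := fun p hp => by
  rw [mem_restrictTotalDegree] at hp ⊢
  exact hp.trans h

/-- The leading term condition on monomials of degree at most `n`. -/
def Leading (n : ℕ) (T : I → (I →₀ ℕ) → MvPolynomial I R) : Prop :=
  ∀ i m, m.degree ≤ n → T i m - monomial (m + Finsupp.single i 1) 1 ∈
    restrictTotalDegree I R m.degree

variable {T}

lemma Leading.mem {n : ℕ} (h : Leading n T) (i : I) {m : I →₀ ℕ} (hm : m.degree ≤ n) :
    T i m ∈ restrictTotalDegree I R (m.degree + 1) := by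
  rw [← sub_add_cancel (T i m) (monomial (m + Finsupp.single i 1) 1)]
  refine add_mem (restrictTotalDegree_mono (Nat.le_succ _) (h i m hm)) (monomial_mem ?_ 1)
  rw [map_add, Finsupp.degree_single]

lemma Leading.onMonomial_mem {n : ℕ} (h : Leading n T) (a : Extension ω) {m : I →₀ ℕ}
    (hm : m.degree ≤ n) : onMonomial b T a m ∈ restrictTotalDegree I R (m.degree + 1) :=
  add_mem (Submodule.smul_mem _ _ (monomial_mem (Nat.le_succ _) 1)) <| by
    rw [Finsupp.linearCombination_apply]
    exact (sum_mem fun i _ => Submodule.smul_mem _ _ (h.mem i hm))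

lemma Leading.act_mem {n k : ℕ} (h : Leading n T) (hk : k ≤ n) (a : Extension ω)
    {p : MvPolynomial I R} (hp : p ∈ restrictTotalDegree I R k) :
    act b T a p ∈ restrictTotalDegree I R (k + 1) := by
  rw [mem_restrictTotalDegree] at hp
  refine sum_mem fun m hm => ?_
  have hmk : m.degree ≤ k := (le_totalDegree hm).trans hp
  exact add_mem (Submodule.smul_mem _ _ (monomial_mem (hmk.trans (Nat.le_succ _)) 1))
    (Submodule.smul_mem _ _ (restrictTotalDegree_mono (Nat.succ_le_succ hmk)
      (h.onMonomial_mem b a (hmk.trans hk))))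

/-! ### Construction of the operators by ordering factors, and their commutation relations -/

section Recursion

variable [LinearOrder I]

/-- `m` is the product of the variable `k` and of `m'`, with `k` minimal in `m` and less
than `i`. -/
def IsSplit (i : I) (m : I →₀ ℕ) (q : I × (I →₀ ℕ)) : Prop :=
  m = q.2 + Finsupp.single q.1 1 ∧ (∀ j ∈ q.2.support, q.1 ≤ j) ∧ q.1 < i

lemma IsSplit.mem_support {i : I} {m : I →₀ ℕ} {q : I × (I →₀ ℕ)} (h : IsSplit i m q) :
    q.1 ∈ m.support := by
  rw [h.1, Finsupp.mem_support_iff, Finsupp.add_apply, Finsupp.single_eq_same]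
  exact Nat.succ_ne_zero _

lemma IsSplit.le {i : I} {m : I →₀ ℕ} {q : I × (I →₀ ℕ)} (h : IsSplit i m q) {j : I}
    (hj : j ∈ m.support) : q.1 ≤ j := by
  classical
  rw [h.1] at hj
  rcases Finset.mem_union.mp (Finsupp.support_add hj) with hj | hj
  · exact h.2.1 j hj
  · exact (Finset.mem_singleton.mp (Finsupp.support_single_subset hj)).ge

/-- The first component is the least variable of `m`. Hence the splitting chosen inside `approx` can
be replaced by any splitting at hand. -/
lemma IsSplit.unique {i : I} {m : I →₀ ℕ} {q q' : I × (I →₀ ℕ)} (h : IsSplit i m q)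
    (h' : IsSplit i m q') : q = q' := by
  have h1 : q.1 = q'.1 := le_antisymm (h.le h'.mem_support) (h'.le h.mem_support)
  refine Prod.ext h1 ?_
  have h2 := h.1.symm.trans h'.1
  rw [h1] at h2
  exact add_right_cancel h2

lemma IsSplit.degree {i : I} {m : I →₀ ℕ} {q : I × (I →₀ ℕ)} (h : IsSplit i m q) :
    m.degree = q.2.degree + 1 := by
  rw [h.1, map_add, Finsupp.degree_single]

lemma exists_isSplit {i : I} {m : I →₀ ℕ} (h : ¬ ∀ j ∈ m.support, i ≤ j) :
    ∃ q, IsSplit i m q := by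
  push Not at h
  obtain ⟨j, hj, hji⟩ := h
  have hne : m.support.Nonempty := ⟨j, hj⟩
  set k := m.support.min' hne
  have hk : k ∈ m.support := m.support.min'_mem hne
  have hle : Finsupp.single k 1 ≤ m := by
    rw [Finsupp.single_le_iff]
    exact Nat.one_le_iff_ne_zero.mpr (Finsupp.mem_support_iff.mp hk)
  refine ⟨(k, m - Finsupp.single k 1), (tsub_add_cancel_of_le hle).symm, fun l hl => ?_,
    (m.support.min'_le j hj).trans_lt hji⟩
  exact m.support.min'_le l (Finsupp.support_tsub hl)

variable (ω)

open Classical in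
/-- The operators of left multiplication by the basis elements, on monomials of degree at
most `n`. -/
noncomputable def approx : ℕ → I → (I →₀ ℕ) → MvPolynomial I R
  -- Only the values of stage `n` at monomials of degree at most `n` matter; the others are default
  -- values.
  | 0, i, m => monomial (m + Finsupp.single i 1) 1
  | n + 1, i, m =>
    if m.degree ≤ n then approx n i m
    else if h : ∃ q, IsSplit i m q then
      -- Write `m = X_k m'`. The relation `e_i e_k m' = e_k e_i m' + [e_i, e_k] m'` forces the
      -- value. Since `e_k` must send `X_i m'` to `X_k X_i m' = X_i m`, that part is put in by hand.
      -- Then `e_k` is applied only to the remainder `e_i m' - X_i m'`, whose degree is small enough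
      -- for the previous stage.
      monomial (m + Finsupp.single i 1) 1
        + act b (approx n) (gen b h.choose.1 : Extension ω)
          (approx n i h.choose.2 - monomial (h.choose.2 + Finsupp.single i 1) 1)
        + onMonomial b (approx n) ⁅(gen b i : Extension ω), (gen b h.choose.1 : Extension ω)⁆ h.choose.2
    else monomial (m + Finsupp.single i 1) 1

/-- Each correction term in the recursion is one operator applied to a polynomial of degree at most
`deg m' = deg m - 1`, so it has degree at most `deg m`. -/
lemma approx_leading (n : ℕ) : Leading n (approx ω b n) := by
  induction n with
  | zero =>
    intro i m _
    rw [approx, sub_self]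
    exact zero_mem _
  | succ n ih =>
    intro i m hm
    rw [approx]
    split_ifs with h1 h2
    · exact ih i m h1
    · have hq := h2.choose_spec
      have hd := hq.degree
      have hqn : h2.choose.2.degree ≤ n := by omega
      rw [add_assoc, add_sub_cancel_left, hd]
      exact add_mem (ih.act_mem b hqn _ (ih i _ hqn)) (ih.onMonomial_mem b _ hqn)
    · rw [sub_self]
      exact zero_mem _

lemma approx_succ {n : ℕ} (i : I) {m : I →₀ ℕ} (h : m.degree ≤ n) :
    approx ω b (n + 1) i m = approx ω b n i m := by
  rw [approx, if_pos h]

lemma approx_eq {n : ℕ} (i : I) {m : I →₀ ℕ} (h : m.degree ≤ n) :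
    approx ω b n i m = approx ω b m.degree i m := by
  induction n, h using Nat.le_induction with
  | base => rfl
  | succ n h ih => rw [approx_succ ω b i h, ih]

/-- The operators of left multiplication by the basis elements, on monomials. -/
noncomputable def limit (i : I) (m : I →₀ ℕ) : MvPolynomial I R := approx ω b m.degree i m

lemma limit_leading (n : ℕ) : Leading n (limit ω b) := fun i m _ =>
  approx_leading ω b m.degree i m le_rfl

/-- The product `e_i m` is already ordered, so the recursion never enters its splitting branch. -/
lemma limit_of_le (i : I) (m : I →₀ ℕ) (h : ∀ j ∈ m.support, i ≤ j) :
    limit ω b i m = monomial (m + Finsupp.single i 1) 1 := by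
  have h2 : ¬ ∃ q, IsSplit i m q := fun ⟨q, hq⟩ => absurd (h _ hq.mem_support) (not_le.mpr hq.2.2)
  rw [limit]
  -- The stage is treated as an arbitrary number: without a splitting, every stage ends at the
  -- default value.
  cases m.degree with
  | zero => rfl
  | succ n =>
    induction n with
    | zero => rw [approx, dif_neg h2]; split_ifs <;> rfl
    | succ n ih => rw [approx, dif_neg h2]; split_ifs <;> [exact ih; rfl]

/-- The recursion without stages. Now `X_i m` is recognized as `e_k (X_i m')` by `limit_of_le`, so
it recombines with the action on the remainder to give `e_k (e_i m')`. -/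
lemma limit_of_isSplit [LieRinehartRing R L] (i : I) {m : I →₀ ℕ} {q : I × (I →₀ ℕ)}
    (hq : IsSplit i m q) :
    limit ω b i m = act b (limit ω b) (gen b q.1 : Extension ω) (limit ω b i q.2)
      + onMonomial b (limit ω b) ⁅(gen b i : Extension ω), (gen b q.1 : Extension ω)⁆ q.2 := by
  have hex : ∃ q, IsSplit i m q := ⟨q, hq⟩
  have hch : hex.choose = q := hex.choose_spec.unique hq
  have hd := hq.degree
  have hagree : ∀ j (m' : I →₀ ℕ), m'.degree ≤ q.2.degree →
      approx ω b q.2.degree j m' = limit ω b j m' := fun j m' h => approx_eq ω b j h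
  -- One unfolding of the recursion at stage `deg m = deg m' + 1`, so that stage `deg m'` appears on
  -- the right.
  have key : limit ω b i m = monomial (m + Finsupp.single i 1) 1
        + act b (approx ω b q.2.degree) (gen b q.1 : Extension ω)
          (approx ω b q.2.degree i q.2 - monomial (q.2 + Finsupp.single i 1) 1)
        + onMonomial b (approx ω b q.2.degree) ⁅(gen b i : Extension ω), (gen b q.1 : Extension ω)⁆ q.2 := by
    conv_lhs => rw [limit, hd, approx]
    rw [if_neg (by omega), dif_pos hex, hch]
  rw [key, act_congr b hagree _ (approx_leading ω b _ i _ le_rfl), hagree i q.2 le_rfl, act_sub,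
    act_gen, limit_of_le ω b q.1]
  · have h1 : q.2 + Finsupp.single i 1 + Finsupp.single q.1 1 = m + Finsupp.single i 1 := by
      rw [hq.1]; abel
    rw [h1, add_sub_cancel]
    -- The bracket terms agree by definition: at `m'`, `limit` is stage `deg m'`.
    congr 1
  · intro j hj
    classical
    rcases Finset.mem_union.mp (Finsupp.support_add hj) with hj | hj
    · exact hq.2.1 j hj
    · exact (Finset.mem_singleton.mp (Finsupp.support_single_subset hj)) ▸ hq.2.2.le

/-- The twisted left multiplication operator on polynomials. -/
noncomputable def op (a : Extension ω) (p : MvPolynomial I R) : MvPolynomial I R :=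
  act b (limit ω b) a p

variable {ω}

/-- The operators attached to `a` and `a'` satisfy the commutation relation on `p`. -/
def Commutes (a a' : Extension ω) (p : MvPolynomial I R) : Prop :=
  op ω b a (op ω b a' p) - op ω b a' (op ω b a p) = op ω b ⁅a, a'⁆ p

lemma op_add (a : Extension ω) (p q : MvPolynomial I R) :
    op ω b a (p + q) = op ω b a p + op ω b a q := act_add b _ a p q

lemma op_sub (a : Extension ω) (p q : MvPolynomial I R) :
    op ω b a (p - q) = op ω b a p - op ω b a q := act_sub b _ a p q

lemma op_zero (a : Extension ω) : op ω b a 0 = 0 := act_zero b _ a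

lemma op_add_left (a a' : Extension ω) (p : MvPolynomial I R) :
    op ω b (a + a') p = op ω b a p + op ω b a' p := act_add_left b _ a a' p

lemma op_zero_left (p : MvPolynomial I R) : op ω b 0 p = 0 := by
  have h := op_add_left b (0 : Extension ω) 0 p
  rwa [add_zero, left_eq_add] at h

lemma op_neg_left (a : Extension ω) (p : MvPolynomial I R) :
    op ω b (-a) p = - op ω b a p := by
  have h := op_add_left b a (-a) p
  rw [add_neg_cancel, op_zero_left] at h
  exact (neg_eq_of_add_eq_zero_right h.symm).symm

lemma op_mem (n : ℕ) (a : Extension ω) {p : MvPolynomial I R}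
    (hp : p ∈ restrictTotalDegree I R n) : op ω b a p ∈ restrictTotalDegree I R (n + 1) :=
  (limit_leading ω b n).act_mem b le_rfl a hp

variable {b}

lemma Commutes.symm {a a' : Extension ω} {p : MvPolynomial I R} (h : Commutes b a a' p) :
    Commutes b a' a p := by
  rw [Commutes, ← lie_skew, op_neg_left, ← h, neg_sub]

lemma Commutes.add {a a' : Extension ω} {p q : MvPolynomial I R} (h : Commutes b a a' p)
    (h' : Commutes b a a' q) : Commutes b a a' (p + q) := by
  rw [Commutes] at *
  simp only [op_add, ← h, ← h']
  abel

lemma Commutes.add_left {a a₁ a' : Extension ω} {p : MvPolynomial I R} (h : Commutes b a a' p)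
    (h' : Commutes b a₁ a' p) : Commutes b (a + a₁) a' p := by
  rw [Commutes] at *
  simp only [op_add, add_lie, op_add_left, ← h, ← h']
  abel

lemma commutes_zero_left (a' : Extension ω) (p : MvPolynomial I R) : Commutes b 0 a' p := by
  rw [Commutes, zero_lie, op_zero_left, op_zero_left, op_zero, sub_zero]

variable [LieRinehartRing R L]

lemma op_smul (a : Extension ω) (f : R) (p : MvPolynomial I R) :
    op ω b a (f • p) = f • op ω b a p + ⁅a.snd, f⁆ • p := act_smul b _ a f p

lemma op_smul_left (a : Extension ω) (f : R) (p : MvPolynomial I R) :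
    op ω b (f • a) p = f • op ω b a p := act_smul_left b _ f a p

lemma op_one_left (p : MvPolynomial I R) : op ω b ⟨1, 0⟩ p = p := act_one_left b _ p

lemma op_gen_monomial (i : I) (m : I →₀ ℕ) :
    op ω b (gen b i) (monomial m 1) = limit ω b i m := act_gen b _ i m

/-- The terms in which `f` is differentiated once are symmetric in `a` and `a'` and cancel. Those in
which it is differentiated twice combine to the derivative of `f` along the bracket. -/
lemma Commutes.smul {a a' : Extension ω} {p : MvPolynomial I R} (h : Commutes b a a' p) (f : R) :
    Commutes b a a' (f • p) := by
  rw [Commutes] at *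
  simp only [op_smul, op_add, ← h, Extension.lie_snd, lie_lie, sub_smul, smul_sub]
  abel

lemma Commutes.smul_left {a a' : Extension ω} {p : MvPolynomial I R} (h : Commutes b a a' p)
    (f : R) : Commutes b (f • a) a' p := by
  rw [Commutes, Extension.lie_smul_left, sub_eq_add_neg (f • _), op_add_left, op_neg_left,
    op_smul_left, op_smul_left, op_smul_left, op_smul_left, op_smul, ← h, smul_sub]
  abel

lemma commutes_one_left (a' : Extension ω) (p : MvPolynomial I R) : Commutes b ⟨1, 0⟩ a' p := by
  have h : ⁅(⟨1, 0⟩ : Extension ω), a'⁆ = 0 := by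
    ext
    · simp [lie_one]
    · simp
  rw [Commutes, op_one_left, op_one_left, sub_self, h, op_zero_left]

/-- The commutation relation follows from the one for basis elements of `L`. -/
lemma commutes_of_gen_left {a' : Extension ω} {p : MvPolynomial I R}
    (h : ∀ i, Commutes b (gen b i) a' p) (a : Extension ω) : Commutes b a a' p := by
  rw [Extension.eq_smul_add a]
  refine ((commutes_one_left a' p).smul_left _).add_left ?_
  generalize a.snd = x
  induction b.mem_span x using Submodule.span_induction with
  | mem x hx =>
    obtain ⟨i, rfl⟩ := hx
    exact h i
  | zero => exact commutes_zero_left a' p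
  | add x y _ _ hx hy =>
    have e : (⟨0, x + y⟩ : Extension ω) = ⟨0, x⟩ + ⟨0, y⟩ := by ext <;> simp
    rw [e]
    exact hx.add_left hy
  | smul f x _ hx =>
    have e : (⟨0, f • x⟩ : Extension ω) = f • ⟨0, x⟩ := by ext <;> simp
    rw [e]
    exact hx.smul_left f

lemma commutes_of_gen {p : MvPolynomial I R}
    (h : ∀ i j, Commutes b (gen b i : Extension ω) (gen b j) p) (a a' : Extension ω) :
    Commutes b a a' p :=
  commutes_of_gen_left (fun i => (commutes_of_gen_left (fun j => h j i) a').symm) a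

lemma commutes_of_monomial {n : ℕ} {a a' : Extension ω}
    (h : ∀ m : I →₀ ℕ, m.degree ≤ n → Commutes b a a' (monomial m 1)) {p : MvPolynomial I R}
    (hp : p ∈ restrictTotalDegree I R n) : Commutes b a a' p := by
  rw [mem_restrictTotalDegree] at hp
  rw [← support_sum_monomial_coeff p]
  refine Finset.sum_induction _ (Commutes b a a') (fun _ _ => Commutes.add) ?_ fun m hm => ?_
  · rw [Commutes, op_zero, op_zero, op_zero, op_zero, sub_zero]
  · have e : monomial m (p.coeff m) = p.coeff m • monomial m (1 : R) := by
      rw [smul_monomial, smul_eq_mul, mul_one]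
    rw [e]
    exact (h m ((le_totalDegree hm).trans hp)).smul _

/-- Here `e_j m = X_j m`, and the commutation relation is the very recursion that defines `e_i` on
`X_j m`. -/
lemma commutes_gen_of_le {i j : I} (hji : j < i) {m : I →₀ ℕ} (hm : ∀ k ∈ m.support, j ≤ k) :
    Commutes b (gen b i : Extension ω) (gen b j) (monomial m 1) := by
  have hq : IsSplit i (m + Finsupp.single j 1) (j, m) := ⟨rfl, hm, hji⟩
  rw [Commutes, op_gen_monomial, op_gen_monomial, limit_of_le ω b j m hm, op_gen_monomial,
    limit_of_isSplit ω b i hq, ← act_monomial]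
  exact add_sub_cancel_left _ _

/-- The remaining case, where some variable of `m` is smaller than `j`. With `k` the least one, `m =
e_k m'`. Moving `e_k` to the left of `e_i e_j` and of `e_j e_i` reduces the relation to lower degree
and the Jacobi identity. -/
lemma commutes_gen_of_isSplit {m : I →₀ ℕ}
    (ih : ∀ m' : I →₀ ℕ, m'.degree < m.degree → ∀ a a' : Extension ω,
      Commutes b a a' (monomial m' 1)) {i j : I} (hji : j < i) {q : I × (I →₀ ℕ)}
    (hq : IsSplit j m q) : Commutes b (gen b i : Extension ω) (gen b j) (monomial m 1) := by
  obtain ⟨k, m'⟩ := q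
  have hd : m.degree = m'.degree + 1 := hq.degree
  have hkj : k < j := hq.2.2
  have hm' : ∀ l ∈ m'.support, k ≤ l := hq.2.1
  have hX : monomial m 1 = op ω b (gen b k) (monomial m' (1 : R)) := by
    rw [op_gen_monomial, limit_of_le ω b k m' hm', hq.1]
  have ihp : ∀ p ∈ restrictTotalDegree I R m'.degree, ∀ a a' : Extension ω, Commutes b a a' p :=
    fun p hp a a' => commutes_of_monomial (fun l hl => ih l (by omega) a a') hp
  have ih' := fun a a' : Extension ω => ihp _ (monomial_mem le_rfl 1) a a'
  -- The polynomial `e_j m'` has degree `deg m`, outside the induction hypothesis. But it is `X_j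
  -- m'` plus terms of degree at most `deg m'`: the latter fall under the hypothesis, and `k` is
  -- minimal in the former.
  have step : ∀ {i j : I}, k < i → k < j →
      Commutes b (gen b i : Extension ω) (gen b k) (op ω b (gen b j) (monomial m' 1)) := by
    intro i j hi hj
    rw [op_gen_monomial, ← sub_add_cancel (limit ω b j m')
      (monomial (m' + Finsupp.single j 1) 1)]
    refine (ihp _ (limit_leading ω b _ j m' le_rfl) _ _).add (commutes_gen_of_le hi ?_)
    intro l hl
    classical
    rcases Finset.mem_union.mp (Finsupp.support_add hl) with hl | hl
    · exact hm' l hl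
    · exact (Finset.mem_singleton.mp (Finsupp.support_single_subset hl)) ▸ hj.le
  -- The two middle terms are exchanged when `i` and `j` are, so they disappear from the difference.
  have expand : ∀ {i j : I}, k < i → k < j →
      op ω b (gen b i) (op ω b (gen b j) (op ω b (gen b k) (monomial m' (1 : R)))) =
        op ω b (gen b k) (op ω b (gen b i) (op ω b (gen b j) (monomial m' 1)))
        + op ω b ⁅(gen b i : Extension ω), gen b k⁆ (op ω b (gen b j) (monomial m' 1))
        + op ω b ⁅(gen b j : Extension ω), gen b k⁆ (op ω b (gen b i) (monomial m' 1))
        + op ω b ⁅(gen b i : Extension ω), ⁅(gen b j : Extension ω), gen b k⁆⁆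
          (monomial m' 1) := by
    intro i j hi hj
    have h1 := ih' (gen b j) (gen b k)
    have h2 := ih' (gen b i) ⁅(gen b j : Extension ω), gen b k⁆
    have h3 := step hi hj
    rw [Commutes] at h1 h2 h3
    rw [← h2, ← h3, sub_eq_iff_eq_add.mp h1, op_add]
    abel
  have hki := hkj.trans hji
  have h4 := ih' ⁅(gen b i : Extension ω), gen b j⁆ (gen b k)
  have h5 := ih' (gen b i) (gen b j)
  rw [Commutes] at h4 h5
  -- The double brackets left over match `[[e_i, e_j], e_k]` by the Jacobi identity, used as
  -- `lie_lie`.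
  rw [Commutes, hX, expand hki hkj, expand hkj hki, sub_eq_iff_eq_add.mp h4, ← h5, op_sub,
    lie_lie, sub_eq_add_neg ⁅gen b i, _⁆, op_add_left, op_neg_left]
  abel

/-- The operators define a representation of the extension. -/
lemma commutes (a a' : Extension ω) (p : MvPolynomial I R) : Commutes b a a' p := by
  suffices h : ∀ n (m : I →₀ ℕ), m.degree = n → ∀ a a' : Extension ω,
      Commutes b a a' (monomial m 1) from
    commutes_of_monomial (fun m _ => h _ m rfl a a')
      ((mem_restrictTotalDegree _ _ _).mpr (le_refl p.totalDegree))
  intro n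
  induction n using Nat.strong_induction_on with
  | _ n ih =>
    rintro m rfl
    have main : ∀ {i j : I}, j < i →
        Commutes b (gen b i : Extension ω) (gen b j) (monomial m 1) := by
      intro i j hji
      by_cases hm : ∀ k ∈ m.support, j ≤ k
      · exact commutes_gen_of_le hji hm
      · obtain ⟨q, hq⟩ := exists_isSplit hm
        exact commutes_gen_of_isSplit (fun m' h => ih _ h m' rfl) hji hq
    refine commutes_of_gen fun i j => ?_
    rcases lt_trichotomy i j with h | rfl | h
    · exact (main h).symm
    · rw [Commutes, sub_self, lie_self, op_zero_left]
    · exact main h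

end Recursion

end FreePBW

end FreePBW

/-! ### The representation on polynomials and its leading terms -/

section FreePBW

open MvPolynomial Module

namespace FreePBW

lemma homogeneousComponent_X_mul {R : Type*} [CommRing R] {I : Type*} (i : I) (n : ℕ) (p : MvPolynomial I R) :
    homogeneousComponent (n + 1) (X i * p) = X i * homogeneousComponent n p := by
  induction p using MvPolynomial.induction_on' with
  | monomial m c =>
    have h : (X i : MvPolynomial I R) * monomial m c = monomial (Finsupp.single i 1 + m) c := by
      rw [X, monomial_mul, one_mul]
    have h1 := isHomogeneous_monomial (d := m) c rfl
    have h2 := isHomogeneous_monomial (d := Finsupp.single i 1 + m) c rfl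
    rw [h, homogeneousComponent_of_mem h1, homogeneousComponent_of_mem h2, map_add,
      Finsupp.degree_single, add_comm 1]
    simp only [Nat.add_right_cancel_iff]
    split_ifs
    · exact h.symm
    · rw [mul_zero]
  | add p q hp hq => rw [mul_add, map_add, map_add, hp, hq, mul_add]

section Representation

variable (K : Type u) {R : Type v} {L : Type w} [CommRing K] [CommRing R] [Algebra K R]
  [LieRing L] [LieAlgebra K L] [Module R L] [LieRingModule L R] [LieRinehartRing R L]
  [LieRinehartAlgebra K R L] {ω : TwoCocycle R L} {I : Type*} (b : Basis I R L) [LinearOrder I]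

/-- The twisted left multiplication operators, as `K`-linear maps. -/
noncomputable def opLinear : Extension ω →ₗ[K] Module.End K (MvPolynomial I R) where
  toFun a :=
    { toFun := op ω b a
      map_add' := op_add b a
      map_smul' := fun c p => by
        have h : ⁅a.snd, algebraMap K R c⁆ = 0 := by
          have h3 : ⁅a.snd, c • (1 : R)⁆ = c • ⁅a.snd, (1 : R)⁆ :=
            LieModule.lie_smul c a.snd (1 : R)
          rw [Algebra.algebraMap_eq_smul_one, h3, lie_one, smul_zero]
        rw [RingHom.id_apply, ← algebraMap_smul R c p, op_smul, h, zero_smul, add_zero,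
          algebraMap_smul] }
  map_add' a a' := LinearMap.ext fun p => op_add_left b a a' p
  map_smul' c a := LinearMap.ext fun p => by
    have h : c • a = algebraMap K R c • a := by
      ext
      · simp [Algebra.smul_def]
      · simp
    change op ω b (c • a) p = c • op ω b a p
    rw [h, op_smul_left, algebraMap_smul]

/-- The twisted enveloping algebra of a free Lie-Rinehart algebra acts on polynomials. -/
lemma exists_representation :
    ∃ ψ : TwistedEnveloping K ω →+* Module.End K (MvPolynomial I R),
      ∀ a, ψ (TwistedEnveloping.ι K ω a) = opLinear K b a := by
  refine TwistedEnveloping.exists_lift (opLinear K b) (fun a a' => ?_) (fun f a => ?_) ?_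
  · refine LinearMap.ext fun p => ?_
    have h := commutes (b := b) a a' p
    rw [Commutes] at h
    exact h.symm
  · refine LinearMap.ext fun p => ?_
    have h : (⟨f, 0⟩ : Extension ω) = f • ⟨1, 0⟩ := by ext <;> simp
    change op ω b (f • a) p = op ω b ⟨f, 0⟩ (op ω b a p)
    rw [h, op_smul_left, op_smul_left, op_one_left]
  · exact LinearMap.ext fun p => op_one_left p

/-- The representation of the twisted enveloping algebra on polynomials. -/
noncomputable def representation :
    TwistedEnveloping K ω →+* Module.End K (MvPolynomial I R) :=
  (exists_representation K b).choose

lemma representation_ι (a : Extension ω) (p : MvPolynomial I R) :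
    representation K b (TwistedEnveloping.ι K ω a) p = op ω b a p :=
  LinearMap.congr_fun ((exists_representation K b).choose_spec a) p

lemma representation_scalar (f : R) (p : MvPolynomial I R) :
    representation K b (TwistedEnveloping.scalar K ω f) p = f • p := by
  have h : (⟨f, 0⟩ : Extension ω) = f • ⟨1, 0⟩ := by ext <;> simp
  change representation K b (TwistedEnveloping.ι K ω ⟨f, 0⟩) p = _
  rw [representation_ι, h, op_smul_left, op_one_left]

/-- Functions preserve the degree, and each factor from `R s ⊕ L` raises it by at most one, starting
from the constant `1`. -/
lemma representation_mem {n : ℕ} {x : TwistedEnveloping K ω}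
    (hx : x ∈ TwistedEnveloping.filtration K ω n) :
    representation K b x 1 ∈ restrictTotalDegree I R n := by
  have one_mem : ∀ k, (1 : MvPolynomial I R) ∈ restrictTotalDegree I R k := fun k => by
    rw [mem_restrictTotalDegree, totalDegree_one]; exact Nat.zero_le _
  induction hx using AddSubgroup.closure_induction with
  | zero => rw [map_zero]; exact zero_mem _
  | add x y _ _ hx hy => rw [map_add]; exact add_mem hx hy
  | neg x _ hx => rw [map_neg]; exact neg_mem hx
  | mem x hx =>
  obtain ⟨f, rfl⟩ | ⟨l, hl, rfl⟩ := hx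
  · change representation K b (TwistedEnveloping.scalar K ω f) 1 ∈ restrictTotalDegree I R n
    rw [representation_scalar]
    exact Submodule.smul_mem _ _ (one_mem n)
  · refine restrictTotalDegree_mono hl ?_
    change representation K b (l.map (TwistedEnveloping.ι K ω)).prod 1 ∈
      restrictTotalDegree I R l.length
    clear hl
    induction l with
    | nil =>
      rw [List.map_nil, List.prod_nil, map_one (representation K b), Module.End.one_apply]
      exact one_mem 0
    | cons a l ih =>
      rw [List.map_cons, List.prod_cons, map_mul]
      change representation K b _ (representation K b _ 1) ∈ _
      rw [representation_ι]
      exact op_mem b _ a ih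

/-- The linear polynomial attached to an element of a free module. -/
noncomputable def linearForm : L →ₗ[R] MvPolynomial I R := b.constr R X

/-- By the leading term condition, `e_i m - X_i m` has degree at most `n` and is invisible in degree
`n + 1`. -/
lemma homogeneousComponent_op_monomial (i : I) (m : I →₀ ℕ) (n : ℕ) (hm : m.degree ≤ n) :
    homogeneousComponent (n + 1) (op ω b (gen b i) (monomial m (1 : R)))
      = X i * homogeneousComponent n (monomial m 1) := by
  have h : monomial (m + Finsupp.single i 1) (1 : R) = X i * monomial m 1 := by
    rw [X, monomial_mul, one_mul, add_comm]
  rw [op_gen_monomial, ← homogeneousComponent_X_mul, ← sub_eq_zero, ← map_sub, ← h]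
  refine homogeneousComponent_eq_zero _ _ (Nat.lt_succ_of_le (le_trans ?_ hm))
  exact (mem_restrictTotalDegree _ _ _).mp (limit_leading ω b _ i m le_rfl)

/-- Derivatives of coefficients do not raise the degree, so they vanish in degree `n + 1` along with
the lower order remainders. At the level of leading parts the action is that of the symmetric
algebra. -/
lemma homogeneousComponent_op (D : L) {n : ℕ} {p : MvPolynomial I R}
    (hp : p ∈ restrictTotalDegree I R n) :
    homogeneousComponent (n + 1) (op ω b ⟨0, D⟩ p)
      = linearForm b D * homogeneousComponent n p := by
  rw [mem_restrictTotalDegree] at hp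
  induction b.mem_span D using Submodule.span_induction with
  | mem D hD =>
    obtain ⟨i, rfl⟩ := hD
    rw [linearForm, Basis.constr_basis]
    conv_lhs => rw [← support_sum_monomial_coeff p]
    conv_rhs => rw [← support_sum_monomial_coeff p]
    rw [op, act_sum, map_sum, map_sum, Finset.mul_sum]
    refine Finset.sum_congr rfl fun m hm => ?_
    have e : monomial m (p.coeff m) = p.coeff m • monomial m (1 : R) := by
      rw [smul_monomial, smul_eq_mul, mul_one]
    have hmn : m.degree ≤ n := (le_totalDegree hm).trans hp
    change homogeneousComponent (n + 1) (op ω b (gen b i) _) = _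
    rw [e, op_smul, map_add, map_smul, homogeneousComponent_op_monomial b i m n hmn, map_smul,
      map_smul, mul_smul_comm, homogeneousComponent_eq_zero (n + 1), smul_zero, add_zero]
    exact Nat.lt_succ_of_le ((mem_restrictTotalDegree _ _ _).mp (monomial_mem hmn 1))
  | zero =>
    have h : op ω b ⟨0, 0⟩ p = 0 := op_zero_left b p
    rw [h, map_zero, map_zero, zero_mul]
  | add D D' _ _ h h' =>
    have e : (⟨0, D + D'⟩ : Extension ω) = ⟨0, D⟩ + ⟨0, D'⟩ := by ext <;> simp
    rw [e, op_add_left, map_add, h, h', map_add, add_mul]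
  | smul f D _ h =>
    have e : (⟨0, f • D⟩ : Extension ω) = f • ⟨0, D⟩ := by ext <;> simp
    rw [e, op_smul_left, map_smul, h, map_smul, smul_mul_assoc]

end Representation

end FreePBW

end FreePBW

/-- This moves a symbol along an equality of degrees such as `0 + n = n` without any transport
between graded pieces. -/
lemma RingFiltration.symbol_congr {A : Type u} [Ring A] (F : RingFiltration A) {i j : ℕ}
    (h : i = j) (a : F.step i) (b : F.step j) (hab : (a : A) = b) :
    F.symbol i a = F.symbol j b :=
  DirectSum.of_eq_of_gradedMonoid_eq (F.mk_toPiece_eq h a b hab)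

/-! ### Commutativity of the associated graded ring -/

section Symmetric

namespace TwistedEnveloping

variable (K : Type u) {R : Type v} {L : Type w} [CommRing K] [CommRing R] [Algebra K R]
  [LieRing L] [LieAlgebra K L] [Module R L] [LieRingModule L R] [LieRinehartRing R L]
  [LieRinehartAlgebra K R L] (ω : TwoCocycle R L)

/-- The filtration of the twisted enveloping algebra. -/
noncomputable def ringFiltration : RingFiltration (TwistedEnveloping K ω) where
  step := filtration K ω
  mono _ _ h := filtration_mono h
  one_mem := one_mem_filtration 0
  mul_mem := mul_mem_filtration

variable {K ω}

/-- Moving `f` past a factor `a` replaces that factor by the function `a(f)`, which shortens the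
word by one. For `n = 0` only functions occur, and they commute exactly, in accordance with `prev 0
= 0`. -/
lemma commutator_scalar_mem {n : ℕ} {x : TwistedEnveloping K ω} (hx : x ∈ filtration K ω n)
    (f : R) : x * scalar K ω f - scalar K ω f * x ∈ (ringFiltration K ω).prev n := by
  suffices h : filtration K ω n ≤ ((ringFiltration K ω).prev n).comap
      (AddMonoidHom.mulRight (scalar K ω f) - AddMonoidHom.mulLeft (scalar K ω f)) from h hx
  refine (AddSubgroup.closure_le _).mpr ?_
  rintro _ (⟨g, rfl⟩ | ⟨l, hl, rfl⟩)
  · change scalar K ω g * scalar K ω f - scalar K ω f * scalar K ω g ∈ (ringFiltration K ω).prev n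
    rw [← map_mul, ← map_mul, mul_comm, sub_self]
    exact zero_mem _
  · change (l.map (ι K ω)).prod * scalar K ω f - scalar K ω f * (l.map (ι K ω)).prod
      ∈ (ringFiltration K ω).prev n
    clear hx
    induction l generalizing n with
    | nil =>
      rw [List.map_nil, List.prod_nil, one_mul, mul_one, sub_self]
      exact zero_mem _
    | cons a l ih =>
      -- The word is non-empty, so `n` is positive and `prev` is an honest step of the filtration.
      obtain ⟨n, rfl⟩ : ∃ k, n = k + 1 := ⟨n - 1, by rw [List.length_cons] at hl; omega⟩
      have hl' : l.length ≤ n := by rw [List.length_cons] at hl; omega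
      have hp : (l.map (ι K ω)).prod ∈ filtration K ω n :=
        filtration_mono hl' (prod_mem_filtration l)
      have e : ((a :: l).map (ι K ω)).prod * scalar K ω f
            - scalar K ω f * ((a :: l).map (ι K ω)).prod
          = ι K ω a * ((l.map (ι K ω)).prod * scalar K ω f
              - scalar K ω f * (l.map (ι K ω)).prod)
            + scalar K ω ⁅a.snd, f⁆ * (l.map (ι K ω)).prod := by
        rw [List.map_cons, List.prod_cons, mul_sub, ← mul_assoc (ι K ω a) (scalar K ω f),
          ι_mul_scalar]
        noncomm_ring
      rw [e]
      refine add_mem ?_ (scalar_mul_mem_filtration _ hp)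
      have ha : ι K ω a ∈ (ringFiltration K ω).step 1 := by
        have h := prod_mem_filtration (K := K) [a]
        rwa [List.map_singleton, List.prod_singleton] at h
      have h := (ringFiltration K ω).mul_mem_prev_right ha (ih hl')
      rwa [add_comm] at h

/-- Commuting with `a` replaces one factor `c` at a time by `[c, a]`, which is again in the
extension, so words do not get longer. -/
lemma commutator_ι_mem {n : ℕ} {x : TwistedEnveloping K ω} (hx : x ∈ filtration K ω n)
    (a : Extension ω) : x * ι K ω a - ι K ω a * x ∈ filtration K ω n := by
  suffices h : filtration K ω n ≤ (filtration K ω n).comap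
      (AddMonoidHom.mulRight (ι K ω a) - AddMonoidHom.mulLeft (ι K ω a)) from h hx
  refine (AddSubgroup.closure_le _).mpr ?_
  rintro _ (⟨g, rfl⟩ | ⟨l, hl, rfl⟩)
  · change scalar K ω g * ι K ω a - ι K ω a * scalar K ω g ∈ filtration K ω n
    rw [ι_mul_scalar, sub_add_cancel_left]
    exact neg_mem (scalar_mem_filtration _ _)
  · refine filtration_mono hl ?_
    change (l.map (ι K ω)).prod * ι K ω a - ι K ω a * (l.map (ι K ω)).prod ∈
      filtration K ω l.length
    clear hl hx
    induction l with
    | nil =>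
      rw [List.map_nil, List.prod_nil, one_mul, mul_one, sub_self]
      exact zero_mem _
    | cons c l ih =>
      have e : ((c :: l).map (ι K ω)).prod * ι K ω a - ι K ω a * ((c :: l).map (ι K ω)).prod
          = ι K ω c * ((l.map (ι K ω)).prod * ι K ω a - ι K ω a * (l.map (ι K ω)).prod)
            + ((⁅c, a⁆ :: l).map (ι K ω)).prod := by
        rw [List.map_cons, List.prod_cons, List.map_cons, List.prod_cons, ι_lie]
        noncomm_ring
      rw [e]
      exact add_mem (ι_mul_mem_filtration c ih) (prod_mem_filtration (⁅c, a⁆ :: l))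

/-- The factors of `y` are moved past `x` one at a time. By `commutator_ι_mem` each passage leaves a
term of order `m` where `m + 1` would be expected, a loss of one in total order. -/
lemma commutator_mem {m n : ℕ} {x y : TwistedEnveloping K ω} (hx : x ∈ filtration K ω m)
    (hy : y ∈ filtration K ω n) : x * y - y * x ∈ (ringFiltration K ω).prev (m + n) := by
  suffices h : filtration K ω n ≤ ((ringFiltration K ω).prev (m + n)).comap
      (AddMonoidHom.mulLeft x - AddMonoidHom.mulRight x) from h hy
  refine (AddSubgroup.closure_le _).mpr ?_
  have prev_mono : ∀ {i j : ℕ}, i ≤ j → (ringFiltration K ω).prev i ≤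
      (ringFiltration K ω).prev j := by
    intro i j h
    cases i with
    | zero => exact bot_le
    | succ i =>
      cases j with
      | zero => omega
      | succ j => exact filtration_mono (Nat.le_of_succ_le_succ h)
  rintro _ (⟨g, rfl⟩ | ⟨l, hl, rfl⟩)
  · exact prev_mono (Nat.le_add_right m n) (commutator_scalar_mem hx g)
  · refine prev_mono (Nat.add_le_add_left hl m) ?_
    change x * (l.map (ι K ω)).prod - (l.map (ι K ω)).prod * x ∈
      (ringFiltration K ω).prev (m + l.length)
    clear hl
    induction l with
    | nil =>
      rw [List.map_nil, List.prod_nil, one_mul, mul_one, sub_self]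
      exact zero_mem _
    | cons c l ih =>
      have e : x * ((c :: l).map (ι K ω)).prod - ((c :: l).map (ι K ω)).prod * x
          = (x * ι K ω c - ι K ω c * x) * (l.map (ι K ω)).prod
            + ι K ω c * (x * (l.map (ι K ω)).prod - (l.map (ι K ω)).prod * x) := by
        rw [List.map_cons, List.prod_cons]
        noncomm_ring
      have hc : ι K ω c ∈ (ringFiltration K ω).step 1 := by
        have h := prod_mem_filtration (K := K) [c]
        rwa [List.map_singleton, List.prod_singleton] at h
      rw [e, List.length_cons]
      -- By definition `prev (m + (l.length + 1))` is the step `m + l.length`.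
      refine add_mem (mul_mem_filtration (commutator_ι_mem hx c) (prod_mem_filtration l)) ?_
      have h := (ringFiltration K ω).mul_mem_prev_right hc ih
      rwa [add_comm 1, add_assoc] at h

variable (K ω)

/-- The associated graded ring of the twisted enveloping algebra. -/
abbrev Graded : Type (max u v w) := (ringFiltration K ω).Gr

noncomputable instance : CommRing (Graded K ω) where
  __ := (inferInstance : Ring (ringFiltration K ω).Gr)
  mul_comm x y := by
    induction x using (ringFiltration K ω).gr_induction with
    | h₀ => rw [zero_mul, mul_zero]
    | hadd a b ha hb => rw [add_mul, mul_add, ha, hb]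
    | h m a =>
      induction y using (ringFiltration K ω).gr_induction with
      | h₀ => rw [zero_mul, mul_zero]
      | hadd c d hc hd => rw [add_mul, mul_add, hc, hd]
      | h n c =>
        rw [RingFiltration.symbol_mul, RingFiltration.symbol_mul]
        have hmem : (c * a : TwistedEnveloping K ω) ∈ (ringFiltration K ω).step (m + n) := by
          rw [add_comm]; exact (ringFiltration K ω).mul_mem c.2 a.2
        rw [(ringFiltration K ω).symbol_congr (add_comm n m) _ ⟨c * a, hmem⟩ rfl]
        refine congrArg (DirectSum.of _ (m + n)) ?_
        rw [RingFiltration.toPiece_eq_iff]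
        exact commutator_mem a.2 c.2

end TwistedEnveloping

end Symmetric

/-! ### The homomorphism from the symmetric algebra: surjectivity and injectivity -/

section SymmetricGraded

lemma RingFiltration.symbol_eq_zero_iff {A : Type u} [Ring A] (F : RingFiltration A) {n : ℕ}
    (a : F.step n) : F.symbol n a = 0 ↔ (a : A) ∈ F.prev n := by
  rw [← sub_zero (a : A), ← (F.step n).coe_zero, ← F.toPiece_eq_iff, map_zero]
  refine Iff.trans ?_ (DirectSum.of_injective (β := F.Piece) n).eq_iff
  rw [map_zero]
  rfl

/-- Ring homomorphisms from a symmetric algebra are determined on generators. -/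
lemma symmetricAlgebra_hom_ext {R M B : Type*} [CommRing R] [AddCommGroup M] [Module R M]
    [Ring B] {φ ψ : SymmetricAlgebra R M →+* B}
    (h : ∀ f, φ (algebraMap R _ f) = ψ (algebraMap R _ f))
    (h' : ∀ D, φ (SymmetricAlgebra.ι R M D) = ψ (SymmetricAlgebra.ι R M D)) : φ = ψ := by
  refine RingHom.ext fun x => ?_
  induction x using SymmetricAlgebra.induction with
  | algebraMap f => exact h f
  | ι D => exact h' D
  | mul a b ha hb => rw [map_mul, map_mul, ha, hb]
  | add a b ha hb => rw [map_add, map_add, ha, hb]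

namespace TwistedEnveloping

variable (K : Type u) {R : Type v} {L : Type w} [CommRing K] [CommRing R] [Algebra K R]
  [LieRing L] [LieAlgebra K L] [Module R L] [LieRingModule L R] [LieRinehartRing R L]
  [LieRinehartAlgebra K R L] (ω : TwoCocycle R L)

/-- The class in degree `n` of an element of the `n`-th step of the filtration. -/
noncomputable def symbol (n : ℕ) : filtration K ω n →+ Graded K ω := (ringFiltration K ω).symbol n

variable {K ω}

lemma graded_induction {p : Graded K ω → Prop} (h₀ : p 0)
    (h : ∀ n (a : filtration K ω n), p (symbol K ω n a))
    (hadd : ∀ a b, p a → p b → p (a + b)) (x : Graded K ω) : p x :=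
  (ringFiltration K ω).gr_induction h₀ h hadd x

lemma symbol_mul {i j : ℕ} (a : filtration K ω i) (b : filtration K ω j) :
    symbol K ω i a * symbol K ω j b
      = symbol K ω (i + j) ⟨a * b, mul_mem_filtration a.2 b.2⟩ :=
  (ringFiltration K ω).symbol_mul a b

lemma symbol_congr {i j : ℕ} (h : i = j) (a : filtration K ω i) (b : filtration K ω j)
    (hab : (a : TwistedEnveloping K ω) = b) : symbol K ω i a = symbol K ω j b :=
  (ringFiltration K ω).symbol_congr h a b hab

lemma symbol_succ_eq_zero_iff {n : ℕ} (a : filtration K ω (n + 1)) :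
    symbol K ω (n + 1) a = 0 ↔ (a : TwistedEnveloping K ω) ∈ filtration K ω n :=
  (ringFiltration K ω).symbol_eq_zero_iff (n := n + 1) a

lemma symbol_eq_zero_of_lt {m n : ℕ} (h : m < n) (a : filtration K ω n)
    (ha : (a : TwistedEnveloping K ω) ∈ filtration K ω m) : symbol K ω n a = 0 := by
  obtain ⟨n, rfl⟩ : ∃ k, n = k + 1 := ⟨n - 1, by omega⟩
  rw [symbol_succ_eq_zero_iff]
  exact filtration_mono (Nat.le_of_lt_succ h) ha

variable (K ω)

/-- The class in degree zero of a scalar. -/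
noncomputable def gradedScalar : R →+* Graded K ω where
  toFun f := symbol K ω 0 ⟨scalar K ω f, scalar_mem_filtration f 0⟩
  map_one' := by
    refine Eq.trans ?_ (ringFiltration K ω).symbol_one
    exact congrArg (symbol K ω 0) (Subtype.ext (map_one _))
  map_mul' f g := by
    rw [symbol_mul]
    exact congrArg (symbol K ω 0) (Subtype.ext (map_mul _ _ _))
  map_zero' := by
    rw [← map_zero (symbol K ω 0)]
    exact congrArg _ (Subtype.ext (map_zero _))
  map_add' f g := by
    rw [← map_add (symbol K ω 0)]
    exact congrArg _ (Subtype.ext (map_add _ _ _))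

noncomputable instance : Algebra R (Graded K ω) := (gradedScalar K ω).toAlgebra

lemma algebraMap_graded (f : R) :
    algebraMap R (Graded K ω) f = symbol K ω 0 ⟨scalar K ω f, scalar_mem_filtration f 0⟩ := rfl

/-- The class in degree one of an element of `L`. -/
noncomputable def gradedVector : L →ₗ[R] Graded K ω where
  toFun D := symbol K ω 1 ⟨vector K ω D, vector_mem_filtration D⟩
  map_add' D D' := by
    rw [← map_add (symbol K ω 1)]
    exact congrArg _ (Subtype.ext (map_add _ _ _))
  map_smul' f D := by
    rw [RingHom.id_apply, Algebra.smul_def, algebraMap_graded, symbol_mul]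
    refine symbol_congr (zero_add 1).symm _ _ ?_
    have h := ι_smul' K ω f ⟨0, D⟩
    have e : f • (⟨0, D⟩ : Extension ω) = ⟨0, f • D⟩ := by ext <;> simp
    rw [e] at h
    exact h

/-- The canonical homomorphism from the symmetric algebra to the associated graded algebra. -/
noncomputable def symToGraded : SymmetricAlgebra R L →ₐ[R] Graded K ω :=
  SymmetricAlgebra.lift (gradedVector K ω)

lemma symToGraded_ι (D : L) : symToGraded K ω (SymmetricAlgebra.ι R L D)
    = symbol K ω 1 ⟨vector K ω D, vector_mem_filtration D⟩ :=
  SymmetricAlgebra.lift_ι_apply (gradedVector K ω) D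

lemma symToGraded_algebraMap (f : R) : symToGraded K ω (algebraMap R _ f)
    = symbol K ω 0 ⟨scalar K ω f, scalar_mem_filtration f 0⟩ :=
  (symToGraded K ω).commutes f

variable {K ω}

lemma symToGraded_mem_degree {n : ℕ} {s : SymmetricAlgebra R L}
    (hs : s ∈ LinearMap.range (SymmetricAlgebra.ι R L) ^ n) :
    symToGraded K ω s ∈ (symbol K ω n).range := by
  induction hs using Submodule.pow_induction_on_left' with
  | algebraMap f => exact ⟨_, (symToGraded_algebraMap K ω f).symm⟩
  | add x y n _ _ hx hy => rw [map_add]; exact add_mem hx hy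
  | mem_mul m hm n x _ hx =>
    obtain ⟨D, rfl⟩ := hm
    obtain ⟨a, ha⟩ := hx
    rw [map_mul, symToGraded_ι, ← ha, symbol_mul]
    exact ⟨_, symbol_congr (add_comm n 1) ⟨vector K ω D * a.1, by
      rw [add_comm]; exact mul_mem_filtration (vector_mem_filtration D) a.2⟩ _ rfl⟩

/-- In degree one the symbol of `f s + D` is that of `D`, as `f s` lies in step zero. So the product
of the `L`-components is a preimage. -/
lemma exists_symToGraded_eq_prod (l : List (Extension ω)) :
    ∃ s ∈ LinearMap.range (SymmetricAlgebra.ι R L) ^ l.length,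
      symToGraded K ω s = symbol K ω l.length ⟨(l.map (ι K ω)).prod, prod_mem_filtration l⟩ := by
  induction l with
  | nil =>
    refine ⟨1, by rw [List.length_nil, pow_zero]; exact Submodule.one_le.mp le_rfl, ?_⟩
    rw [map_one]
    exact (ringFiltration K ω).symbol_one.symm
  | cons a l ih =>
    obtain ⟨s, hs, h⟩ := ih
    refine ⟨SymmetricAlgebra.ι R L a.snd * s, ?_, ?_⟩
    · rw [List.length_cons, pow_succ']
      exact Submodule.mul_mem_mul ⟨_, rfl⟩ hs
    · rw [map_mul, h, symToGraded_ι]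
      have ha : ι K ω a ∈ filtration K ω 1 := by
        have h := prod_mem_filtration (K := K) [a]
        rwa [List.map_singleton, List.prod_singleton] at h
      have e : symbol K ω 1 ⟨vector K ω a.snd, vector_mem_filtration a.snd⟩
          = symbol K ω 1 ⟨ι K ω a, ha⟩ := by
        rw [← sub_eq_zero, ← map_sub, symbol_succ_eq_zero_iff]
        change vector K ω a.snd - ι K ω a ∈ filtration K ω 0
        have h2 : a = ⟨a.fst, 0⟩ + ⟨0, a.snd⟩ := by ext <;> simp
        have h3 : vector K ω a.snd - ι K ω a = - scalar K ω a.fst := by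
          conv_lhs => rw [h2, map_add]
          change vector K ω _ - (scalar K ω _ + vector K ω _) = _
          simp
        rw [h3]
        exact neg_mem (scalar_mem_filtration _ 0)
      rw [e, symbol_mul]
      refine symbol_congr (add_comm _ _) _ _ ?_
      exact List.prod_cons.symm

/-- Only words of length exactly `n` have a symbol that can be non-zero, apart from functions when
`n = 0`. The preimage is kept in degree `n` so that gradings can be compared later. -/
lemma exists_symToGraded_eq {n : ℕ} (a : filtration K ω n) :
    ∃ s ∈ LinearMap.range (SymmetricAlgebra.ι R L) ^ n, symToGraded K ω s = symbol K ω n a := by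
  obtain ⟨a, ha⟩ := a
  have lower : ∀ {m} (_ : m < n) {x} (hx : x ∈ filtration K ω n) (_ : x ∈ filtration K ω m),
      ∃ s ∈ LinearMap.range (SymmetricAlgebra.ι R L) ^ n,
        symToGraded K ω s = symbol K ω n ⟨x, hx⟩ := fun h x hx hx' =>
    ⟨0, zero_mem _, by rw [map_zero, symbol_eq_zero_of_lt h _ hx']⟩
  induction ha using AddSubgroup.closure_induction with
  | zero => exact ⟨0, zero_mem _, by rw [map_zero, ← map_zero (symbol K ω n)]; rfl⟩
  | add x y hx hy h h' =>
    obtain ⟨s, hs, h⟩ := h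
    obtain ⟨t, ht, h'⟩ := h'
    refine ⟨s + t, add_mem hs ht, ?_⟩
    rw [map_add, h, h', ← map_add]
    rfl
  | neg x hx h =>
    obtain ⟨s, hs, h⟩ := h
    refine ⟨-s, neg_mem hs, ?_⟩
    rw [map_neg, h, ← map_neg]
    rfl
  | mem x hx =>
    obtain ⟨f, rfl⟩ | ⟨l, hl, rfl⟩ := hx
    · rcases Nat.eq_zero_or_pos n with rfl | hn
      · exact ⟨algebraMap R _ f, by rw [pow_zero]; exact Submodule.algebraMap_mem f,
          symToGraded_algebraMap K ω f⟩
      · exact lower hn _ (scalar_mem_filtration f 0)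
    · rcases hl.lt_or_eq with hl' | rfl
      · exact lower hl' _ (prod_mem_filtration l)
      · exact exists_symToGraded_eq_prod l

section Injective

open MvPolynomial Module FreePBW

variable {I : Type*} (b : Basis I R L) [LinearOrder I]

variable (K ω) in
/-- The leading homogeneous part of the action on `1`, on elements of the `n`-th step of the
filtration. -/
noncomputable def leadingPart (n : ℕ) : filtration K ω n →+ MvPolynomial I R where
  toFun x := homogeneousComponent n (representation K b x.1 1)
  map_zero' := by
    change homogeneousComponent n (representation K b (0 : TwistedEnveloping K ω) 1) = 0
    rw [map_zero, LinearMap.zero_apply, map_zero]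
  map_add' x y := by
    change homogeneousComponent n (representation K b (x.1 + y.1) 1) = _
    rw [map_add, LinearMap.add_apply, map_add]

variable (K ω) in
/-- The map from the associated graded algebra to polynomials given by leading parts. -/
noncomputable def gradedToPolynomial : Graded K ω →+ MvPolynomial I R :=
  DirectSum.toAddMonoid fun n => QuotientAddGroup.lift _ (leadingPart K ω b n) fun x hx => by
    have hx' : (x : TwistedEnveloping K ω) ∈ (ringFiltration K ω).prev n :=
      AddSubgroup.mem_addSubgroupOf.mp hx
    change homogeneousComponent n (representation K b x.1 1) = 0
    cases n with
    | zero =>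
      have h : x.1 = 0 := hx'
      rw [h, map_zero, LinearMap.zero_apply, map_zero]
    | succ n =>
      refine homogeneousComponent_eq_zero _ _ (Nat.lt_succ_of_le ?_)
      exact (mem_restrictTotalDegree _ _ _).mp (representation_mem K b hx')

lemma gradedToPolynomial_symbol (n : ℕ) (x : filtration K ω n) :
    gradedToPolynomial K ω b (symbol K ω n x)
      = homogeneousComponent n (representation K b x.1 1) :=
  DirectSum.toAddMonoid_of _ _ _

/-- Leading parts are only known to be additive in `y`. The free factor `y` lets the induction on
`s` absorb generators from the left, where `D` acts on leading parts as its linear form. -/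
lemma gradedToPolynomial_mul (s : SymmetricAlgebra R L) (y : Graded K ω) :
    gradedToPolynomial K ω b (symToGraded K ω s * y)
      = SymmetricAlgebra.equivMvPolynomial b s * gradedToPolynomial K ω b y := by
  induction s using SymmetricAlgebra.induction generalizing y with
  | algebraMap f =>
    rw [AlgEquiv.commutes, symToGraded_algebraMap]
    induction y using graded_induction with
    | h₀ => rw [mul_zero, map_zero, mul_zero]
    | hadd a b ha hb => rw [mul_add, map_add, ha, hb, map_add, mul_add]
    | h n a =>
      have e := symbol_congr (zero_add n) ⟨scalar K ω f * a.1, mul_mem_filtration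
        (scalar_mem_filtration f 0) a.2⟩ ⟨scalar K ω f * a.1, scalar_mul_mem_filtration f a.2⟩ rfl
      rw [symbol_mul, e, gradedToPolynomial_symbol, gradedToPolynomial_symbol, map_mul,
        Module.End.mul_apply, representation_scalar, map_smul, Algebra.smul_def]
  | ι D =>
    have hD : SymmetricAlgebra.equivMvPolynomial b (SymmetricAlgebra.ι R L D)
        = linearForm b D := SymmetricAlgebra.lift_ι_apply _ D
    rw [hD, symToGraded_ι]
    induction y using graded_induction with
    | h₀ => rw [mul_zero, map_zero, mul_zero]
    | hadd a b ha hb => rw [mul_add, map_add, ha, hb, map_add, mul_add]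
    | h n a =>
      have hm : vector K ω D * a.1 ∈ filtration K ω (n + 1) := by
        rw [add_comm]; exact mul_mem_filtration (vector_mem_filtration D) a.2
      have e := symbol_congr (add_comm 1 n) ⟨vector K ω D * a.1, mul_mem_filtration
        (vector_mem_filtration D) a.2⟩ ⟨vector K ω D * a.1, hm⟩ rfl
      rw [symbol_mul, e, gradedToPolynomial_symbol, gradedToPolynomial_symbol, map_mul,
        Module.End.mul_apply]
      change homogeneousComponent (n + 1) (representation K b (ι K ω ⟨0, D⟩) _) = _
      rw [representation_ι, homogeneousComponent_op b D (representation_mem K b a.2)]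
  | mul s t hs ht =>
    rw [map_mul (symToGraded K ω), mul_assoc, hs, ht, map_mul (SymmetricAlgebra.equivMvPolynomial b),
      mul_assoc]
  | add s t hs ht =>
    rw [map_add (symToGraded K ω), add_mul, map_add, hs, ht,
      map_add (SymmetricAlgebra.equivMvPolynomial b), add_mul]

/-- At `y = 1`, `gradedToPolynomial_mul` says that taking leading parts after `symToGraded` is the
isomorphism of the symmetric algebra with polynomials. -/
lemma symToGraded_injective {I : Type*} (b : Basis I R L) :
    Function.Injective (symToGraded K ω) := by
  classical
  -- Any linear order would do: the recursion only takes minima of finite supports.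
  let _ : LinearOrder I := linearOrderOfSTO WellOrderingRel
  rw [injective_iff_map_eq_zero]
  intro s hs
  have h1 : gradedToPolynomial K ω b (1 : Graded K ω) = 1 := by
    have h : (1 : Graded K ω) = symbol K ω 0 ⟨1, one_mem_filtration 0⟩ :=
      (ringFiltration K ω).symbol_one.symm
    rw [h, gradedToPolynomial_symbol, map_one (representation K b), Module.End.one_apply,
      homogeneousComponent_zero, coeff_one, if_pos rfl, map_one]
  have h := gradedToPolynomial_mul (K := K) (ω := ω) b s 1
  rw [hs, zero_mul, map_zero, h1, mul_one] at h
  exact (map_eq_zero_iff _ (SymmetricAlgebra.equivMvPolynomial b).injective).mp h.symm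

end Injective

section Functoriality

variable {R' : Type v} {L' : Type w} [CommRing R'] [Algebra K R']
  [LieRing L'] [LieAlgebra K L'] [Module R' L'] [LieRingModule L' R'] [LieRinehartRing R' L']
  [LieRinehartAlgebra K R' L'] {ω' : TwoCocycle R' L'}

/-- Functoriality of the associated graded algebra of the twisted enveloping algebra. -/
noncomputable def gradedMap (σ : R →ₐ[K] R') (F : LieRinehartAlgebra.Hom σ L L')
    (hω : ∀ x y, σ (ω.form x y) = ω'.form (F x) (F y)) : Graded K ω →+* Graded K ω' :=
  RingFiltration.grMap (F := ringFiltration K ω) (G := ringFiltration K ω') (map σ F hω)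
    fun _ _ => map_mem_filtration σ F hω

lemma gradedMap_symbol (σ : R →ₐ[K] R') (F : LieRinehartAlgebra.Hom σ L L')
    (hω : ∀ x y, σ (ω.form x y) = ω'.form (F x) (F y)) (n : ℕ) (a : filtration K ω n) :
    gradedMap σ F hω (symbol K ω n a)
      = symbol K ω' n ⟨map σ F hω a, map_mem_filtration σ F hω a.2⟩ :=
  RingFiltration.grMap_symbol _ _ _ _

lemma map_vector (σ : R →ₐ[K] R') (F : LieRinehartAlgebra.Hom σ L L')
    (hω : ∀ x y, σ (ω.form x y) = ω'.form (F x) (F y)) (D : L) :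
    map σ F hω (vector K ω D) = vector K ω' (F D) := by
  change map σ F hω (ι K ω ⟨0, D⟩) = ι K ω' ⟨0, F D⟩
  rw [map_ι, map_zero]

/-- The map `S` is any ring homomorphism compatible with `σ` and `F`, so that both restriction maps
and passage to a stalk are covered. -/
lemma gradedMap_symToGraded (σ : R →ₐ[K] R') (F : LieRinehartAlgebra.Hom σ L L')
    (hω : ∀ x y, σ (ω.form x y) = ω'.form (F x) (F y))
    (S : SymmetricAlgebra R L →+* SymmetricAlgebra R' L')
    (hS : ∀ f, S (algebraMap R _ f) = algebraMap R' _ (σ f))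
    (hS' : ∀ D, S (SymmetricAlgebra.ι R L D) = SymmetricAlgebra.ι R' L' (F D))
    (s : SymmetricAlgebra R L) :
    gradedMap σ F hω (symToGraded K ω s) = symToGraded K ω' (S s) := by
  suffices h : (gradedMap σ F hω).comp (symToGraded K ω).toRingHom
      = (symToGraded K ω').toRingHom.comp S from RingHom.congr_fun h s
  refine symmetricAlgebra_hom_ext (fun f => ?_) fun D => ?_
  · change gradedMap σ F hω (symToGraded K ω _) = symToGraded K ω' (S _)
    rw [hS, symToGraded_algebraMap, symToGraded_algebraMap, gradedMap_symbol]
    exact congrArg _ (Subtype.ext (map_scalar σ F hω f))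
  · change gradedMap σ F hω (symToGraded K ω _) = symToGraded K ω' (S _)
    rw [hS', symToGraded_ι, symToGraded_ι, gradedMap_symbol]
    exact congrArg _ (Subtype.ext (map_vector σ F hω D))

end Functoriality

end TwistedEnveloping

end SymmetricGraded

/-! ### Stalks as Lie-Rinehart algebras with a cocycle -/

section Stalks

open CategoryTheory TopologicalSpace Opposite AlgebraicGeometry

/-- The open neighbourhoods of a point, ordered by reverse inclusion. -/
abbrev Nbhd {X : RingedSpace.{u, u}} (x : X) : Type u := {V : Opens X // x ∈ V}ᵒᵈ

namespace Nbhd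

variable {X : RingedSpace.{u, u}} {x : X}

/-- A neighbourhood, as an object of the opposite of the category of open sets. -/
def op (p : Nbhd x) : (Opens X)ᵒᵖ := Opposite.op (OrderDual.ofDual p).1

/-- The morphism given by an inclusion of neighbourhoods. -/
def hom {p q : Nbhd x} (h : p ≤ q) : p.op ⟶ q.op := (homOfLE h).op

/-- The neighbourhood given by an open set containing the point. -/
def mk (V : Opens X) (h : x ∈ V) : Nbhd x := OrderDual.toDual ⟨V, h⟩

instance : Nonempty (Nbhd x) := ⟨mk ⊤ trivial⟩

instance : IsDirectedOrder (Nbhd x) where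
  directed p q := ⟨mk ((OrderDual.ofDual p).1 ⊓ (OrderDual.ofDual q).1)
    ⟨(OrderDual.ofDual p).2, (OrderDual.ofDual q).2⟩,
    show (_ : Opens X) ≤ _ from inf_le_left, show (_ : Opens X) ≤ _ from inf_le_right⟩

end Nbhd

namespace LieAlgebroid

variable {K : Type u} [Field K] {X : RingedSpace.{u, u}} [StructureAlgebra K X]
  (L : LieAlgebroid K X) (x : X)

variable (K) in
/-- The transition maps between rings of functions on neighbourhoods of a point. -/
noncomputable abbrev transO (p q : Nbhd x) (h : p ≤ q) : X.presheaf.obj p.op →ₐ[K] X.presheaf.obj q.op :=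
  resO K (Nbhd.hom h)

/-- The transition maps between sections on neighbourhoods of a point. -/
noncomputable abbrev trans (p q : Nbhd x) (h : p ≤ q) : L.Sec p.op →ₗ⁅K⁆ L.Sec q.op :=
  (L.res (Nbhd.hom h)).toLieHom

/-- The transition maps between symmetric algebras on neighbourhoods of a point. -/
noncomputable abbrev symTrans (p q : Nbhd x) (h : p ≤ q) :
    SymmetricAlgebra (X.presheaf.obj p.op) (L.Sec p.op) →+*
      SymmetricAlgebra (X.presheaf.obj q.op) (L.Sec q.op) :=
  L.symRes (Nbhd.hom h)

instance : DirectedSystem (fun p : Nbhd x => (X.presheaf.obj p.op : Type u))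
    (transO K x · · ·) where
  map_self p f := by
    change (X.presheaf.map (𝟙 p.op)).hom f = f
    rw [X.presheaf.map_id]; rfl
  map_map _ _ _ h h' f := by
    change (X.presheaf.map _).hom ((X.presheaf.map _).hom f)
      = (X.presheaf.map (Nbhd.hom h ≫ Nbhd.hom h')).hom f
    rw [X.presheaf.map_comp]; rfl

instance : DirectedSystem (fun p : Nbhd x => L.Sec p.op) (L.trans x · · ·) where
  map_self p D := L.res_id p.op D
  map_map _ _ _ h h' D := (L.res_comp (Nbhd.hom h) (Nbhd.hom h') D).symm

instance : DirectedSystem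
    (fun p : Nbhd x => SymmetricAlgebra (X.presheaf.obj p.op) (L.Sec p.op))
    (L.symTrans x · · ·) where
  map_self p s := congrArg (fun φ => φ.hom s) (L.symPresheaf.map_id p.op)
  map_map _ _ _ h h' s :=
    congrArg (fun φ => φ.hom s) (L.symPresheaf.map_comp (Nbhd.hom h) (Nbhd.hom h')).symm

variable (K) in
/-- The stalk of the structure sheaf. -/
def StalkO : Type u := DirectLimit (fun p : Nbhd x => (X.presheaf.obj p.op : Type u))
  (transO K x · · ·)

/-- The stalk of a Lie algebroid. -/
def Stalk : Type u := DirectLimit (fun p : Nbhd x => L.Sec p.op) (L.trans x · · ·)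

/-- The stalk of the presheaf of symmetric algebras. -/
def SymStalk : Type u := DirectLimit
  (fun p : Nbhd x => SymmetricAlgebra (X.presheaf.obj p.op) (L.Sec p.op)) (L.symTrans x · · ·)

noncomputable instance : CommRing (StalkO K x) :=
  inferInstanceAs (CommRing (DirectLimit (fun p : Nbhd x => (X.presheaf.obj p.op : Type u)) (transO K x · · ·)))

noncomputable instance : AddCommGroup (L.Stalk x) :=
  inferInstanceAs (AddCommGroup (DirectLimit (fun p : Nbhd x => L.Sec p.op) (L.trans x · · ·)))

noncomputable instance : CommRing (L.SymStalk x) :=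
  inferInstanceAs (CommRing (DirectLimit
    (fun p : Nbhd x => SymmetricAlgebra (X.presheaf.obj p.op) (L.Sec p.op)) (L.symTrans x · · ·)))

variable {x}

variable (K) in
/-- The germ of a function. -/
noncomputable def germO (p : Nbhd x) : X.presheaf.obj p.op →+* StalkO K x where
  toFun f := (⟦⟨p, f⟩⟧ : DirectLimit _ _)
  map_one' := (DirectLimit.one_def (f := transO K x) p :).symm
  map_mul' f g := (DirectLimit.mul_def (f := transO K x) p f g :).symm
  map_zero' := (DirectLimit.zero_def (f := transO K x) p :).symm
  map_add' f g := (DirectLimit.add_def (f := transO K x) p f g :).symm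

/-- The germ of a section of a Lie algebroid. -/
noncomputable def germ (p : Nbhd x) : L.Sec p.op →+ L.Stalk x where
  toFun D := (⟦⟨p, D⟩⟧ : DirectLimit _ _)
  map_zero' := (DirectLimit.zero_def (f := L.trans x) p :).symm
  map_add' D E := (DirectLimit.add_def (f := L.trans x) p D E :).symm

/-- The germ of an element of the symmetric algebra. -/
noncomputable def symGerm (p : Nbhd x) :
    SymmetricAlgebra (X.presheaf.obj p.op) (L.Sec p.op) →+* L.SymStalk x where
  toFun s := (⟦⟨p, s⟩⟧ : DirectLimit _ _)
  map_one' := (DirectLimit.one_def (f := L.symTrans x) p :).symm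
  map_mul' f g := (DirectLimit.mul_def (f := L.symTrans x) p f g :).symm
  map_zero' := (DirectLimit.zero_def (f := L.symTrans x) p :).symm
  map_add' f g := (DirectLimit.add_def (f := L.symTrans x) p f g :).symm

lemma germO_res {p q : Nbhd x} (h : p ≤ q) (f : X.presheaf.obj p.op) :
    germO K q (resO K (Nbhd.hom h) f) = germO K p f :=
  (DirectLimit.mk_apply (f := transO K x) p q f h :)

lemma germ_res {p q : Nbhd x} (h : p ≤ q) (D : L.Sec p.op) :
    L.germ q (L.res (Nbhd.hom h) D) = L.germ p D :=
  (DirectLimit.mk_apply (f := L.trans x) p q D h :)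

lemma symGerm_eq_zero {p : Nbhd x} {s : SymmetricAlgebra (X.presheaf.obj p.op) (L.Sec p.op)}
    (hs : L.symGerm p s = 0) : ∃ (q : Nbhd x) (h : p ≤ q), L.symRes (Nbhd.hom h) s = 0 := by
  have h := (DirectLimit.exists_eq_zero (f := L.symTrans x) ⟨p, s⟩ :)
  exact h.mp hs

lemma exists_germO (a : StalkO K x) : ∃ (p : Nbhd x) (f : _), germO K p f = a := by
  obtain ⟨p, f, h⟩ := DirectLimit.exists_eq_mk (transO K x · · ·) a
  exact ⟨p, f, h.symm⟩

lemma exists_germ (a : L.Stalk x) : ∃ (p : Nbhd x) (D : _), L.germ p D = a := by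
  obtain ⟨p, D, h⟩ := DirectLimit.exists_eq_mk (L.trans x · · ·) a
  exact ⟨p, D, h.symm⟩

/-- Finitely many germs are represented by sections over a common neighbourhood. -/
lemma stalk_induction {P : StalkO K x → StalkO K x → L.Stalk x → L.Stalk x → L.Stalk x → Prop}
    (h : ∀ (p : Nbhd x) f g D E F,
      P (germO K p f) (germO K p g) (L.germ p D) (L.germ p E) (L.germ p F)) (a b c d e) :
    P a b c d e := by
  obtain ⟨p₁, f, rfl⟩ := exists_germO a
  obtain ⟨p₂, g, rfl⟩ := exists_germO b
  obtain ⟨p₃, D, rfl⟩ := L.exists_germ c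
  obtain ⟨p₄, E, rfl⟩ := L.exists_germ d
  obtain ⟨p₅, F, rfl⟩ := L.exists_germ e
  obtain ⟨q₁, h₁, h₂⟩ := exists_ge_ge p₁ p₂
  obtain ⟨q₂, h₃, h₄⟩ := exists_ge_ge p₃ p₄
  obtain ⟨q₃, h₅, h₆⟩ := exists_ge_ge q₁ q₂
  obtain ⟨q, h₇, h₈⟩ := exists_ge_ge q₃ p₅
  rw [← germO_res (h₁.trans (h₅.trans h₇)), ← germO_res (h₂.trans (h₅.trans h₇)),
    ← L.germ_res (h₃.trans (h₆.trans h₇)), ← L.germ_res (h₄.trans (h₆.trans h₇)),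
    ← L.germ_res h₈]
  exact h _ _ _ _ _ _

noncomputable instance : SMul (StalkO K x) (L.Stalk x) where
  smul := DirectLimit.map₂ (transO K x · · ·)
    (L.trans x · · ·) (L.trans x · · ·)
    (fun _ f D => f • D) fun _ _ h f D => (L.res (Nbhd.hom h)).map_smul_apply f D

lemma germ_smul (p : Nbhd x) (f : X.presheaf.obj p.op) (D : L.Sec p.op) :
    L.germ p (f • D) = germO K p f • L.germ p D :=
  (DirectLimit.map₂_def (transO K x · · ·) (L.trans x · · ·) (L.trans x · · ·)
    (fun _ f D => f • D) (fun _ _ h f D => (L.res (Nbhd.hom h)).map_smul_apply f D) p f D :).symm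

noncomputable instance : Bracket (L.Stalk x) (L.Stalk x) where
  bracket := DirectLimit.map₂ (L.trans x · · ·)
    (L.trans x · · ·) (L.trans x · · ·)
    (fun _ D E => ⁅D, E⁆) fun _ _ h D E => (L.res (Nbhd.hom h)).toLieHom.map_lie D E

lemma germ_lie (p : Nbhd x) (D E : L.Sec p.op) :
    L.germ p ⁅D, E⁆ = ⁅L.germ p D, L.germ p E⁆ :=
  (DirectLimit.map₂_def (L.trans x · · ·) (L.trans x · · ·) (L.trans x · · ·)
    (fun _ D E => ⁅D, E⁆) (fun _ _ h D E => (L.res (Nbhd.hom h)).toLieHom.map_lie D E) p D E :).symm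

noncomputable instance : Bracket (L.Stalk x) (StalkO K x) where
  bracket := DirectLimit.map₂ (L.trans x · · ·)
    (transO K x · · ·) (transO K x · · ·)
    (fun _ D f => ⁅D, f⁆) fun _ _ h D f => (L.res (Nbhd.hom h)).apply_lie f D

lemma germO_lie (p : Nbhd x) (D : L.Sec p.op) (f : X.presheaf.obj p.op) :
    germO K p ⁅D, f⁆ = ⁅L.germ p D, germO K p f⁆ :=
  (DirectLimit.map₂_def (L.trans x · · ·) (transO K x · · ·) (transO K x · · ·)
    (fun _ D f => ⁅D, f⁆) (fun _ _ h D f => (L.res (Nbhd.hom h)).apply_lie f D) p D f :).symm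

noncomputable instance : Module (StalkO K x) (L.Stalk x) where
  -- Each axiom is checked on representatives over one neighbourhood. Places of `stalk_induction`
  -- that the identity does not involve are filled with `0`, here and below.
  one_smul c := L.stalk_induction (P := fun _ _ c _ _ => (1 : StalkO K x) • c = c)
    (fun p _ _ D _ _ => by rw [← map_one (germO K p), ← germ_smul, one_smul]) 0 0 c 0 0
  mul_smul a b c := L.stalk_induction (P := fun a b c _ _ => (a * b) • c = a • b • c)
    (fun p f g D _ _ => by
      rw [← map_mul, ← germ_smul, ← germ_smul, ← germ_smul, mul_smul]) a b c 0 0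
  smul_zero a := L.stalk_induction (P := fun a _ _ _ _ => a • (0 : L.Stalk x) = 0)
    (fun p f _ _ _ _ => by rw [← map_zero (L.germ p), ← germ_smul, smul_zero]) a 0 0 0 0
  smul_add a c d := L.stalk_induction (P := fun a _ c d _ => a • (c + d) = a • c + a • d)
    (fun p f _ D E _ => by
      rw [← map_add, ← germ_smul, ← germ_smul, ← germ_smul, ← map_add, smul_add]) a 0 c d 0
  add_smul a b c := L.stalk_induction (P := fun a b c _ _ => (a + b) • c = a • c + b • c)
    (fun p f g D _ _ => by
      rw [← map_add, ← germ_smul, ← germ_smul, ← germ_smul, ← map_add, add_smul]) a b c 0 0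
  zero_smul c := L.stalk_induction (P := fun _ _ c _ _ => (0 : StalkO K x) • c = 0)
    (fun p _ _ D _ _ => by
      rw [← map_zero (germO K p), ← germ_smul, zero_smul, map_zero]) 0 0 c 0 0

noncomputable instance : LieRing (L.Stalk x) where
  add_lie c d e := L.stalk_induction (P := fun _ _ c d e => ⁅c + d, e⁆ = ⁅c, e⁆ + ⁅d, e⁆)
    (fun p _ _ D E F => by
      rw [← map_add, ← germ_lie, ← germ_lie, ← germ_lie, ← map_add, add_lie]) 0 0 c d e
  lie_add c d e := L.stalk_induction (P := fun _ _ c d e => ⁅c, d + e⁆ = ⁅c, d⁆ + ⁅c, e⁆)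
    (fun p _ _ D E F => by
      rw [← map_add, ← germ_lie, ← germ_lie, ← germ_lie, ← map_add, lie_add]) 0 0 c d e
  lie_self c := L.stalk_induction (P := fun _ _ c _ _ => ⁅c, c⁆ = 0)
    (fun p _ _ D _ _ => by rw [← germ_lie, lie_self, map_zero]) 0 0 c 0 0
  leibniz_lie c d e := L.stalk_induction
    (P := fun _ _ c d e => ⁅c, ⁅d, e⁆⁆ = ⁅⁅c, d⁆, e⁆ + ⁅d, ⁅c, e⁆⁆)
    (fun p _ _ D E F => by
      simp only [← germ_lie, ← map_add]
      rw [leibniz_lie]) 0 0 c d e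

noncomputable instance : LieRingModule (L.Stalk x) (StalkO K x) where
  add_lie c d a := L.stalk_induction (P := fun a _ c d _ => ⁅c + d, a⁆ = ⁅c, a⁆ + ⁅d, a⁆)
    (fun p f _ D E _ => by
      rw [← map_add, ← germO_lie, ← germO_lie, ← germO_lie, ← map_add, add_lie]) a 0 c d 0
  lie_add c a b := L.stalk_induction (P := fun a b c _ _ => ⁅c, a + b⁆ = ⁅c, a⁆ + ⁅c, b⁆)
    (fun p f g D _ _ => by
      rw [← map_add, ← germO_lie, ← germO_lie, ← germO_lie, ← map_add, lie_add]) a b c 0 0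
  leibniz_lie c d a := L.stalk_induction
    (P := fun a _ c d _ => ⁅c, ⁅d, a⁆⁆ = ⁅⁅c, d⁆, a⁆ + ⁅d, ⁅c, a⁆⁆)
    (fun p f _ D E _ => by
      simp only [← germ_lie, ← germO_lie, ← map_add]
      rw [leibniz_lie]) a 0 c d 0

instance : LieRinehartRing (StalkO K x) (L.Stalk x) where
  lie_smul_eq_mul' a b c := L.stalk_induction (P := fun a b c _ _ => ⁅a • c, b⁆ = a * ⁅c, b⁆)
    (fun p f g D _ _ => by
      simp only [← germ_smul, ← germO_lie, ← map_mul]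
      rw [LieRinehartRing.lie_smul_eq_mul]) a b c 0 0
  leibniz_mul_right' c a b := L.stalk_induction
    (P := fun a b c _ _ => ⁅c, a * b⁆ = a • ⁅c, b⁆ + ⁅c, a⁆ * b)
    (fun p f g D _ _ => by
      simp only [← germO_lie, ← map_mul, smul_eq_mul, ← map_add]
      rw [LieRinehartRing.leibniz_mul_right, smul_eq_mul]) a b c 0 0
  leibniz_smul_right' c d a := L.stalk_induction
    (P := fun a _ c d _ => ⁅c, a • d⁆ = a • ⁅c, d⁆ + ⁅c, a⁆ • d)
    (fun p f _ D E _ => by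
      simp only [← germO_lie, ← germ_smul, ← germ_lie, ← map_add]
      rw [LieRinehartRing.leibniz_smul_right]) a 0 c d 0

noncomputable instance : Algebra K (StalkO K x) :=
  ((germO K (Nbhd.mk ⊤ trivial)).comp (algebraMap K _)).toAlgebra

/-- Constants in the stalk are defined as germs of global constants; restriction preserves
constants, so any neighbourhood computes them. -/
lemma germO_algebraMap (p : Nbhd x) (c : K) :
    germO K p (algebraMap K _ c) = algebraMap K (StalkO K x) c := by
  have h : Nbhd.mk ⊤ trivial ≤ p := show (_ : Opens X) ≤ _ from le_top
  exact (congrArg (germO K p) ((resO K (Nbhd.hom h)).commutes c)).symm.trans (germO_res h _)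

noncomputable instance : Module K (L.Stalk x) :=
  Module.compHom (L.Stalk x) (algebraMap K (StalkO K x))

instance : IsScalarTower K (StalkO K x) (L.Stalk x) where
  smul_assoc c a d := by
    change (c • a) • d = algebraMap K (StalkO K x) c • a • d
    rw [Algebra.smul_def, mul_smul]

lemma germ_ksmul (p : Nbhd x) (c : K) (D : L.Sec p.op) :
    L.germ p (c • D) = c • L.germ p D := by
  rw [← algebraMap_smul (X.presheaf.obj p.op) c D, germ_smul, germO_algebraMap, algebraMap_smul]

lemma germO_ksmul (p : Nbhd x) (c : K) (f : X.presheaf.obj p.op) :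
    germO K p (c • f) = c • germO K p f := by
  rw [Algebra.smul_def, map_mul, germO_algebraMap, Algebra.smul_def]

noncomputable instance : LieAlgebra K (L.Stalk x) where
  lie_smul c d e := L.stalk_induction (P := fun _ _ d e _ => ⁅d, c • e⁆ = c • ⁅d, e⁆)
    (fun p _ _ D E _ => by
      rw [← germ_ksmul, ← germ_lie, ← germ_lie, ← germ_ksmul, lie_smul]) 0 0 d e 0

instance : LieRinehartAlgebra K (StalkO K x) (L.Stalk x) where
  smul_lie c d a := L.stalk_induction (P := fun a _ d _ _ => ⁅c • d, a⁆ = c • ⁅d, a⁆)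
    (fun p f _ D _ _ => by
      rw [← germ_ksmul, ← germO_lie, ← germO_lie, ← germO_ksmul, smul_lie]) a 0 d 0 0
  lie_smul c d a := L.stalk_induction (P := fun a _ d _ _ => ⁅d, c • a⁆ = c • ⁅d, a⁆)
    (fun p f _ D _ _ => by
      have hl : ⁅D, c • f⁆ = c • ⁅D, f⁆ := LieModule.lie_smul c D f
      rw [← germO_ksmul, ← germO_lie, ← germO_lie, ← germO_ksmul, hl]) a 0 d 0 0

/-- The germ map on functions, as a homomorphism of algebras. -/
noncomputable def germOAlg (p : Nbhd x) : X.presheaf.obj p.op →ₐ[K] StalkO K x :=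
  { germO K p with commutes' := germO_algebraMap p }

/-- The germ map, as a morphism of Lie-Rinehart algebras. -/
noncomputable def germHom (p : Nbhd x) :
    LieRinehartAlgebra.Hom (germOAlg (K := K) p) (L.Sec p.op) (L.Stalk x) where
  toFun := L.germ p
  map_add' := map_add (L.germ p)
  map_smul' := L.germ_ksmul p
  map_lie' {D E} := L.germ_lie p D E
  map_smul_apply' f D := L.germ_smul p f D
  apply_lie' f D := L.germO_lie p D f

section Cocycle

variable (ω : L.Cocycle)

/-- The form on the stalk induced by a cocycle. -/
noncomputable def stalkForm : L.Stalk x → L.Stalk x → StalkO K x :=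
  DirectLimit.map₂ (L.trans x · · ·)
    (L.trans x · · ·) (transO K x · · ·)
    (fun p D E => (ω.val p.op).form D E) fun _ _ h D E => ω.res_val (Nbhd.hom h) D E

lemma germO_form (p : Nbhd x) (D E : L.Sec p.op) :
    germO K p ((ω.val p.op).form D E) = L.stalkForm ω (L.germ p D) (L.germ p E) :=
  (DirectLimit.map₂_def (L.trans x · · ·) (L.trans x · · ·) (transO K x · · ·)
    (fun p D E => (ω.val p.op).form D E) (fun _ _ h D E => ω.res_val (Nbhd.hom h) D E) p D E :).symm

variable (x) in
/-- The cocycle on the stalk. -/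
noncomputable def stalkCocycle : TwoCocycle (StalkO K x) (L.Stalk x) where
  form := LinearMap.mk₂ (StalkO K x) (L.stalkForm ω)
    (fun c d e => L.stalk_induction (P := fun _ _ c d e =>
        L.stalkForm ω (c + d) e = L.stalkForm ω c e + L.stalkForm ω d e)
      (fun p _ _ D E F => by
        rw [← map_add, ← germO_form, ← germO_form, ← germO_form, ← map_add, map_add,
          LinearMap.add_apply]) 0 0 c d e)
    (fun a c d => L.stalk_induction (P := fun a _ c d _ =>
        L.stalkForm ω (a • c) d = a • L.stalkForm ω c d)
      (fun p f _ D E _ => by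
        rw [← germ_smul, ← germO_form, ← germO_form, smul_eq_mul, ← map_mul, map_smul,
          LinearMap.smul_apply, smul_eq_mul]) a 0 c d 0)
    (fun c d e => L.stalk_induction (P := fun _ _ c d e =>
        L.stalkForm ω c (d + e) = L.stalkForm ω c d + L.stalkForm ω c e)
      (fun p _ _ D E F => by
        rw [← map_add, ← germO_form, ← germO_form, ← germO_form, ← map_add, map_add]) 0 0 c d e)
    (fun a c d => L.stalk_induction (P := fun a _ c d _ =>
        L.stalkForm ω c (a • d) = a • L.stalkForm ω c d)
      (fun p f _ D E _ => by
        rw [← germ_smul, ← germO_form, ← germO_form, smul_eq_mul, ← map_mul, map_smul,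
          smul_eq_mul]) a 0 c d 0)
  alternating c := L.stalk_induction (P := fun _ _ c _ _ => L.stalkForm ω c c = 0)
    (fun p _ _ D _ _ => by
      rw [← germO_form, (ω.val p.op).alternating, map_zero]) 0 0 c 0 0
  closed c d e := L.stalk_induction (P := fun _ _ c d e =>
      ⁅c, L.stalkForm ω d e⁆ - ⁅d, L.stalkForm ω c e⁆ + ⁅e, L.stalkForm ω c d⁆
        - L.stalkForm ω ⁅c, d⁆ e + L.stalkForm ω ⁅c, e⁆ d - L.stalkForm ω ⁅d, e⁆ c = 0)
    (fun p _ _ D E F => by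
      simp only [← germ_lie, ← germO_form, ← germO_lie, ← map_add, ← map_sub]
      rw [(ω.val p.op).closed, map_zero]) 0 0 c d e

end Cocycle

/-- The map of symmetric algebras given by taking germs. -/
noncomputable def symToStalk (p : Nbhd x) :
    SymmetricAlgebra (X.presheaf.obj p.op) (L.Sec p.op) →+*
      SymmetricAlgebra (StalkO K x) (L.Stalk x) :=
  letI : Algebra (X.presheaf.obj p.op) (SymmetricAlgebra (StalkO K x) (L.Stalk x)) :=
    ((algebraMap (StalkO K x) (SymmetricAlgebra (StalkO K x) (L.Stalk x))).comp
      (germO K p)).toAlgebra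
  (SymmetricAlgebra.lift
    { toFun := fun D => SymmetricAlgebra.ι (StalkO K x) (L.Stalk x) (L.germ p D)
      map_add' := fun D D' => by rw [map_add, map_add]
      map_smul' := fun f D => by
        rw [germ_smul, map_smul, Algebra.smul_def, Algebra.smul_def]
        rfl } : SymmetricAlgebra (X.presheaf.obj p.op) (L.Sec p.op) →ₐ[X.presheaf.obj p.op]
      SymmetricAlgebra (StalkO K x) (L.Stalk x)).toRingHom

lemma symToStalk_ι (p : Nbhd x) (D : L.Sec p.op) :
    L.symToStalk p (SymmetricAlgebra.ι _ _ D) = SymmetricAlgebra.ι _ _ (L.germ p D) := by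
  let _ : Algebra (X.presheaf.obj p.op) (SymmetricAlgebra (StalkO K x) (L.Stalk x)) :=
    ((algebraMap (StalkO K x) (SymmetricAlgebra (StalkO K x) (L.Stalk x))).comp
      (germO K p)).toAlgebra
  exact SymmetricAlgebra.lift_ι_apply _ D

lemma symToStalk_algebraMap (p : Nbhd x) (f : X.presheaf.obj p.op) :
    L.symToStalk p (algebraMap _ _ f) = algebraMap _ _ (germO K p f) := by
  let _ : Algebra (X.presheaf.obj p.op) (SymmetricAlgebra (StalkO K x) (L.Stalk x)) :=
    ((algebraMap (StalkO K x) (SymmetricAlgebra (StalkO K x) (L.Stalk x))).comp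
      (germO K p)).toAlgebra
  exact AlgHom.commutes (SymmetricAlgebra.lift _) f

/-- The scalars in the stalk of the presheaf of symmetric algebras. -/
noncomputable def symStalkScalar : StalkO K x → L.SymStalk x :=
  DirectLimit.map (transO K x · · ·) (L.symTrans x · · ·) (fun _ f => algebraMap _ _ f)
    fun _ _ h f => L.symRes_algebraMap (Nbhd.hom h) f

lemma symStalkScalar_germO (p : Nbhd x) (f : X.presheaf.obj p.op) :
    L.symStalkScalar (germO K p f) = L.symGerm p (algebraMap _ _ f) := rfl

noncomputable instance : Algebra (StalkO K x) (L.SymStalk x) :=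
  RingHom.toAlgebra
    { toFun := L.symStalkScalar
      map_one' := by
        rw [← map_one (germO K (Nbhd.mk (x := x) ⊤ trivial)), symStalkScalar_germO, map_one,
          map_one]
      map_mul' := fun a b => L.stalk_induction (P := fun a b _ _ _ =>
          L.symStalkScalar (a * b) = L.symStalkScalar a * L.symStalkScalar b)
        (fun p f g _ _ _ => by
          rw [← map_mul]
          simp only [symStalkScalar_germO]
          rw [map_mul, map_mul]) a b 0 0 0
      map_zero' := by
        rw [← map_zero (germO K (Nbhd.mk (x := x) ⊤ trivial)), symStalkScalar_germO, map_zero,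
          map_zero]
      map_add' := fun a b => L.stalk_induction (P := fun a b _ _ _ =>
          L.symStalkScalar (a + b) = L.symStalkScalar a + L.symStalkScalar b)
        (fun p f g _ _ _ => by
          rw [← map_add]
          simp only [symStalkScalar_germO]
          rw [map_add, map_add]) a b 0 0 0 }

lemma algebraMap_germO (p : Nbhd x) (f : X.presheaf.obj p.op) :
    algebraMap (StalkO K x) (L.SymStalk x) (germO K p f) = L.symGerm p (algebraMap _ _ f) := rfl

/-- The vectors in the stalk of the presheaf of symmetric algebras. -/
noncomputable def symStalkVector : L.Stalk x → L.SymStalk x :=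
  DirectLimit.map (L.trans x · · ·) (L.symTrans x · · ·) (fun _ D => SymmetricAlgebra.ι _ _ D)
    fun _ _ h D => L.symRes_ι (Nbhd.hom h) D

lemma symStalkVector_germ (p : Nbhd x) (D : L.Sec p.op) :
    L.symStalkVector (L.germ p D) = L.symGerm p (SymmetricAlgebra.ι _ _ D) := rfl

/-- The inclusion of the stalk of a Lie algebroid in the stalk of its symmetric algebras. -/
noncomputable def symStalkι : L.Stalk x →ₗ[StalkO K x] L.SymStalk x where
  toFun := L.symStalkVector
  map_add' c d := L.stalk_induction (P := fun _ _ c d _ =>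
      L.symStalkVector (c + d) = L.symStalkVector c + L.symStalkVector d)
    (fun p _ _ D E _ => by
      rw [← map_add]
      simp only [symStalkVector_germ]
      rw [map_add, map_add]) 0 0 c d 0
  map_smul' a c := L.stalk_induction (P := fun a _ c _ _ =>
      L.symStalkVector (a • c) = a • L.symStalkVector c)
    (fun p f _ D _ _ => by
      rw [← germ_smul, Algebra.smul_def, algebraMap_germO]
      simp only [symStalkVector_germ]
      rw [map_smul, Algebra.smul_def, map_mul]) a 0 c 0 0

lemma symStalkι_germ (p : Nbhd x) (D : L.Sec p.op) :
    L.symStalkι (L.germ p D) = L.symGerm p (SymmetricAlgebra.ι _ _ D) := rfl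

/-- An element of a symmetric algebra which vanishes in the symmetric algebra of the stalk
vanishes in a neighbourhood of the point. -/
lemma exists_symRes_eq_zero {p : Nbhd x}
    {s : SymmetricAlgebra (X.presheaf.obj p.op) (L.Sec p.op)} (hs : L.symToStalk p s = 0) :
    ∃ (q : Nbhd x) (h : p ≤ q), L.symRes (Nbhd.hom h) s = 0 := by
  refine L.symGerm_eq_zero ?_
  -- The symmetric algebra of the stalk maps to the direct limit of symmetric algebras, and the germ
  -- map factors through it. So vanishing over the stalk forces the germ to vanish.
  have h : (SymmetricAlgebra.lift (L.symStalkι (x := x))).toRingHom.comp (L.symToStalk p)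
      = L.symGerm p := by
    refine symmetricAlgebra_hom_ext (fun f => ?_) fun D => ?_
    · change SymmetricAlgebra.lift L.symStalkι (L.symToStalk p _) = _
      rw [symToStalk_algebraMap, AlgHom.commutes, algebraMap_germO]
    · change SymmetricAlgebra.lift L.symStalkι (L.symToStalk p _) = _
      rw [symToStalk_ι, SymmetricAlgebra.lift_ι_apply, symStalkι_germ]
  rw [← h]
  change SymmetricAlgebra.lift L.symStalkι (L.symToStalk p s) = 0
  rw [hs, map_zero]

end LieAlgebroid

end Stalks

/-! ### Bases of a sheaf of modules: local spanning and coordinates -/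

section LocallySpanned

open CategoryTheory

variable {C : Type u} [Category.{u} C] {J : GrothendieckTopology C} {R : Sheaf J RingCat.{u}}
  {M : SheafOfModules.{u} R} {I : Type u} (s : I → M.sections)

/-- The span of a family of global sections of a sheaf of modules, on sections over an object. -/
def sectionsSpan (V : Cᵒᵖ) : Submodule (R.obj.obj V) (M.val.obj V) :=
  Submodule.span _ (Set.range fun i => (s i).val V)

lemma map_mem_sectionsSpan {V W : Cᵒᵖ} (f : V ⟶ W) {m : M.val.obj V}
    (hm : m ∈ sectionsSpan s V) : M.val.map f m ∈ sectionsSpan s W := by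
  induction hm using Submodule.span_induction with
  | mem m hm =>
    obtain ⟨i, rfl⟩ := hm
    exact Submodule.subset_span ⟨i, ((s i).property f).symm⟩
  | zero => rw [map_zero]; exact zero_mem _
  | add m n _ _ hm hn => rw [map_add]; exact add_mem hm hn
  | smul r m _ hm => rw [M.val.map_smul]; exact Submodule.smul_mem _ _ hm

/-- The arrows along which a section restricts to a linear combination of a given family of
sections. -/
def spanSieve {V : Cᵒᵖ} (m : M.val.obj V) : Sieve V.unop where
  arrows Y f := (M.val.map f.op m : M.val.obj (Opposite.op Y)) ∈ sectionsSpan s (Opposite.op Y)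
  downward_closed {Y Z f} hf g := by
    have h := map_mem_sectionsSpan s g.op hf
    rwa [← PresheafOfModules.map_comp_apply] at h

/-- The sections which are locally linear combinations of a given family of sections. -/
def locallySpanned : M.val.Submodule where
  obj V :=
    { carrier := {m | spanSieve s m ∈ J V.unop}
      zero_mem' := by
        refine J.superset_covering (fun Y f _ => ?_) (J.top_mem _)
        change (M.val.map f.op 0 : M.val.obj (Opposite.op Y)) ∈ sectionsSpan s (Opposite.op Y)
        rw [map_zero]; exact zero_mem _
      add_mem' := fun {m n} hm hn => by
        refine J.superset_covering (fun Y f hf => ?_) (J.intersection_covering hm hn)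
        change (M.val.map f.op (m + n) : M.val.obj (Opposite.op Y)) ∈ sectionsSpan s (Opposite.op Y)
        rw [map_add]; exact add_mem hf.1 hf.2
      smul_mem' := fun r m hm => by
        refine J.superset_covering (fun Y f hf => ?_) hm
        change (M.val.map f.op (r • m) : M.val.obj (Opposite.op Y)) ∈ sectionsSpan s (Opposite.op Y)
        rw [M.val.map_smul]; exact Submodule.smul_mem _ _ hf }
  map {V W} f m hm := by
    refine J.superset_covering (fun Y g hg => ?_) (J.pullback_stable f.unop hm)
    change (M.val.map g.op (M.val.map f m) : M.val.obj (Opposite.op Y)) ∈ sectionsSpan s (Opposite.op Y)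
    have hg' : (M.val.map (g ≫ f.unop).op m : M.val.obj (Opposite.op Y)) ∈ sectionsSpan s (Opposite.op Y) := hg
    rwa [← PresheafOfModules.map_comp_apply]

/-- Being a linear combination locally is itself a local condition, by transitivity of covering
sieves, so these sections form a subsheaf of `M`. -/
lemma locallySpanned_isSheaf :
    Presheaf.IsSheaf J (locallySpanned s).toPresheafOfModules.presheaf := by
  rw [Presheaf.isSheaf_iff_isSheaf_forget J _ (forget AddCommGrpCat.{u}),
    isSheaf_iff_isSheaf_of_type]
  have hM : Presieve.IsSheaf J (M.val.presheaf ⋙ forget AddCommGrpCat.{u}) := by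
    rw [← isSheaf_iff_isSheaf_of_type, ← Presheaf.isSheaf_iff_isSheaf_forget]
    exact M.isSheaf
  let G : Subfunctor (M.val.presheaf ⋙ forget AddCommGrpCat.{u}) :=
    { obj := fun V => {m : M.val.obj V | m ∈ (locallySpanned s).obj V}
      map := fun f m hm => (locallySpanned s).map f hm }
  have hG : Presieve.IsSheaf J G.toFunctor := by
    rw [Subfunctor.isSheaf_iff G hM]
    intro V (m : M.val.obj V) hm
    refine J.transitive hm _ fun Y f hf => ?_
    have hf' : spanSieve s (V := Opposite.op Y) (M.val.map f.op m) ∈ J Y := hf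
    refine J.superset_covering (fun Z g hg => ?_) hf'
    have hg' : (M.val.map g.op (M.val.map f.op m) : M.val.obj (Opposite.op Z)) ∈ sectionsSpan s (Opposite.op Z) := hg
    rw [← PresheafOfModules.map_comp_apply] at hg'
    exact hg'
  exact hG

/-- The sheaf of sections which are locally linear combinations of a given family of sections. -/
noncomputable def locallySpannedSheaf : SheafOfModules.{u} R :=
  ⟨(locallySpanned s).toPresheafOfModules, locallySpanned_isSheaf s⟩

variable [HasWeakSheafify J AddCommGrpCat.{u}] [J.WEqualsLocallyBijective AddCommGrpCat.{u}]
  [IsIso (M.freeHomEquiv.symm s)]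

/-- If a family of sections is a basis of a sheaf of modules, then every section is locally a
linear combination of the family. -/
lemma spanSieve_mem {V : Cᵒᵖ} (m : M.val.obj V) : spanSieve s m ∈ J V.unop := by
  let ι : locallySpannedSheaf s ⟶ M := ⟨(locallySpanned s).ι⟩
  let t : I → (locallySpannedSheaf s).sections := fun i =>
    ⟨fun V => ⟨(s i).val V, J.superset_covering (fun Y f _ => by
        change (M.val.map f.op ((s i).val V) : M.val.obj (Opposite.op Y)) ∈ sectionsSpan s (Opposite.op Y)
        exact map_mem_sectionsSpan s f.op (Submodule.subset_span ⟨i, rfl⟩)) (J.top_mem _)⟩,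
      fun f => Subtype.ext ((s i).property f)⟩
  -- The isomorphism from the free sheaf factors through the subsheaf of locally spanned sections.
  -- Its inverse therefore gives a section of the inclusion `ι`, and every section of `M` lies in
  -- the subsheaf.
  have h : (locallySpannedSheaf s).freeHomEquiv.symm t ≫ ι = M.freeHomEquiv.symm s := by
    rw [SheafOfModules.freeHomEquiv_symm_comp]
    rfl
  have h' : (inv (M.freeHomEquiv.symm s) ≫ (locallySpannedSheaf s).freeHomEquiv.symm t) ≫ ι
      = 𝟙 M := by
    rw [Category.assoc, h, IsIso.inv_hom_id]
  have h'' := congrArg (fun φ : M ⟶ M => φ.val.app V m) h'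
  have e : ((inv (M.freeHomEquiv.symm s) ≫ (locallySpannedSheaf s).freeHomEquiv.symm t).val.app V
      m : (locallySpanned s).obj V).1 = m := h''
  rw [← e]
  exact ((inv (M.freeHomEquiv.symm s) ≫ (locallySpannedSheaf s).freeHomEquiv.symm t).val.app V
    m : (locallySpanned s).obj V).2

/-- The coordinates with respect to a basis of a sheaf of modules. -/
lemma exists_coordinate [DecidableEq I] (i : I) : ∃ φ : M ⟶ SheafOfModules.unit R,
    ∀ V j, φ.val.app V ((s j).val V) = (if i = j then 1 else 0 : R.obj.obj V) := by
  -- A morphism out of a free sheaf is given by the images of its basis; the `i`-th coordinate takes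
  -- the values `δ_ij`.
  let t : I → (SheafOfModules.unit R).sections := fun j =>
    ⟨fun V => (if i = j then 1 else 0 : R.obj.obj V), fun {V W} f => by
      change (R.obj.map f).hom (if i = j then 1 else 0) = _
      split_ifs
      · exact map_one _
      · exact map_zero _⟩
  refine ⟨inv (M.freeHomEquiv.symm s) ≫ (SheafOfModules.unit R).freeHomEquiv.symm t,
    fun V j => ?_⟩
  have h₁ : s j = SheafOfModules.sectionsMap (M.freeHomEquiv.symm s)
      (SheafOfModules.freeSection j) :=
    (SheafOfModules.sectionsMap_freeHomEquiv_symm_freeSection s j).symm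
  have h₂ : SheafOfModules.sectionsMap
      (inv (M.freeHomEquiv.symm s) ≫ (SheafOfModules.unit R).freeHomEquiv.symm t) (s j) = t j := by
    rw [h₁, ← SheafOfModules.sectionsMap_comp, IsIso.hom_inv_id_assoc]
    exact SheafOfModules.sectionsMap_freeHomEquiv_symm_freeSection t j
  exact congrArg (fun σ => σ.val V) h₂

end LocallySpanned

/-! ### Freeness of the stalks of a locally free Lie algebroid -/

section StalkBasis

open CategoryTheory TopologicalSpace Opposite AlgebraicGeometry

namespace LieAlgebroid

variable {K : Type u} [Field K] {X : RingedSpace.{u, u}} [StructureAlgebra K X]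
  (L : LieAlgebroid K X)

/-- A linear form on the restriction of a Lie algebroid to an open set, on sections over the
intersection with a neighbourhood of a point. -/
noncomputable def overForm {U : Opens X} (φ : L.module.over U ⟶ SheafOfModules.unit _)
    {V : Opens X} (h : V ≤ U) : L.Sec (op V) →ₗ[X.presheaf.obj (op V)] X.presheaf.obj (op V) :=
  (φ.val.app (op (Over.mk (homOfLE h)))).hom

lemma overForm_res {U : Opens X} (φ : L.module.over U ⟶ SheafOfModules.unit _)
    {V W : Opens X} (h : V ≤ U) (hW : W ≤ V) (D : L.Sec (op V)) :
    L.overForm φ (hW.trans h) (L.res (homOfLE hW).op D)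
      = resO K (homOfLE hW).op (L.overForm φ h D) := by
  let i : Over.mk (homOfLE (hW.trans h)) ⟶ Over.mk (homOfLE h) := Over.homMk (homOfLE hW)
  exact PresheafOfModules.naturality_apply φ.val i.op D

variable {x : X}

/-- The linear form on the stalk induced by a linear form near the point. -/
lemma exists_stalk_form {U : Opens X} (hx : x ∈ U)
    (φ : L.module.over U ⟶ SheafOfModules.unit _) :
    ∃ f : Module.Dual (StalkO K x) (L.Stalk x), ∀ (p : Nbhd x) (h : (OrderDual.ofDual p).1 ≤ U)
      (D : L.Sec p.op), f (L.germ p D) = germO K p (L.overForm φ h D) := by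
  -- The form is only available on open sets inside `U`, so every neighbourhood is first shrunk into
  -- `U`; `hres` makes the result independent of the shrinking.
  have key : ∀ p : Nbhd x, ∃ q : Nbhd x, p ≤ q ∧ (OrderDual.ofDual q).1 ≤ U := fun p =>
    ⟨Nbhd.mk ((OrderDual.ofDual p).1 ⊓ U) ⟨(OrderDual.ofDual p).2, hx⟩,
      show (_ : Opens X) ≤ _ from inf_le_left, inf_le_right⟩
  choose q hpq hq using key
  have hres : ∀ (p r : Nbhd x) (h : p ≤ r) (hp : (OrderDual.ofDual p).1 ≤ U) (D : L.Sec p.op),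
      germO K p (L.overForm φ hp D)
        = germO K r (L.overForm φ (le_trans h hp) (L.res (Nbhd.hom h) D)) := fun p r h hp D =>
    ((congrArg (germO K r) (L.overForm_res φ hp h D)).trans (germO_res h _)).symm
  let F : L.Stalk x → StalkO K x := DirectLimit.lift (L.trans x · · ·)
    (fun p D => germO K (q p) (L.overForm φ (hq p) (L.res (Nbhd.hom (hpq p)) D)))
    (fun p r h D => by
      obtain ⟨t, h₁, h₂⟩ := exists_ge_ge (q p) (q r)
      refine (hres _ t h₁ _ _).trans (Eq.trans ?_ (hres _ t h₂ _ _).symm)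
      congr 2
      refine (L.res_comp _ _ D).symm.trans (Eq.trans ?_ (L.res_comp _ _ _))
      exact L.res_comp (Nbhd.hom h) (Nbhd.hom ((hpq r).trans h₂)) D)
  have hF : ∀ (p : Nbhd x) (h : (OrderDual.ofDual p).1 ≤ U) (D : L.Sec p.op),
      F (L.germ p D) = germO K p (L.overForm φ h D) := fun p h D => (hres p _ (hpq p) h D).symm
  -- Identities on the stalk may be tested over neighbourhoods contained in `U`, where `F` is given
  -- directly by the form.
  have hU : ∀ (P : StalkO K x → L.Stalk x → L.Stalk x → Prop),
      (∀ (p : Nbhd x), (OrderDual.ofDual p).1 ≤ U → ∀ f D E,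
        P (germO K p f) (L.germ p D) (L.germ p E)) → ∀ a c d, P a c d := fun P hP a c d =>
    L.stalk_induction (P := fun a _ c d _ => P a c d) (fun p f _ D E _ => by
      rw [← germO_res (hpq p), ← L.germ_res (hpq p), ← L.germ_res (hpq p)]
      exact hP _ (hq p) _ _ _) a 0 c d 0
  refine ⟨{ toFun := F, map_add' := fun c d => ?_, map_smul' := fun a c => ?_ }, hF⟩
  · refine hU (fun _ c d => F (c + d) = F c + F d) (fun p h f D E => ?_) 0 c d
    rw [← map_add, hF p h, hF p h, hF p h]
    exact (congrArg (germO K p) (map_add (L.overForm φ h) D E)).trans (map_add _ _ _)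
  · refine hU (fun a c _ => F (a • c) = a • F c) (fun p h f D E => ?_) a c 0
    rw [← germ_smul, hF p h, hF p h]
    exact (congrArg (germO K p) ((L.overForm φ h).map_smul (f : X.presheaf.obj (op (OrderDual.ofDual p).1)) D)).trans (map_mul _ _ _)

/-- The section over an open set given by a global section of the restriction to this set. -/
def ofOver {U : Opens X} (s : (L.module.over U).sections) : L.Sec (op U) :=
  s.val (op (Over.mk (𝟙 U)))

lemma res_ofOver {U V : Opens X} (s : (L.module.over U).sections) (h : V ≤ U) :
    L.res (homOfLE h).op (L.ofOver s) = s.val (op (Over.mk (homOfLE h))) :=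
  s.property (Over.homMk (homOfLE h) : Over.mk (homOfLE h) ⟶ Over.mk (𝟙 U)).op

section

variable {U : Opens X} (hx : x ∈ U) {I : Type u} (s : I → (L.module.over U).sections)

/-- The coordinate forms pass to the stalk and are dual to the germs of the basis. -/
lemma linearIndependent_germ [IsIso ((L.module.over U).freeHomEquiv.symm s)] :
    LinearIndependent (StalkO K x) fun i => L.germ (Nbhd.mk U hx) (L.ofOver (s i)) := by
  classical
  choose φ hφ using fun i => exists_coordinate s i
  choose f hf using fun i => L.exists_stalk_form hx (φ i)
  have key : ∀ i j, f i (L.germ (Nbhd.mk U hx) (L.ofOver (s j))) = if i = j then 1 else 0 := by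
    intro i j
    refine (hf i (Nbhd.mk U hx) (le_refl U) (L.ofOver (s j))).trans ?_
    refine (congrArg (germO K (Nbhd.mk U hx)) (hφ i (op (Over.mk (𝟙 U))) j)).trans ?_
    split_ifs
    · exact map_one _
    · exact map_zero _
  refine LinearIndependent.of_pairwise_dual_eq_zero_one _ f (fun i j hij => ?_) fun i => ?_
  · exact (key i j).trans (if_neg hij)
  · exact (key i i).trans (if_pos rfl)

lemma germ_mem_span {V : Opens X} (hV : V ≤ U) (hxV : x ∈ V) {m : L.Sec (op V)}
    (hm : m ∈ sectionsSpan s (op (Over.mk (homOfLE hV)))) :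
    L.germ (Nbhd.mk V hxV) m ∈ Submodule.span (StalkO K x)
      (Set.range fun i => L.germ (Nbhd.mk U hx) (L.ofOver (s i))) := by
  have hle : Nbhd.mk U hx ≤ Nbhd.mk V hxV := hV
  induction hm using Submodule.span_induction with
  | mem m hm =>
    obtain ⟨i, rfl⟩ := hm
    refine Submodule.subset_span ⟨i, ?_⟩
    exact (L.germ_res hle _).symm.trans
      (congrArg (L.germ (Nbhd.mk V hxV)) (L.res_ofOver (s i) hV))
  | zero => exact (map_zero (L.germ (Nbhd.mk V hxV))).symm ▸ zero_mem _
  | add m n _ _ hm hn =>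
    exact (map_add (L.germ (Nbhd.mk V hxV)) m n).symm ▸ add_mem hm hn
  | smul f m _ hm =>
    exact (L.germ_smul (Nbhd.mk V hxV) f m).symm ▸ Submodule.smul_mem _ _ hm

/-- A representative of the germ becomes a finite combination of the basis near `x`, by
`spanSieve_mem`. The shrinking is harmless at a point, which is why freeness is obtained for stalks.
-/
lemma span_germ_eq_top [IsIso ((L.module.over U).freeHomEquiv.symm s)] :
    ⊤ ≤ Submodule.span (StalkO K x)
      (Set.range fun i => L.germ (Nbhd.mk U hx) (L.ofOver (s i))) := by
  rintro c -
  obtain ⟨p', D, rfl⟩ := L.exists_germ c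
  obtain ⟨r, h₁, h₂⟩ := exists_ge_ge (Nbhd.mk U hx) p'
  have hrU : (OrderDual.ofDual r).1 ≤ U := h₁
  rw [← L.germ_res h₂]
  generalize L.res (Nbhd.hom h₂) D = E
  have hcov := spanSieve_mem s (V := op (Over.mk (homOfLE hrU))) E
  rw [GrothendieckTopology.mem_over_iff] at hcov
  obtain ⟨W, w, hw, hxW⟩ := hcov x (OrderDual.ofDual r).2
  rw [Sieve.overEquiv_iff] at hw
  have hle : r ≤ Nbhd.mk W hxW := w.le
  rw [← L.germ_res hle]
  exact L.germ_mem_span hx s (w.le.trans hrU) hxW hw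

end

/-- The stalks of a locally free Lie algebroid are free. -/
lemma exists_stalk_basis (hL : L.module.IsLocallyFree) (x : X) :
    ∃ I : Type u, Nonempty (Module.Basis I (StalkO K x) (L.Stalk x)) := by
  obtain ⟨q, hq⟩ := hL.exists_isLocallyFreeData
  -- The trivializing cover, tested on the whole space at `x`, gives a member `q.X k` containing
  -- `x`.
  obtain ⟨V, i, ⟨k, ⟨j⟩⟩, hxV⟩ := q.coversTop ⊤ x trivial
  have hiso : IsIso ((L.module.over (q.X k)).freeHomEquiv.symm (q.generators k).s) := hq.isIso k
  exact ⟨_, ⟨Module.Basis.mk (L.linearIndependent_germ (j.le hxV) (q.generators k).s)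
    (L.span_germ_eq_top (j.le hxV) (q.generators k).s)⟩⟩

end LieAlgebroid

end StalkBasis

/-! ### Local injectivity and surjectivity in terms of points -/

section LocalMaps

open CategoryTheory TopologicalSpace Opposite AlgebraicGeometry

variable {X : RingedSpace.{u, u}} {P Q : (Opens X)ᵒᵖ ⥤ RingCat.{u}} (η : P ⟶ Q)

lemma isLocallyInjective_of_exists_res_eq_zero
    (h : ∀ (V : (Opens X)ᵒᵖ) (s : P.obj V), (η.app V).hom s = 0 → ∀ x ∈ V.unop,
      ∃ (W : Opens X) (i : W ⟶ V.unop), x ∈ W ∧ (P.map i.op).hom s = 0) :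
    Presheaf.IsLocallyInjective (Opens.grothendieckTopology X) η where
  equalizerSieve_mem {V} s t hst x hx := by
    have h0 : (η.app V).hom (s - t) = 0 := by
      rw [map_sub, sub_eq_zero]; exact hst
    obtain ⟨W, i, hW, e⟩ := h V (s - t) h0 x hx
    rw [map_sub, sub_eq_zero] at e
    exact ⟨W, i, e, hW⟩

lemma exists_res_eq_zero [Presheaf.IsLocallyInjective (Opens.grothendieckTopology X) η]
    {V : (Opens X)ᵒᵖ} {s : P.obj V} (hs : (η.app V).hom s = 0) (x : X) (hx : x ∈ V.unop) :
    ∃ (W : Opens X) (i : W ⟶ V.unop), x ∈ W ∧ (P.map i.op).hom s = 0 := by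
  obtain ⟨W, i, e, hW⟩ := Presheaf.equalizerSieve_mem (Opens.grothendieckTopology X) η s 0
    (hs.trans (map_zero (η.app V).hom).symm) x hx
  exact ⟨W, i, hW, e.trans (map_zero (P.map i.op).hom)⟩

lemma isLocallySurjective_of_exists
    (h : ∀ (V : (Opens X)ᵒᵖ) (s : Q.obj V), ∀ x ∈ V.unop, ∃ (W : Opens X) (i : W ⟶ V.unop),
      x ∈ W ∧ ∃ t, (η.app (op W)).hom t = (Q.map i.op).hom s) :
    Presheaf.IsLocallySurjective (Opens.grothendieckTopology X) η where
  imageSieve_mem {V} s x hx := by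
    obtain ⟨W, i, hW, t, e⟩ := h (op V) s x hx
    exact ⟨W, i, ⟨t, e⟩, hW⟩

end LocalMaps

/-! ### Kernels of maps of associated graded rings -/

section GrMap

variable {A B C : Type u} [Ring A] [Ring B] [Ring C] {F : RingFiltration A} {G : RingFiltration B}
  {H : RingFiltration C}

namespace RingFiltration

lemma grMap_apply (f : A →+* B) (hf : ∀ n a, a ∈ F.step n → f a ∈ G.step n) (x : F.Gr) (n : ℕ) :
    grMap f hf x n = pieceMap f hf n (x n) := by
  induction x using F.gr_induction with
  | h₀ => rw [map_zero, DirectSum.zero_apply, DirectSum.zero_apply, map_zero]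
  | hadd a b ha hb => rw [map_add, DirectSum.add_apply, DirectSum.add_apply, ha, hb, map_add]
  | h m a =>
    rw [grMap_symbol]
    change DirectSum.of G.Piece m (pieceMap f hf m (F.toPiece m a)) n
      = pieceMap f hf n (DirectSum.of F.Piece m (F.toPiece m a) n)
    by_cases h : m = n
    · subst h
      rw [DirectSum.of_eq_same, DirectSum.of_eq_same]
    · rw [DirectSum.of_eq_of_ne _ _ _ (Ne.symm h), DirectSum.of_eq_of_ne _ _ _ (Ne.symm h), map_zero]

/-- The kernel of a graded map is graded. An element has finitely many components, so local
statements about each one will combine. -/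
lemma exists_sum_of_grMap_eq_zero (f : A →+* B) (hf : ∀ n a, a ∈ F.step n → f a ∈ G.step n)
    {x : F.Gr} (hx : grMap f hf x = 0) : ∃ (S : Finset ℕ) (a : ∀ n, F.step n),
      x = ∑ n ∈ S, F.symbol n (a n) ∧ ∀ n, f (a n) ∈ G.prev n := by
  classical
  choose a ha using fun n => F.toPiece_surjective n (x n)
  refine ⟨DFinsupp.support x, a, ?_, fun n => ?_⟩
  · conv_lhs => rw [← DirectSum.sum_support_of x]
    exact Finset.sum_congr rfl fun n _ => congrArg _ (ha n).symm
  · have h : pieceMap f hf n (x n) = 0 := by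
      rw [← grMap_apply, hx, DirectSum.zero_apply]
    rw [← ha n] at h
    have h' : G.toPiece n ⟨f (a n), hf n _ (a n).2⟩ = G.toPiece n 0 := h.trans (map_zero _).symm
    rw [toPiece_eq_iff] at h'
    simpa using h'

end RingFiltration

end GrMap

/-! ### Local bijectivity of the presheaf morphism -/

section Sheaves

open CategoryTheory TopologicalSpace Opposite AlgebraicGeometry

namespace LieAlgebroid

variable {K : Type u} [Field K] {X : RingedSpace.{u, u}} [StructureAlgebra K X]
  (L : LieAlgebroid K X) (ω : L.Cocycle)

instance : Presheaf.IsLocallySurjective (Opens.grothendieckTopology X) L.toSymSheaf :=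
  inferInstanceAs (Presheaf.IsLocallySurjective _ (toSheafify _ _))

instance : Presheaf.IsLocallyInjective (Opens.grothendieckTopology X) (L.toTwistedSheaf ω) :=
  inferInstanceAs (Presheaf.IsLocallyInjective _ (toSheafify _ _))

instance : Presheaf.IsLocallyInjective (Opens.grothendieckTopology X) (L.toGrSheaf ω) :=
  inferInstanceAs (Presheaf.IsLocallyInjective _ (toSheafify _ _))

instance : Presheaf.IsLocallySurjective (Opens.grothendieckTopology X) (L.toGrSheaf ω) :=
  inferInstanceAs (Presheaf.IsLocallySurjective _ (toSheafify _ _))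

open TwistedEnveloping (Graded ringFiltration symToGraded gradedMap filtration)

/-- The map on associated graded rings induced by the sheafification map. -/
noncomputable def gradedToGr (V : (Opens X)ᵒᵖ) :
    Graded K (ω.val V) →+* (L.twistedFiltration ω V).Gr :=
  RingFiltration.grMap (F := ringFiltration K (ω.val V)) ((L.toTwistedSheaf ω).app V).hom
    fun _ _ ha => app_mem_localImage (L.toTwistedSheaf ω) _ ha

lemma gradedToGr_symbol (V : (Opens X)ᵒᵖ) (n : ℕ) (a : filtration K (ω.val V) n) :
    L.gradedToGr ω V (TwistedEnveloping.symbol K (ω.val V) n a)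
      = (L.twistedFiltration ω V).symbol n ⟨((L.toTwistedSheaf ω).app V).hom a.1,
        app_mem_localImage (L.toTwistedSheaf ω) _ a.2⟩ :=
  RingFiltration.grMap_symbol (F := ringFiltration K (ω.val V)) _ _ n a

/-- The restriction maps of the associated graded rings of twisted enveloping algebras. -/
noncomputable def gradedRes {V W : (Opens X)ᵒᵖ} (i : V ⟶ W) :
    Graded K (ω.val V) →+* Graded K (ω.val W) :=
  gradedMap (resO K i) (L.res i) (ω.res_val i)

lemma gradedRes_symbol {V W : (Opens X)ᵒᵖ} (i : V ⟶ W) (n : ℕ) (a : filtration K (ω.val V) n) :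
    L.gradedRes ω i (TwistedEnveloping.symbol K (ω.val V) n a)
      = TwistedEnveloping.symbol K (ω.val W) n
        ⟨L.twistedRes ω i a.1, L.twistedPresheaf_filtration_res ω n i a.1 a.2⟩ :=
  TwistedEnveloping.gradedMap_symbol _ _ _ n a

lemma gradedRes_comp {U V W : (Opens X)ᵒᵖ} (i : U ⟶ V) (j : V ⟶ W) (a : Graded K (ω.val U)) :
    L.gradedRes ω (i ≫ j) a = L.gradedRes ω j (L.gradedRes ω i a) := by
  induction a using TwistedEnveloping.graded_induction with
  | h₀ => simp only [map_zero]
  | hadd a b ha hb => simp only [map_add, ha, hb]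
  | h n a =>
    rw [gradedRes_symbol, gradedRes_symbol, gradedRes_symbol]
    exact congrArg _ (Subtype.ext
      (congrArg (fun φ => φ.hom a.1) ((L.twistedPresheaf ω).map_comp i j)))

lemma gradedRes_symToGraded {V W : (Opens X)ᵒᵖ} (i : V ⟶ W)
    (s : SymmetricAlgebra (X.presheaf.obj V) (L.Sec V)) :
    L.gradedRes ω i (symToGraded K (ω.val V) s) = symToGraded K (ω.val W) (L.symRes i s) :=
  TwistedEnveloping.gradedMap_symToGraded _ _ _ (L.symRes i) (L.symRes_algebraMap i)
    (L.symRes_ι i) s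

/-- Near `x` the image of `a` is also the image of some `t` in the lower step. Sheafification is
locally injective, so `a` and `t` agree after a further restriction, and the symbol of `a` vanishes
there. For `n = 0` the lower step is zero and `a` itself vanishes locally. -/
lemma exists_gradedRes_eq_zero_of_prev {V : (Opens X)ᵒᵖ} {n : ℕ} (a : filtration K (ω.val V) n)
    (ha : ((L.toTwistedSheaf ω).app V).hom a.1 ∈ (L.twistedFiltration ω V).prev n)
    (x : X) (hx : x ∈ V.unop) : ∃ (W : Opens X) (i : W ⟶ V.unop), x ∈ W ∧
      L.gradedRes ω i.op (TwistedEnveloping.symbol K (ω.val V) n a) = 0 := by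
  suffices h : ∃ (W : Opens X) (i : W ⟶ V.unop), x ∈ W ∧
      L.twistedRes ω i.op a.1 ∈ (ringFiltration K (ω.val (op W))).prev n by
    obtain ⟨W, i, hW, h⟩ := h
    refine ⟨W, i, hW, ?_⟩
    rw [gradedRes_symbol]
    exact ((ringFiltration K (ω.val (op W))).symbol_eq_zero_iff _).mpr h
  cases n with
  | zero =>
    obtain ⟨W, i, hW, h⟩ := exists_res_eq_zero (L.toTwistedSheaf ω)
      (show ((L.toTwistedSheaf ω).app V).hom a.1 = 0 from ha) x hx
    exact ⟨W, i, hW, h⟩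
  | succ n =>
    obtain ⟨W, i, hW, t, ht, h⟩ := ha x hx
    have h0 : ((L.toTwistedSheaf ω).app (op W)).hom
        (t - ((L.twistedPresheaf ω).map i.op).hom a.1) = 0 := by
      rw [map_sub, h, sub_eq_zero]
      exact (NatTrans.naturality_apply (L.toTwistedSheaf ω) i.op a.1).symm
    obtain ⟨W', i', hW', h'⟩ := exists_res_eq_zero (L.toTwistedSheaf ω) h0 x hW
    refine ⟨W', i' ≫ i, hW', ?_⟩
    rw [map_sub, sub_eq_zero] at h'
    have e : L.twistedRes ω (i' ≫ i).op a.1 = ((L.twistedPresheaf ω).map i'.op).hom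
        (((L.twistedPresheaf ω).map i.op).hom a.1) :=
      congrArg (fun φ => φ.hom a.1) ((L.twistedPresheaf ω).map_comp i.op i'.op)
    rw [e, ← h']
    exact L.twistedPresheaf_filtration_res ω n i'.op t ht

/-- The map on associated graded rings induced by the sheafification map is locally injective. -/
lemma exists_gradedRes_eq_zero {V : (Opens X)ᵒᵖ} {a : Graded K (ω.val V)}
    (ha : L.gradedToGr ω V a = 0) (x : X) (hx : x ∈ V.unop) :
    ∃ (W : Opens X) (i : W ⟶ V.unop), x ∈ W ∧ L.gradedRes ω i.op a = 0 := by
  obtain ⟨S, b, rfl, hb⟩ := RingFiltration.exists_sum_of_grMap_eq_zero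
    (F := ringFiltration K (ω.val V)) _ _ ha
  clear ha
  -- The finitely many homogeneous components are killed one by one, intersecting the
  -- neighbourhoods.
  induction S using Finset.induction_on with
  | empty => exact ⟨V.unop, 𝟙 _, hx, by rw [Finset.sum_empty, map_zero]⟩
  | insert n S hn ih =>
    obtain ⟨W, i, hW, h⟩ := ih
    obtain ⟨W', i', hW', h'⟩ := L.exists_gradedRes_eq_zero_of_prev ω (b n) (hb n) x hx
    refine ⟨W ⊓ W', homOfLE inf_le_left ≫ i, ⟨hW, hW'⟩, ?_⟩
    have e : (homOfLE inf_le_left ≫ i : W ⊓ W' ⟶ V.unop) = homOfLE inf_le_right ≫ i' :=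
      Subsingleton.elim _ _
    rw [Finset.sum_insert hn, map_add]
    have h₁ : L.gradedRes ω (homOfLE inf_le_left ≫ i : W ⊓ W' ⟶ V.unop).op
        ((ringFiltration K (ω.val V)).symbol n (b n)) = 0 := by
      rw [e, op_comp, gradedRes_comp]
      exact (congrArg _ h').trans (map_zero _)
    rw [h₁, zero_add, op_comp, gradedRes_comp, h, map_zero]

lemma gradedToGr_gradedRes {V W : (Opens X)ᵒᵖ} (i : V ⟶ W) (a : Graded K (ω.val V)) :
    L.gradedToGr ω W (L.gradedRes ω i a)
      = ((L.grPresheaf ω).map i).hom (L.gradedToGr ω V a) := by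
  induction a using TwistedEnveloping.graded_induction with
  | h₀ =>
    simp only [map_zero]
    exact (map_zero ((L.grPresheaf ω).map i).hom).symm
  | hadd a b ha hb =>
    simp only [map_add, ha, hb]
    exact (map_add ((L.grPresheaf ω).map i).hom _ _).symm
  | h n a =>
    rw [gradedRes_symbol, gradedToGr_symbol, gradedToGr_symbol]
    refine Eq.trans ?_ (RingFiltration.grMap_symbol _ (L.twistedFiltration_res ω i) n _).symm
    exact congrArg _ (Subtype.ext (NatTrans.naturality_apply (L.toTwistedSheaf ω) i a.1))

/-- The canonical morphism from symmetric algebras to associated graded rings, on presheaves. -/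
noncomputable def symToGr : L.symPresheaf ⟶ L.grPresheaf ω where
  app V := RingCat.ofHom ((L.gradedToGr ω V).comp (symToGraded K (ω.val V)).toRingHom)
  naturality _ W i := RingCat.hom_ext (RingHom.ext fun s =>
    (congrArg (L.gradedToGr ω W) (L.gradedRes_symToGraded ω i s).symm).trans
      (L.gradedToGr_gradedRes ω i _))

lemma symToGr_app (V : (Opens X)ᵒᵖ) (s : SymmetricAlgebra (X.presheaf.obj V) (L.Sec V)) :
    ((L.symToGr ω).app V).hom s = L.gradedToGr ω V (symToGraded K (ω.val V) s) := rfl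

lemma symToGr_algebraMap (V : (Opens X)ᵒᵖ) (f : X.presheaf.obj V) :
    ((L.symToGr ω).app V).hom (algebraMap _ (SymmetricAlgebra (X.presheaf.obj V) (L.Sec V)) f)
      = (L.twistedFiltration ω V).symbol 0
        ⟨L.twistedScalar ω V f, L.twistedScalar_mem ω V f 0⟩ := by
  rw [symToGr_app, TwistedEnveloping.symToGraded_algebraMap, gradedToGr_symbol]
  rfl

lemma symToGr_ι (V : (Opens X)ᵒᵖ) (D : L.Sec V) :
    ((L.symToGr ω).app V).hom (SymmetricAlgebra.ι (X.presheaf.obj V) (L.Sec V) D)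
      = (L.twistedFiltration ω V).symbol 1
        ⟨L.twistedVector ω V D, L.twistedVector_mem ω V D⟩ := by
  rw [symToGr_app, TwistedEnveloping.symToGraded_ι, gradedToGr_symbol]
  rfl

lemma symToGr_mem_degree {n : ℕ} {V : (Opens X)ᵒᵖ} {s : L.symPresheaf.obj V}
    (hs : s ∈ L.symPower n V) :
    ((L.symToGr ω).app V).hom s ∈ (L.twistedFiltration ω V).degree n := by
  obtain ⟨a, ha⟩ := TwistedEnveloping.symToGraded_mem_degree (K := K) (ω := ω.val V) hs
  exact ⟨_, ((congrArg (L.gradedToGr ω V) ha.symm).trans (L.gradedToGr_symbol ω V n a)).symm⟩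

/-- A section of the `n`-th step comes locally from the `n`-th step of the presheaf, where
`exists_symToGraded_eq` provides a preimage of the symbol in the `n`-th symmetric power. -/
lemma exists_symToGr_eq {n : ℕ} {V : (Opens X)ᵒᵖ} {y : (L.grPresheaf ω).obj V}
    (hy : y ∈ (L.twistedFiltration ω V).degree n) (x : X) (hx : x ∈ V.unop) :
    ∃ (W : Opens X) (i : W ⟶ V.unop), x ∈ W ∧ ∃ s ∈ L.symPower n (op W),
      ((L.symToGr ω).app (op W)).hom s = ((L.grPresheaf ω).map i.op).hom y := by
  obtain ⟨⟨a, ha⟩, rfl⟩ := hy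
  obtain ⟨W, i, hW, t, ht, h⟩ := ha x hx
  obtain ⟨s, hs, e⟩ := TwistedEnveloping.exists_symToGraded_eq (K := K) (ω := ω.val (op W)) ⟨t, ht⟩
  refine ⟨W, i, hW, s, hs, ?_⟩
  rw [symToGr_app, e, gradedToGr_symbol]
  refine Eq.trans ?_ (RingFiltration.grMap_symbol _ (L.twistedFiltration_res ω i.op) n _).symm
  exact congrArg _ (Subtype.ext h)

instance : Presheaf.IsLocallySurjective (Opens.grothendieckTopology X) (L.symToGr ω) := by
  refine isLocallySurjective_of_exists _ fun V y x hx => ?_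
  induction y using (L.twistedFiltration ω V).gr_induction with
  | h₀ => exact ⟨V.unop, 𝟙 _, hx, 0,
    (map_zero ((L.symToGr ω).app _).hom).trans (map_zero ((L.grPresheaf ω).map _).hom).symm⟩
  | h n a =>
    obtain ⟨W, i, hW, s, -, h⟩ := L.exists_symToGr_eq ω (y := (L.twistedFiltration ω V).symbol n a)
      ⟨a, rfl⟩ x hx
    exact ⟨W, i, hW, s, h⟩
  | hadd a b ha hb =>
    obtain ⟨W, i, hW, s, h⟩ := ha
    obtain ⟨W', i', hW', s', h'⟩ := hb
    refine ⟨W ⊓ W', homOfLE inf_le_left ≫ i, ⟨hW, hW'⟩,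
      (L.symPresheaf.map (homOfLE inf_le_left).op).hom s
        + (L.symPresheaf.map (homOfLE inf_le_right).op).hom s', ?_⟩
    have e : (homOfLE inf_le_left ≫ i : W ⊓ W' ⟶ V.unop) = homOfLE inf_le_right ≫ i' :=
      Subsingleton.elim _ _
    rw [map_add, NatTrans.naturality_apply (L.symToGr ω), NatTrans.naturality_apply (L.symToGr ω),
      h, h']
    refine Eq.trans ?_ (map_add ((L.grPresheaf ω).map _).hom a b).symm
    congr 1
    · rw [op_comp, (L.grPresheaf ω).map_comp]; rfl
    · rw [e, op_comp, (L.grPresheaf ω).map_comp]; rfl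

/-- This is where the free case is used. After shrinking, `s` has zero image in the graded algebra
of the presheaf; by functoriality so does its image at the stalk, where `symToGraded` is injective.
-/
lemma isLocallyInjective_symToGr (hL : L.module.IsLocallyFree) :
    Presheaf.IsLocallyInjective (Opens.grothendieckTopology X) (L.symToGr ω) := by
  refine isLocallyInjective_of_exists_res_eq_zero _ fun V s hs x hx => ?_
  obtain ⟨W, i, hW, h⟩ := L.exists_gradedRes_eq_zero ω hs x hx
  have h' : symToGraded K (ω.val (op W)) (L.symRes i.op s) = 0 :=
    (L.gradedRes_symToGraded ω i.op s).symm.trans h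
  let p : Nbhd x := Nbhd.mk W hW
  obtain ⟨I, ⟨b⟩⟩ := L.exists_stalk_basis hL x
  have h'' : symToGraded K (L.stalkCocycle x ω) (L.symToStalk p (L.symRes i.op s)) = 0 := by
    refine (TwistedEnveloping.gradedMap_symToGraded (ω := ω.val p.op) (ω' := L.stalkCocycle x ω)
      (germOAlg p) (L.germHom p) (fun D E => L.germO_form ω p D E) (L.symToStalk p)
      (L.symToStalk_algebraMap p) (L.symToStalk_ι p) _).symm.trans ?_
    exact (congrArg _ h').trans (map_zero _)
  -- Vanishing in the symmetric algebra of the stalk spreads to a neighbourhood.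
  obtain ⟨q, hq, e⟩ := L.exists_symRes_eq_zero
    (TwistedEnveloping.symToGraded_injective b (h''.trans (map_zero _).symm))
  have hle : (OrderDual.ofDual q).1 ≤ W := hq
  refine ⟨(OrderDual.ofDual q).1, homOfLE hle ≫ i, (OrderDual.ofDual q).2, ?_⟩
  rw [op_comp, L.symPresheaf.map_comp]
  exact e

end LieAlgebroid

end Sheaves

/-! ### Symmetrization, passage to sheaves and uniqueness -/

section Isomorphism

open CategoryTheory TopologicalSpace Opposite AlgebraicGeometry

namespace LieAlgebroid

variable {K : Type u} [Field K] {X : RingedSpace.{u, u}} [StructureAlgebra K X]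
  (L : LieAlgebroid K X) (ω : L.Cocycle)

open SymmetricAlgebra (ι)

lemma symToGr_prod (V : (Opens X)ᵒᵖ) (l : List (L.Sec V)) {k : ℕ} (hk : l.length = k)
    (h : (l.map (L.twistedVector ω V)).prod ∈ (L.twistedFiltration ω V).step k) :
    ((L.symToGr ω).app V).hom (l.map (ι (X.presheaf.obj V) (L.Sec V))).prod
      = (L.twistedFiltration ω V).symbol k ⟨(l.map (L.twistedVector ω V)).prod, h⟩ := by
  have key : ∀ l : List (L.Sec V), ∃ h : (l.map (L.twistedVector ω V)).prod
      ∈ (L.twistedFiltration ω V).step l.length,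
      ((L.symToGr ω).app V).hom (l.map (ι (X.presheaf.obj V) (L.Sec V))).prod
        = (L.twistedFiltration ω V).symbol l.length ⟨(l.map (L.twistedVector ω V)).prod, h⟩ := by
    intro l
    induction l with
    | nil => exact ⟨(L.twistedFiltration ω V).one_mem,
        (map_one ((L.symToGr ω).app V).hom).trans (L.twistedFiltration ω V).symbol_one.symm⟩
    | cons D l ih =>
      obtain ⟨h, e⟩ := ih
      have hD := L.twistedVector_mem ω V D
      have h' := (L.twistedFiltration ω V).mul_mem hD h
      refine ⟨by rw [List.map_cons, List.prod_cons, List.length_cons, add_comm]; exact h', ?_⟩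
      have e₁ : ((L.symToGr ω).app V).hom (((D :: l).map (ι (X.presheaf.obj V) (L.Sec V))).prod)
          = ((L.symToGr ω).app V).hom (ι (X.presheaf.obj V) (L.Sec V) D)
            * ((L.symToGr ω).app V).hom ((l.map (ι (X.presheaf.obj V) (L.Sec V))).prod) := by
        rw [List.map_cons, List.prod_cons]
        exact map_mul ((L.symToGr ω).app V).hom _ _
      rw [e₁, e, symToGr_ι]
      refine ((L.twistedFiltration ω V).symbol_mul _ _).trans ?_
      refine RingFiltration.symbol_congr _ (add_comm _ _) _ _ ?_
      exact List.prod_cons.symm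
  obtain ⟨_, e⟩ := key l
  subst hk
  exact e

/-- The symmetric algebra is commutative, so the `k!` reordered products all have the same symbol,
and averaging them gives it back. -/
lemma symToGr_symmetrized [CharZero K] (V : (Opens X)ᵒᵖ) {k : ℕ} (D : Fin k → L.Sec V) :
    ((L.symToGr ω).app V).hom (List.ofFn fun j => ι (X.presheaf.obj V) (L.Sec V) (D j)).prod
      = (L.twistedFiltration ω V).symbol k (L.symmetrized ω V D) := by
  have hprod : ∀ E : Fin k → L.Sec V,
      ((L.symToGr ω).app V).hom (List.ofFn fun j => ι (X.presheaf.obj V) (L.Sec V) (E j)).prod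
        = (L.twistedFiltration ω V).symbol k ⟨_, L.prod_twistedVector_mem ω V E⟩ := fun E => by
    have h := L.prod_twistedVector_mem ω V E
    have e := L.symToGr_prod ω V (List.ofFn E) (List.length_ofFn)
      (by rw [List.map_ofFn]; exact h)
    simp only [List.map_ofFn] at e
    exact e
  have hperm : ∀ σ : Equiv.Perm (Fin k),
      (List.ofFn fun j => ι (X.presheaf.obj V) (L.Sec V) (D (σ j))).prod
        = (List.ofFn fun j => ι (X.presheaf.obj V) (L.Sec V) (D j)).prod := fun σ => by
    rw [List.prod_ofFn, List.prod_ofFn]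
    exact Equiv.prod_comp σ fun j => ι (X.presheaf.obj V) (L.Sec V) (D j)
  set c := algebraMap K (X.presheaf.obj V) ((k.factorial : K)⁻¹) with hc
  have hsum : (∑ σ : Equiv.Perm (Fin k),
        (List.ofFn fun j => L.twistedVector ω V (D (σ j))).prod) ∈ (L.twistedFiltration ω V).step k :=
    sum_mem fun σ _ => L.prod_twistedVector_mem ω V fun j => D (σ j)
  have e₁ : (L.twistedFiltration ω V).symbol k (L.symmetrized ω V D)
      = (L.twistedFiltration ω V).symbol 0 ⟨_, L.twistedScalar_mem ω V c 0⟩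
        * (L.twistedFiltration ω V).symbol k ⟨_, hsum⟩ := by
    rw [RingFiltration.symbol_mul]
    exact RingFiltration.symbol_congr _ (zero_add k).symm _ _ rfl
  have e₂ : (L.twistedFiltration ω V).symbol k ⟨_, hsum⟩ = ∑ σ : Equiv.Perm (Fin k),
      (L.twistedFiltration ω V).symbol k ⟨_, L.prod_twistedVector_mem ω V fun j => D (σ j)⟩ := by
    rw [← map_sum]
    congr 1
    refine Subtype.ext (Eq.symm ?_)
    exact map_sum ((L.twistedFiltration ω V).step k).subtype _ _
  have e₃ : (c : X.presheaf.obj V) * (k.factorial : X.presheaf.obj V) = 1 := by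
    rw [hc, ← map_natCast (algebraMap K (X.presheaf.obj V)), ← map_mul,
      inv_mul_cancel₀ (Nat.cast_ne_zero.mpr k.factorial_ne_zero), map_one]
  -- The same map, with source and target displayed as the concrete rings, so that their algebraic
  -- structure is visible to rewriting.
  let φ : SymmetricAlgebra (X.presheaf.obj V) (L.Sec V) →+* (L.twistedFiltration ω V).Gr :=
    ((L.symToGr ω).app V).hom
  have hprod' : ∀ E : Fin k → L.Sec V,
      φ (List.ofFn fun j => ι (X.presheaf.obj V) (L.Sec V) (E j)).prod
        = (L.twistedFiltration ω V).symbol k ⟨_, L.prod_twistedVector_mem ω V E⟩ := hprod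
  change φ _ = _
  rw [e₁, e₂]
  simp only [← hprod', hperm]
  rw [Finset.sum_const, Finset.card_univ, Fintype.card_perm, Fintype.card_fin, ← map_nsmul]
  have e₄ : (L.twistedFiltration ω V).symbol 0 ⟨_, L.twistedScalar_mem ω V c 0⟩
      = φ (algebraMap _ _ c) := (L.symToGr_algebraMap ω V c).symm
  rw [e₄, ← map_mul, nsmul_eq_mul, ← mul_assoc, ← map_natCast (algebraMap (X.presheaf.obj V)
    (SymmetricAlgebra (X.presheaf.obj V) (L.Sec V))), ← map_mul, e₃, map_one, one_mul]

/-- The morphism from the sheaf of symmetric algebras to the associated graded sheaf. -/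
noncomputable def symSheafToGrSheaf : L.symSheaf ⟶ L.grSheaf ω :=
  ⟨sheafifyLift _ (L.symToGr ω ≫ L.toGrSheaf ω) (L.grSheaf ω).property⟩

lemma toSymSheaf_comp :
    L.toSymSheaf ≫ (L.symSheafToGrSheaf ω).hom = L.symToGr ω ≫ L.toGrSheaf ω :=
  toSheafify_sheafifyLift _ _ _

lemma symSheafToGrSheaf_app (V : (Opens X)ᵒᵖ) (s : L.symPresheaf.obj V) :
    ((L.symSheafToGrSheaf ω).hom.app V).hom ((L.toSymSheaf.app V).hom s)
      = ((L.toGrSheaf ω).app V).hom (((L.symToGr ω).app V).hom s) :=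
  congrArg (fun φ => (φ.app V).hom s) (L.toSymSheaf_comp ω)

/-- Sheafification maps are locally bijective, so local bijectivity passes from `symToGr` to the
induced morphism, and for sheaves this means being an isomorphism. -/
lemma isIso_symSheafToGrSheaf (hL : L.module.IsLocallyFree) : IsIso (L.symSheafToGrSheaf ω) := by
  have := L.isLocallyInjective_symToGr ω hL
  have h₁ : Sheaf.IsLocallyInjective (L.symSheafToGrSheaf ω) :=
    Presheaf.isLocallyInjective_of_isLocallyInjective_of_isLocallySurjective_fac _ _
      (L.toSymSheaf_comp ω)
  have h₂ : Sheaf.IsLocallySurjective (L.symSheafToGrSheaf ω) :=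
    Presheaf.isLocallySurjective_of_isLocallySurjective_fac _ (L.toSymSheaf_comp ω)
  exact (Sheaf.isLocallyBijective_iff_isIso _).mp ⟨h₁, h₂⟩

lemma symSheafToGrSheaf_mem_grDegree {n : ℕ} {V : (Opens X)ᵒᵖ} {s : L.symSheaf.obj.obj V}
    (hs : s ∈ L.symDegree n V) :
    ((L.symSheafToGrSheaf ω).hom.app V).hom s ∈ L.grDegree ω n V := by
  intro x hx
  obtain ⟨W, i, hW, t, ht, h⟩ := hs x hx
  refine ⟨W, i, hW, ((L.symToGr ω).app (op W)).hom t, L.symToGr_mem_degree ω ht, ?_⟩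
  refine (L.symSheafToGrSheaf_app ω (op W) t).symm.trans ?_
  exact (congrArg ((L.symSheafToGrSheaf ω).hom.app (op W)).hom h).trans
    (NatTrans.naturality_apply (L.symSheafToGrSheaf ω).hom i.op s)

/-- Locally the image of `s` has a preimage in the `n`-th symmetric power by `exists_symToGr_eq`;
injectivity on sections identifies it with `s`. -/
lemma mem_symDegree_of_mem_grDegree (hL : L.module.IsLocallyFree) {n : ℕ} {V : (Opens X)ᵒᵖ}
    {s : L.symSheaf.obj.obj V}
    (hs : ((L.symSheafToGrSheaf ω).hom.app V).hom s ∈ L.grDegree ω n V) :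
    s ∈ L.symDegree n V := by
  have := L.isIso_symSheafToGrSheaf ω hL
  have hinj : ∀ V, Function.Injective ((L.symSheafToGrSheaf ω).hom.app V).hom := fun V a b h => by
    have e : (L.symSheafToGrSheaf ω).hom ≫ (inv (L.symSheafToGrSheaf ω)).hom = 𝟙 _ :=
      congrArg (fun φ => φ.hom) (IsIso.hom_inv_id (L.symSheafToGrSheaf ω))
    have e' : ∀ a, ((inv (L.symSheafToGrSheaf ω)).hom.app V).hom
        (((L.symSheafToGrSheaf ω).hom.app V).hom a) = a := fun a =>
      congrArg (fun φ => (φ.app V).hom a) e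
    rw [← e' a, h, e']
  intro x hx
  obtain ⟨W, i, hW, t, ht, h⟩ := hs x hx
  obtain ⟨W', i', hW', u, hu, h'⟩ := L.exists_symToGr_eq ω (V := op W) ht x hW
  refine ⟨W', i' ≫ i, hW', u, hu, hinj _ ?_⟩
  refine (L.symSheafToGrSheaf_app ω (op W') u).trans ?_
  refine (congrArg ((L.toGrSheaf ω).app (op W')).hom h').trans ?_
  refine (NatTrans.naturality_apply (L.toGrSheaf ω) i'.op t).trans ?_
  refine (congrArg ((L.grSheaf ω).obj.map i'.op).hom h).trans ?_
  refine Eq.trans ?_ (NatTrans.naturality_apply (L.symSheafToGrSheaf ω).hom (i' ≫ i).op s).symm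
  exact (congrArg (fun φ => φ.hom (((L.symSheafToGrSheaf ω).hom.app V).hom s))
    ((L.grSheaf ω).obj.map_comp i.op i'.op)).symm

lemma symSheafToGrSheaf_scalar (V : (Opens X)ᵒᵖ) (f : X.presheaf.obj V) :
    ((L.symSheafToGrSheaf ω).hom.app V).hom (L.symScalar V f) = L.grScalar ω V f :=
  (L.symSheafToGrSheaf_app ω V _).trans
    (congrArg ((L.toGrSheaf ω).app V).hom (L.symToGr_algebraMap ω V f))

lemma symSheafToGrSheaf_prod [CharZero K] (V : (Opens X)ᵒᵖ) {k : ℕ} (D : Fin k → L.Sec V) :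
    ((L.symSheafToGrSheaf ω).hom.app V).hom (List.ofFn fun j => L.symVector V (D j)).prod
      = L.symbol ω k V (L.symmetrized ω V D) := by
  have e : (List.ofFn fun j => L.symVector V (D j)).prod = (L.toSymSheaf.app V).hom
      (List.ofFn fun j => ι (X.presheaf.obj V) (L.Sec V) (D j)).prod := by
    refine Eq.trans ?_ (map_list_prod (L.toSymSheaf.app V).hom _).symm
    have h : List.map (L.toSymSheaf.app V).hom
        (List.ofFn fun j => ι (X.presheaf.obj V) (L.Sec V) (D j)) = List.ofFn _ := List.map_ofFn
    exact congrArg List.prod h.symm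
  rw [e]
  exact (L.symSheafToGrSheaf_app ω V _).trans
    (congrArg ((L.toGrSheaf ω).app V).hom (L.symToGr_symmetrized ω V D))

/-- A morphism from a sheafification to a sheaf is determined on the presheaf, and symmetric
algebras are generated by functions and by `L`. -/
lemma symSheaf_hom_ext {φ ψ : L.symSheaf ⟶ L.grSheaf ω}
    (h : ∀ V f, (φ.hom.app V).hom (L.symScalar V f) = (ψ.hom.app V).hom (L.symScalar V f))
    (h' : ∀ V D, (φ.hom.app V).hom (L.symVector V D) = (ψ.hom.app V).hom (L.symVector V D)) :
    φ = ψ := by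
  refine ObjectProperty.hom_ext _ ?_
  refine sheafify_hom_ext _ _ _ (L.grSheaf ω).property ?_
  refine NatTrans.ext (funext fun V => RingCat.hom_ext ?_)
  exact symmetricAlgebra_hom_ext (h V) (h' V)

end LieAlgebroid

end Isomorphism

end TwistedPBW

theorem theorem4p5 {K : Type u} [Field K] [CharZero K]
    (X : AlgebraicGeometry.RingedSpace.{u, u}) [TwistedPBW.StructureAlgebra K X]
    (L : TwistedPBW.LieAlgebroid K X) (hL : L.module.IsLocallyFree) (ω : L.Cocycle) :
    ∃! φ : L.symSheaf ≅ L.grSheaf ω,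
      (∀ V f, (φ.hom.hom.app V).hom (L.symScalar V f) = L.grScalar ω V f) ∧
      (∀ n V s, s ∈ L.symDegree n V ↔ (φ.hom.hom.app V).hom s ∈ L.grDegree ω n V) ∧
      (∀ V k (D : Fin k → L.Sec V),
        (φ.hom.hom.app V).hom (List.ofFn fun j => L.symVector V (D j)).prod =
          L.symbol ω k V (L.symmetrized ω V D)) := by
  have hiso := L.isIso_symSheafToGrSheaf ω hL
  refine ⟨CategoryTheory.asIso (L.symSheafToGrSheaf ω), ⟨L.symSheafToGrSheaf_scalar ω,
    fun n V s => ⟨L.symSheafToGrSheaf_mem_grDegree ω, L.mem_symDegree_of_mem_grDegree ω hL⟩,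
    fun V k D => L.symSheafToGrSheaf_prod ω V D⟩, ?_⟩
  -- Functions and the products with `k = 1` already determine the morphism, by `symSheaf_hom_ext`.
  rintro φ ⟨h₁, -, h₂⟩
  refine CategoryTheory.Iso.ext (L.symSheaf_hom_ext ω (fun V f => ?_) fun V D => ?_)
  · exact (h₁ V f).trans (L.symSheafToGrSheaf_scalar ω V f).symm
  · change _ = ((L.symSheafToGrSheaf ω).hom.app V).hom (L.symVector V D)
    have h := (h₂ V 1 fun _ => D).trans (L.symSheafToGrSheaf_prod ω V fun _ => D).symm
    simpa only [List.ofFn_succ, List.ofFn_zero, List.prod_singleton] using h
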